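/- Let $\mathbb{T}=\mathbb{R}/2\pi\mathbb{Z}$ and $0<s_0\le 2$. Let $T>0$, let $u_0\in H^{s_0}(\mathbb{T})$, and let $u\in C([0,T],H^{s_0}(\mathbb{T}))$ be the solution of the cubic nonlinear Schrödinger equation $$ i\partial_t u=-\partial_x^2u+|u|^2u,\qquad u(0)=u_0, $$ that is, $u\in C([0,T],H^{s_0}(\mathbb{T}))\cap L^4((0,T)\times\mathbb{T})$ and Duhamel's formula $$u(t)=e^{it\partial_x^2}u_0-i\int_0^t e^{i(t-s)\partial_x^2}\big(|u(s)|^2u(s)\big)\,ds$$ holds for all $t\in[0,T]$. For $\tau>0$ let $\Pi_\tau$ be the projection onto the frequencies $|k|\le\tau^{-1/2}$, i.e. $\widehat{\Pi_\tau f}(k)=\mathbf 1_{|k|\le\tau^{-1/2}}\hat f(k)$ for $k\in\mathbb{Z}$, and define the filtered Lie splitting scheme $$ u^0=\Pi_\tau u_0,\qquad u^{n+1}=e^{i\tau\partial_x^2}\,\Pi_\tau\Big(e^{-i\tau|\Pi_\tau u^n|^2}\,\Pi_\tau u^n\Big),\quad n\ge 0. $$ Then there exist $\tau_0>0$ and $C_T>0$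 such that for every step size $\tau\in(0,\tau_0]$ and every integer $n\ge 0$ with $n\tau\le T$, $$ \|u^n-u(n\tau)\|_{L^2(\mathbb{T})}\le C_T\,\tau^{s_0/2}. $$ -/

import Mathlib

open MeasureTheory Filter Topology

noncomputable section

namespace FilteredNLS

instance factTwoPiPos : Fact (0 < 2 * Real.pi) := ⟨Real.two_pi_pos⟩

/-- The torus `𝕋 = ℝ / 2πℤ`. The monomial `fourier k` on it is `x ↦ exp (i k x)`. -/
abbrev Torus : Type := AddCircle (2 * Real.pi)

/-- `L²(𝕋)`, complex valued, for the normalised measure `dx / 2π`. -/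
abbrev L2Torus : Type := Lp ℂ 2 (AddCircle.haarAddCircle : Measure Torus)

/-- Membership in the Sobolev space `H^s(𝕋)`, for `s ≥ 0`. -/
def MemSobolev (s : ℝ) (f : L2Torus) : Prop :=
  Summable fun k : ℤ => (1 + (k : ℝ) ^ 2) ^ s * ‖fourierCoeff (f : Torus → ℂ) k‖ ^ 2

/-- The norm of `H^s(𝕋)` (meaningful for `f` with `MemSobolev s f`). -/
def sobolevNorm (s : ℝ) (f : L2Torus) : ℝ :=
  Real.sqrt (∑' k : ℤ, (1 + (k : ℝ) ^ 2) ^ s * ‖fourierCoeff (f : Torus → ℂ) k‖ ^ 2)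

/-- `u ∈ C([0, T], H^s(𝕋))`. -/
def ContinuousIntoSobolev (s T : ℝ) (u : ℝ → L2Torus) : Prop :=
  (∀ t ∈ Set.Icc 0 T, MemSobolev s (u t)) ∧
    ∀ t₀ ∈ Set.Icc 0 T,
      Tendsto (fun t => sobolevNorm s (u t - u t₀)) (𝓝[Set.Icc 0 T] t₀) (𝓝 0)

/-- The cubic nonlinearity `|f|² f`. -/
def cubic (f : Torus → ℂ) : Torus → ℂ := fun x => ((‖f x‖ ^ 2 : ℝ) : ℂ) * f x

/-- `u ∈ C([0, T], H^s(𝕋))` is the solution of `i ∂ₜ u = - ∂ₓ² u + |u|² u`, `u(0) = u₀`, on `[0, T]`.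

The equation is Duhamel's formula
`u(t) = e^{i t ∂ₓ²} u₀ - i ∫₀ᵗ e^{i (t - r) ∂ₓ²} (|u|² u)(r) dr`, read on each Fourier coefficient.
For small `s` a curve in `H^s(𝕋)` need not have a locally integrable cube, so the solution is
taken, as usual, in the Strichartz class `L⁴((0, T) × 𝕋)`, which contains the Bourgain space
`X^{0,b}` for `b ≥ 3/8`; for `s ≥ 1/4` this holds for all of `C([0, T], H^s(𝕋))`. -/
structure IsNLSSolution (s T : ℝ) (u₀ : L2Torus) (u : ℝ → L2Torus) : Prop where
  continuous_sobolev : ContinuousIntoSobolev s T u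
  strichartz :
    ∫⁻ t in Set.Icc 0 T, ∫⁻ x, ‖(u t : Torus → ℂ) x‖ₑ ^ 4 ∂AddCircle.haarAddCircle < ⊤
  duhamel : ∀ t ∈ Set.Icc 0 T, ∀ k : ℤ,
    fourierCoeff (u t : Torus → ℂ) k =
      Complex.exp (-Complex.I * (t : ℂ) * (k : ℂ) ^ 2) * fourierCoeff (u₀ : Torus → ℂ) k -
        Complex.I * ∫ r in (0 : ℝ)..t,
          Complex.exp (-Complex.I * ((t - r : ℝ) : ℂ) * (k : ℂ) ^ 2) *
            fourierCoeff (cubic (u r : Torus → ℂ)) k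

/-- The frequency filter `Π_K`: keep the frequencies `k` with `|k| ≤ K`. Its values are
trigonometric polynomials. -/
def freqFilter (K : ℝ) (f : Torus → ℂ) : C(Torus, ℂ) :=
  ∑ k ∈ Finset.Icc (-⌊K⌋) ⌊K⌋, fourierCoeff f k • (fourier k : C(Torus, ℂ))

/-- The filter `Π_τ = Π_K` with `K = τ^{-1/2}`. -/
def stepFilter (τ : ℝ) (f : Torus → ℂ) : C(Torus, ℂ) :=
  freqFilter (τ ^ (-(1 / 2) : ℝ)) f

theorem norm_schrodinger_symbol (t : ℝ) (k : ℤ) :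
    ‖Complex.exp (-Complex.I * (t : ℂ) * (k : ℂ) ^ 2)‖ = 1 := by
  have h : -Complex.I * (t : ℂ) * (k : ℂ) ^ 2 = ((-(t * (k : ℝ) ^ 2) : ℝ) : ℂ) * Complex.I := by
    push_cast
    ring
  rw [h, Complex.norm_exp_ofReal_mul_I]

theorem memℓp_schrodinger (t : ℝ) (a : lp (fun _ : ℤ => ℂ) 2) :
    Memℓp (fun k : ℤ => Complex.exp (-Complex.I * (t : ℂ) * (k : ℂ) ^ 2) * a k) 2 := by
  rw [← memℓp_norm_iff]
  simp only [norm_mul, norm_schrodinger_symbol, one_mul]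
  exact memℓp_norm_iff.mpr (lp.memℓp a)

/-- The free Schrödinger group `e^{i t ∂ₓ²}` on `L²(𝕋)`: the Fourier multiplier
`exp (- i t k²)`. -/
def schrodingerFlow (t : ℝ) (f : L2Torus) : L2Torus :=
  fourierBasis.repr.symm ⟨_, memℓp_schrodinger t (fourierBasis.repr f)⟩

/-- The flow `w ↦ e^{- i τ |w|²} w` of `i ∂ₜ w = |w|² w`. -/
def phaseFlow (τ : ℝ) (w : C(Torus, ℂ)) : C(Torus, ℂ) where
  toFun x := Complex.exp (-Complex.I * (τ : ℂ) * ((‖w x‖ ^ 2 : ℝ) : ℂ)) * w x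
  continuous_toFun := by fun_prop

/-- A continuous function as an element of `L²(𝕋)`. -/
def toL2 (w : C(Torus, ℂ)) : L2Torus :=
  ContinuousMap.toLp (E := ℂ) 2 AddCircle.haarAddCircle ℂ w

/-- The filtered Lie splitting scheme with step size `τ`:
`u^{n+1} = e^{i τ ∂ₓ²} Π_τ (e^{- i τ |Π_τ u^n|²} Π_τ u^n)`, `u^0 = Π_τ u₀`. -/
def filteredLie (τ : ℝ) (u₀ : L2Torus) : ℕ → L2Torus
  | 0 => toL2 (stepFilter τ u₀)
  | n + 1 =>
    schrodingerFlow τ (toL2 (stepFilter τ (phaseFlow τ (stepFilter τ (filteredLie τ u₀ n)))))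

end FilteredNLS

end

noncomputable section

namespace FilteredNLS

open scoped ComplexConjugate ENNReal

/-! ### Lattice sums -/

/-! For small $s_0$ the cubic term is out of reach of Sobolev embedding, and everything rests on
Bourgain's periodic $L^4$ Strichartz estimate on $(a,b]\times\mathbb T$, here with a gain
$(b-a)^{1/8}$ (`integral_norm_mode_freeMul_pow_le`, `homBound_freeMul`). Duality gives an
$L^{4/3}\to\ell^2$ bound. A dyadic splitting of time, whose cost is a geometric series thanks to the
gain, gives the retarded Duhamel estimate (`RetBound.concat`, `retBound_dyadic`).

The scheme fits into the same framework. In the interaction picture its Fourier coefficients obey a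
recursion which is exactly a Duhamel integral with piecewise constant forcing and with phases frozen
on the time grid (`DuhamelSeq.eq_integral`). The filter keeps only $\tau k^2\le1$, so the frozen
phase is the free phase times a power series in $\tau k^2$ with separated variables. It therefore
inherits the Strichartz estimate, and the difference of the two phases is $k^2$ times a multiplier
whose Strichartz constant is $O(\tau)$ (`homBound_of_expansion`, `homBound_diffMul`).

Freezing phases thus costs $\tau$ times two derivatives of the numerical solution. The data have
only $s_0$ derivatives, but after filtering the second derivatives have size $O(\tau^{s_0/2-1})$
(`mul_energy_zero_le`), and trilinear Strichartz estimates propagate this `energy` over blocks of a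
length independent of $\tau$ (`Trajectory.energy_le`). Hence $\tau\cdot$`energy` stays
$O(\tau^{s_0/2})$ up to time $T$ (`exists_mul_energy_le`).

On one block the two flows are compared both in $L^4$ and in $\ell^2$
(`Trajectory.lpNorm_profile_sub_solution_le`, `Trajectory.l2_sub_le`). The frequencies of the exact
solution above $\tau^{-1/2}$ are $O(\tau^{s_0/2})$ in $L^2$ by Sobolev regularity, and in $L^4$
because the cube of a trigonometric polynomial triples its degree at most
(`Solution.lpNorm_tail_le`). On a short block the feedback of the error through the nonlinearity is
absorbed (`Solution.exists_block_error`), and a number of blocks independent of $\tau$ covers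
$[0,T]$ (`le_of_block_bound`). -/

theorem sum_range_inv_one_add_sq_le {h : ℝ} (hh : 0 < h) (n : ℕ) :
    ∑ j ∈ Finset.range n, 1 / (1 + h ^ 2 * ((j : ℝ) + 1) ^ 2) ≤ 2 / h := by
  have key : ∀ n : ℕ, ∑ j ∈ Finset.range n, 1 / (1 + h ^ 2 * ((j : ℝ) + 1) ^ 2)
      ≤ (2 / h) * (1 - 1 / (1 + h * n)) := by
    intro n
    induction n with
    | zero => simp
    | succ n ih =>
      rw [Finset.sum_range_succ]
      have hn : (0 : ℝ) ≤ n := n.cast_nonneg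
      have h1 : (0 : ℝ) < 1 + h * n := by positivity
      have h2 : (0 : ℝ) < 1 + h * (n + 1) := by positivity
      -- With $x=h(n+1)$ this is $(1+x-h)(1+x)\le(1+x)^2\le2(1+x^2)$: each term is dominated by a
      -- telescoping difference.
      have h3 : 1 / (1 + h ^ 2 * ((n : ℝ) + 1) ^ 2) ≤
          (2 / h) * (1 / (1 + h * n) - 1 / (1 + h * (n + 1))) := by
        have : (2 / h) * (1 / (1 + h * n) - 1 / (1 + h * (n + 1))) =
            2 / ((1 + h * n) * (1 + h * (n + 1))) := by field_simp; ring
        rw [this, div_le_div_iff₀ (by positivity) (by positivity)]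
        nlinarith [sq_nonneg (1 - h * ((n : ℝ) + 1)), mul_pos hh h2]
      push_cast
      linarith
  refine (key n).trans ?_
  have : (0 : ℝ) ≤ 1 / (1 + h * n) := by positivity
  have h2 : 0 < 2 / h := by positivity
  nlinarith

/-- Riemann sum of $1/(1+x^2)$ with mesh $h$, uniform in the centre $k$ and in the finite set. The
index $0$ is counted in both half-lines, whence the $2$. It serves both the Strichartz kernel and
Agmon's inequality. -/
theorem sum_int_inv_one_add_sq_le {h : ℝ} (hh : 0 < h) (A : Finset ℤ) (k : ℤ) :
    ∑ j ∈ A, 1 / (1 + h ^ 2 * ((j : ℝ) - k) ^ 2) ≤ 2 + 4 / h := by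
  have key : ∀ A : Finset ℤ, ∑ j ∈ A, 1 / (1 + h ^ 2 * (j : ℝ) ^ 2) ≤ 2 + 4 / h := by
    intro A
    obtain ⟨n, hn⟩ : ∃ n : ℕ, ∀ j ∈ A, j.natAbs < n + 1 :=
      ⟨A.sup Int.natAbs, fun j hj => Nat.lt_succ_of_le (Finset.le_sup (f := Int.natAbs) hj)⟩
    have hrange : ∑ j ∈ Finset.range (n + 1), 1 / (1 + h ^ 2 * (j : ℝ) ^ 2) ≤ 1 + 2 / h := by
      rw [Finset.sum_range_succ']
      have := sum_range_inv_one_add_sq_le hh n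
      push_cast
      simp only [ne_eq, OfNat.ofNat_ne_zero, not_false_eq_true, zero_pow, mul_zero, add_zero,
        div_one]
      linarith
    calc ∑ j ∈ A, 1 / (1 + h ^ 2 * (j : ℝ) ^ 2)
        ≤ ∑ j ∈ (Finset.range (n + 1)).image (fun i : ℕ => (i : ℤ)) ∪
            (Finset.range (n + 1)).image (fun i : ℕ => -(i : ℤ)),
            1 / (1 + h ^ 2 * (j : ℝ) ^ 2) := by
          refine Finset.sum_le_sum_of_subset_of_nonneg ?_ (fun _ _ _ => by positivity)
          intro j hj
          have := hn j hj
          simp only [Finset.mem_union, Finset.mem_image, Finset.mem_range]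
          rcases Int.natAbs_eq j with h | h
          · exact Or.inl ⟨_, this, h.symm⟩
          · exact Or.inr ⟨_, this, h.symm⟩
      _ ≤ ∑ j ∈ (Finset.range (n + 1)).image (fun i : ℕ => (i : ℤ)), 1 / (1 + h ^ 2 * (j : ℝ) ^ 2) +
            ∑ j ∈ (Finset.range (n + 1)).image (fun i : ℕ => -(i : ℤ)),
              1 / (1 + h ^ 2 * (j : ℝ) ^ 2) := by
          rw [← Finset.sum_union_inter]
          exact le_add_of_nonneg_right (Finset.sum_nonneg fun _ _ => by positivity)
      _ ≤ 2 + 4 / h := by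
          rw [Finset.sum_image (by intro a _ b _; simp), Finset.sum_image (by intro a _ b _; simp)]
          push_cast
          simp only [neg_sq]
          have : 4 / h = 2 / h + 2 / h := by ring
          linarith
  have := key (A.image (fun j => j - k))
  rw [Finset.sum_image (by intro a _ b _; simp)] at this
  simpa using this

/-! ### The characters of the torus -/

/-- The Haar probability measure of the torus. -/
abbrev haarT : Measure Torus := AddCircle.haarAddCircle

/-- The character `x ↦ exp (i k x)`. -/
def expi (k : ℤ) (x : Torus) : ℂ := fourier k x

theorem continuous_expi (k : ℤ) : Continuous (expi k) := (fourier k).continuous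

theorem norm_expi (k : ℤ) (x : Torus) : ‖expi k x‖ = 1 := Circle.norm_coe _

theorem expi_add (m n : ℤ) (x : Torus) : expi (m + n) x = expi m x * expi n x := fourier_add

theorem conj_expi (k : ℤ) (x : Torus) : conj (expi k x) = expi (-k) x := fourier_neg.symm

theorem expi_zero (x : Torus) : expi 0 x = 1 := fourier_zero

theorem fourierCoeff_eq_integral (f : Torus → ℂ) (k : ℤ) :
    fourierCoeff f k = ∫ x, expi (-k) x * f x ∂haarT := rfl

theorem integral_expi (k : ℤ) : ∫ x, expi k x ∂haarT = if k = 0 then 1 else 0 := by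
  have h := congrFun (fourierCoeff_fourier (T := 2 * Real.pi) k) 0
  rw [fourierCoeff_eq_integral] at h
  simp only [neg_zero, expi_zero, one_mul] at h
  rw [show (∫ x, expi k x ∂haarT) = ∫ x, fourier k x ∂haarT from rfl, h]
  by_cases hk : k = 0
  · simp [hk]
  · rw [if_neg hk, Pi.single_eq_of_ne (Ne.symm hk)]

theorem fourierCoeff_expi (j k : ℤ) : fourierCoeff (expi j) k = if k = j then 1 else 0 := by
  rw [fourierCoeff_eq_integral]
  simp_rw [← expi_add]
  rw [integral_expi]
  simp only [neg_add_eq_zero]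

/-! ### Space-time slabs -/

/-- The measure of the space-time slab `(a, b] × 𝕋`. -/
def slab (a b : ℝ) : Measure (ℝ × Torus) := (volume.restrict (Set.Ioc a b)).prod haarT

instance (a b : ℝ) : IsFiniteMeasure (slab a b) := by unfold slab; infer_instance

theorem slab_univ (a b : ℝ) : slab a b Set.univ = ENNReal.ofReal (b - a) := by
  unfold slab
  rw [← Set.univ_prod_univ, Measure.prod_prod]
  simp

/-- The `ℓ²` norm of the coefficients in `A`. -/
def l2 (A : Finset ℤ) (d : ℤ → ℂ) : ℝ := Real.sqrt (∑ k ∈ A, ‖d k‖ ^ 2)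

theorem l2_nonneg (A : Finset ℤ) (d : ℤ → ℂ) : 0 ≤ l2 A d := Real.sqrt_nonneg _

theorem l2_sq (A : Finset ℤ) (d : ℤ → ℂ) : l2 A d ^ 2 = ∑ k ∈ A, ‖d k‖ ^ 2 :=
  Real.sq_sqrt (Finset.sum_nonneg fun _ _ => by positivity)

theorem l2_mono {A : Finset ℤ} {d d' : ℤ → ℂ} (h : ∀ k ∈ A, ‖d k‖ ≤ ‖d' k‖) : l2 A d ≤ l2 A d' :=
  Real.sqrt_le_sqrt (Finset.sum_le_sum fun k hk => by gcongr; exact h k hk)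

theorem l2_eq_norm (A : Finset ℤ) (d : ℤ → ℂ) :
    l2 A d = ‖(WithLp.toLp 2 (fun k : A => d k) : EuclideanSpace ℂ A)‖ := by
  rw [EuclideanSpace.norm_eq, l2, ← Finset.sum_coe_sort A (fun k => ‖d k‖ ^ 2)]

theorem l2_add_le (A : Finset ℤ) (d d' : ℤ → ℂ) : l2 A (fun k => d k + d' k) ≤ l2 A d + l2 A d' := by
  simp only [l2_eq_norm]
  exact norm_add_le (WithLp.toLp 2 (fun k : A => d k) : EuclideanSpace ℂ A)
    (WithLp.toLp 2 (fun k : A => d' k))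

/-- The space-time function `∑ₖ ω(t, k) d(k) exp(i k x)`. -/
def mode (A : Finset ℤ) (ω : ℝ → ℤ → ℂ) (d : ℤ → ℂ) (p : ℝ × Torus) : ℂ :=
  ∑ k ∈ A, ω p.1 k * d k * expi k p.2

/-- Admissible time dependent Fourier multipliers. -/
def IsMultiplier (ω : ℝ → ℤ → ℂ) : Prop :=
  (∀ k, Measurable fun t => ω t k) ∧ ∀ t k, ‖ω t k‖ ≤ 2

theorem measurable_mode {ω : ℝ → ℤ → ℂ} (hω : ∀ k, Measurable fun t => ω t k)
    (A : Finset ℤ) (d : ℤ → ℂ) : Measurable (mode A ω d) := by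
  unfold mode
  refine Finset.measurable_sum _ fun k _ => ?_
  exact ((((hω k).comp measurable_fst).mul_const _)).mul
    ((continuous_expi k).measurable.comp measurable_snd)

theorem norm_mode_le {ω : ℝ → ℤ → ℂ} (hω : ∀ t k, ‖ω t k‖ ≤ 2)
    (A : Finset ℤ) (d : ℤ → ℂ) (p : ℝ × Torus) : ‖mode A ω d p‖ ≤ ∑ k ∈ A, 2 * ‖d k‖ := by
  refine norm_sum_le_of_le _ fun k _ => ?_
  rw [norm_mul, norm_mul, norm_expi, mul_one]
  gcongr
  exact hω _ _

theorem memLp_of_bounded {f : ℝ × Torus → ℂ} (hf : Measurable f) {C : ℝ} (hC : ∀ p, ‖f p‖ ≤ C)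
    (p : ℝ≥0∞) (a b : ℝ) : MemLp f p (slab a b) :=
  MemLp.of_bound hf.aestronglyMeasurable C (Eventually.of_forall hC)

theorem memLp_mode {ω : ℝ → ℤ → ℂ} (hω : IsMultiplier ω) (A : Finset ℤ) (d : ℤ → ℂ)
    (p : ℝ≥0∞) (a b : ℝ) : MemLp (mode A ω d) p (slab a b) :=
  memLp_of_bounded (measurable_mode hω.1 A d) (norm_mode_le hω.2 A d) p a b

theorem lpNorm_four_pow {α : Type*} [MeasurableSpace α] {μ : Measure α} {f : α → ℂ}
    (hf : AEStronglyMeasurable f μ) :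
    lpNorm f 4 μ ^ 4 = ∫ p, ‖f p‖ ^ 4 ∂μ := by
  rw [lpNorm_eq_integral_norm_rpow_toReal (by norm_num) (by norm_num) hf]
  rw [← Real.rpow_natCast, ← Real.rpow_mul (integral_nonneg fun _ => by positivity)]
  norm_num

/-! ### The homogeneous Strichartz estimate -/

/-- The free Schrödinger multiplier. -/
def freeMul (t : ℝ) (k : ℤ) : ℂ := Complex.exp (-Complex.I * (t : ℂ) * (k : ℂ) ^ 2)

theorem norm_freeMul (t : ℝ) (k : ℤ) : ‖freeMul t k‖ = 1 := norm_schrodinger_symbol t k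

theorem isMultiplier_freeMul : IsMultiplier freeMul := by
  refine ⟨fun k => ?_, fun t k => by rw [norm_freeMul]; norm_num⟩
  unfold freeMul
  fun_prop

theorem norm_integral_exp_le {a b : ℝ} (hab : a ≤ b) (m : ℤ) :
    ‖∫ t in a..b, Complex.exp (-Complex.I * (t : ℂ) * (2 * m : ℂ))‖ ≤
      if m = 0 then b - a else min (b - a) (1 / |(m : ℝ)|) := by
  have h1 : ‖∫ t in a..b, Complex.exp (-Complex.I * (t : ℂ) * (2 * m : ℂ))‖ ≤ b - a := by
    have := intervalIntegral.norm_integral_le_of_norm_le_const (a := a) (b := b) (C := 1)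
      (f := fun t : ℝ => Complex.exp (-Complex.I * (t : ℂ) * (2 * m : ℂ))) (fun t _ => by
        rw [show -Complex.I * (t : ℂ) * (2 * m : ℂ) = ((-(2 * m * t) : ℝ) : ℂ) * Complex.I by
          push_cast; ring, Complex.norm_exp_ofReal_mul_I])
    rwa [one_mul, abs_of_nonneg (by linarith)] at this
  split_ifs with hm
  · exact h1
  · refine le_min h1 ?_
    have hc : (-Complex.I * (2 * m : ℂ)) ≠ 0 := by
      simp [hm, Complex.I_ne_zero]
    have : ∀ t : ℝ, Complex.exp (-Complex.I * (t : ℂ) * (2 * m : ℂ)) =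
        Complex.exp ((-Complex.I * (2 * m : ℂ)) * t) := fun t => by ring_nf
    simp_rw [this]
    rw [integral_exp_mul_complex hc, norm_div]
    have hn : ∀ t : ℝ, ‖Complex.exp ((-Complex.I * (2 * m : ℂ)) * t)‖ = 1 := fun t => by
      rw [show (-Complex.I * (2 * m : ℂ)) * t = ((-(2 * m * t) : ℝ) : ℂ) * Complex.I by
          push_cast; ring, Complex.norm_exp_ofReal_mul_I]
    have hd : ‖-Complex.I * (2 * m : ℂ)‖ = 2 * |(m : ℝ)| := by simp
    rw [hd]
    have hmpos : 0 < |(m : ℝ)| := by positivity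
    rw [div_le_div_iff₀ (by positivity) hmpos]
    have := norm_sub_le (Complex.exp ((-Complex.I * (2 * m : ℂ)) * b))
      (Complex.exp ((-Complex.I * (2 * m : ℂ)) * a))
    rw [hn, hn] at this
    nlinarith

/-- Decouples the two factors of the resonance function: $1/|ij|$ is at most $1/\min(|i|,|j|)^2$, so
the kernel is controlled by the smaller factor alone. Each summand on the right has lattice sum
$O(\sqrt\delta)$. -/
theorem kernel_le {δ : ℝ} (hδ : 0 < δ) (i j : ℤ) :
    (if i * j = 0 then δ else min δ (1 / |((i * j : ℤ) : ℝ)|)) ≤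
      2 * δ * (1 / (1 + δ * (i : ℝ) ^ 2)) + 2 * δ * (1 / (1 + δ * (j : ℝ) ^ 2)) := by
  wlog hij : |(i : ℝ)| ≤ |(j : ℝ)| generalizing i j
  · have := this j i (le_of_not_ge hij)
    rw [mul_comm i j, add_comm]
    exact this
  have hpos : 0 ≤ 2 * δ * (1 / (1 + δ * (j : ℝ) ^ 2)) := by positivity
  suffices h : (if i * j = 0 then δ else min δ (1 / |((i * j : ℤ) : ℝ)|)) ≤
      2 * δ * (1 / (1 + δ * (i : ℝ) ^ 2)) by linarith
  have hle : (if i * j = 0 then δ else min δ (1 / |((i * j : ℤ) : ℝ)|)) ≤ δ := by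
    split_ifs
    · exact le_rfl
    · exact min_le_left _ _
  by_cases h1 : δ * (i : ℝ) ^ 2 ≤ 1
  · refine hle.trans ?_
    rw [mul_one_div, le_div_iff₀ (by positivity)]
    nlinarith
  · push Not at h1
    have hi : (i : ℝ) ≠ 0 := by
      rintro h; rw [h] at h1; norm_num at h1
    have hj : (j : ℝ) ≠ 0 := by
      rintro h; rw [h, abs_zero] at hij
      exact hi (abs_eq_zero.mp (le_antisymm hij (abs_nonneg _)))
    rw [if_neg (by simpa using ⟨by exact_mod_cast hi, by exact_mod_cast hj⟩)]
    refine (min_le_right _ _).trans ?_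
    push_cast
    rw [abs_mul]
    have hi' : 0 < |(i : ℝ)| := abs_pos.mpr hi
    have h2 : 1 / (|(i : ℝ)| * |(j : ℝ)|) ≤ 1 / (i : ℝ) ^ 2 := by
      rw [← sq_abs]
      apply one_div_le_one_div_of_le (by positivity)
      nlinarith
    refine h2.trans ?_
    rw [mul_one_div, div_le_div_iff₀ (by positivity) (by positivity)]
    nlinarith

/-- Schur's test for a symmetric kernel: $w_pw_q\le(w_p^2+w_q^2)/2$, and rows and columns have the
same sums. -/
theorem sum_mul_le_of_symm {ι : Type*} (P : Finset ι) (G : ι → ι → ℝ) (w : ι → ℝ) {R : ℝ}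
    (hG : ∀ p ∈ P, ∀ q ∈ P, 0 ≤ G p q) (hsymm : ∀ p ∈ P, ∀ q ∈ P, G p q = G q p)
    (hR : ∀ p ∈ P, ∑ q ∈ P, G p q ≤ R) :
    ∑ p ∈ P, ∑ q ∈ P, w p * w q * G p q ≤ R * ∑ p ∈ P, w p ^ 2 := by
  have h1 : ∑ p ∈ P, ∑ q ∈ P, w p * w q * G p q ≤
      ∑ p ∈ P, ∑ q ∈ P, (w p ^ 2 * G p q / 2 + w q ^ 2 * G q p / 2) := by
    refine Finset.sum_le_sum fun p hp => Finset.sum_le_sum fun q hq => ?_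
    rw [← hsymm p hp q hq]
    nlinarith [hG p hp q hq, mul_nonneg (hG p hp q hq) (sq_nonneg (w p - w q))]
  have h2 : ∑ p ∈ P, ∑ q ∈ P, w p ^ 2 * G p q / 2 ≤ R * (∑ p ∈ P, w p ^ 2) / 2 := by
    rw [Finset.mul_sum, Finset.sum_div]
    refine Finset.sum_le_sum fun p hp => ?_
    rw [← Finset.sum_div, ← Finset.mul_sum]
    have := hR p hp
    nlinarith [sq_nonneg (w p)]
  refine h1.trans ?_
  simp_rw [Finset.sum_add_distrib]
  rw [Finset.sum_comm (f := fun p q => w q ^ 2 * G q p / 2)]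
  linarith

/-- Write $|f|^4=|f^2|^2$ and expand $f^2$ over pairs of frequencies $p=(p_1,p_2)$. Integration in
$x$ leaves only $p_1+p_2=q_1+q_2$, and then the phase $p_1^2+p_2^2-q_1^2-q_2^2$ factors as
$2(p_1-q_1)(q_1-p_2)$. The time integral is bounded by the decoupled kernel and the quadratic form
in $d_{p_1}d_{p_2}$ by Schur's test; given $p$, the pair $q$ is determined by $q_1$. -/
theorem integral_norm_mode_freeMul_pow_le {a b : ℝ} (hab : a < b) (hab' : b - a ≤ 1)
    (A : Finset ℤ) (d : ℤ → ℂ) :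
    ∫ p, ‖mode A freeMul d p‖ ^ 4 ∂(slab a b) ≤ 24 * Real.sqrt (b - a) * l2 A d ^ 4 := by
  set δ := b - a with hδ
  have hδ0 : 0 < δ := by linarith
  set h := Real.sqrt δ with hh
  have hh0 : 0 < h := Real.sqrt_pos.mpr hδ0
  have hh2 : h ^ 2 = δ := Real.sq_sqrt hδ0.le
  have hh1 : h ≤ 1 := Real.sqrt_le_one.mpr hab'
  let P := A ×ˢ A
  let τ : ℤ × ℤ → ℝ → ℂ := fun p t => freeMul t p.1 * freeMul t p.2
  let c : ℤ × ℤ → ℝ × Torus → ℂ := fun p z => d p.1 * d p.2 * (τ p z.1 * expi (p.1 + p.2) z.2)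
  let K : ℤ → ℝ := fun j => 2 * δ * (1 / (1 + δ * (j : ℝ) ^ 2))
  have hK : ∀ j, 0 ≤ K j := fun j => by positivity
  have hKneg : ∀ j, K (-j) = K j := fun j => by simp [K]
  let G : ℤ × ℤ → ℤ × ℤ → ℝ := fun p q =>
    if p.1 + p.2 = q.1 + q.2 then K (p.1 - q.1) + K (q.1 - p.2) else 0
  have hG0 : ∀ p q, 0 ≤ G p q := fun p q => by
    dsimp only [G]; split_ifs
    · exact add_nonneg (hK _) (hK _)
    · exact le_rfl
  have hsq : ∀ z, mode A freeMul d z ^ 2 = ∑ p ∈ P, c p z := by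
    intro z
    rw [sq, mode, Finset.sum_mul_sum, Finset.sum_product]
    refine Finset.sum_congr rfl fun k _ => Finset.sum_congr rfl fun l _ => ?_
    simp only [c, τ, expi_add]
    ring
  have hcc : ∀ p q z, c p z * conj (c q z) = (d p.1 * d p.2 * conj (d q.1 * d q.2)) *
      ((τ p z.1 * conj (τ q z.1)) * expi (p.1 + p.2 - (q.1 + q.2)) z.2) := by
    intro p q z
    simp only [c, map_mul, conj_expi, sub_eq_add_neg]
    rw [expi_add (p.1 + p.2)]
    ring
  have hτ : ∀ p q t, τ p t * conj (τ q t) = Complex.exp (-Complex.I * (t : ℂ) *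
      ((p.1 : ℂ) ^ 2 + p.2 ^ 2 - q.1 ^ 2 - q.2 ^ 2)) := by
    intro p q t
    simp only [τ, freeMul, ← Complex.exp_conj, ← Complex.exp_add]
    congr 1
    simp only [map_add, map_mul, map_neg, Complex.conj_I, Complex.conj_ofReal, map_pow, map_intCast]
    ring
  have hint : ∀ p q, Integrable (fun z => c p z * conj (c q z)) (slab a b) := by
    intro p q
    have hm : Measurable (fun z => c p z * conj (c q z)) := by
      simp_rw [hcc, hτ]
      have := (continuous_expi (p.1 + p.2 - (q.1 + q.2))).measurable
      fun_prop
    refine (memLp_of_bounded hm (C := ‖d p.1 * d p.2 * conj (d q.1 * d q.2)‖) (fun z => ?_) 1 a b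
      ).integrable le_rfl
    rw [hcc, norm_mul, norm_mul (τ p z.1 * conj (τ q z.1)), norm_expi]
    simp [τ, norm_freeMul]
  have hval : ∀ p q, ‖∫ z, c p z * conj (c q z) ∂(slab a b)‖ ≤
      (‖d p.1‖ * ‖d p.2‖) * (‖d q.1‖ * ‖d q.2‖) * G p q := by
    intro p q
    simp_rw [hcc]
    rw [integral_const_mul, slab, integral_prod_mul (fun t => τ p t * conj (τ q t))
      (fun x => expi (p.1 + p.2 - (q.1 + q.2)) x), integral_expi, norm_mul]
    have hn : ‖d p.1 * d p.2 * conj (d q.1 * d q.2)‖ =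
        (‖d p.1‖ * ‖d p.2‖) * (‖d q.1‖ * ‖d q.2‖) := by simp
    rw [hn, norm_mul]
    refine mul_le_mul_of_nonneg_left ?_ (by positivity)
    dsimp only [G]
    by_cases hpq : p.1 + p.2 = q.1 + q.2
    · rw [if_pos (by omega), if_pos hpq, norm_one, mul_one,
        ← intervalIntegral.integral_of_le hab.le]
      have hm : ∀ t, τ p t * conj (τ q t) = Complex.exp (-Complex.I * (t : ℂ) *
          (2 * ((p.1 - q.1) * (q.1 - p.2) : ℤ) : ℂ)) := by
        intro t
        rw [hτ]
        have : (q.2 : ℂ) = p.1 + p.2 - q.1 := by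
          have : q.2 = p.1 + p.2 - q.1 := by omega
          rw [this]; push_cast; ring
        rw [this]
        congr 1
        push_cast
        ring
      simp_rw [hm]
      exact (norm_integral_exp_le hab.le _).trans (kernel_le hδ0 _ _)
    · rw [if_neg (by omega), if_neg hpq]
      simp
  have hrow : ∀ p ∈ P, ∑ q ∈ P, G p q ≤ 24 * h := by
    intro p _
    have hinner : ∀ x ∈ A, ∑ y ∈ A, G p (x, y) ≤ K (p.1 - x) + K (x - p.2) := by
      intro x _
      have : ∀ y, G p (x, y) = if y = p.1 + p.2 - x then K (p.1 - x) + K (x - p.2) else 0 := by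
        intro y
        dsimp only [G]
        refine if_congr ?_ rfl rfl
        omega
      simp_rw [this]
      rw [Finset.sum_ite_eq']
      split_ifs
      · exact le_rfl
      · exact add_nonneg (hK _) (hK _)
    -- The lattice sum gives $4h^2+8h$; the length being at most one, $h\le1$, turns this into a
    -- multiple of $h=\sqrt\delta$.
    have hsumK : ∀ k : ℤ, ∑ x ∈ A, K (x - k) ≤ 12 * h := by
      intro k
      dsimp only [K]
      rw [← Finset.mul_sum]
      have := sum_int_inv_one_add_sq_le hh0 A k
      rw [hh2] at this
      push_cast
      calc 2 * δ * ∑ x ∈ A, 1 / (1 + δ * ((x : ℝ) - k) ^ 2) ≤ 2 * δ * (2 + 4 / h) := by gcongr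
        _ = 4 * h ^ 2 + 8 * h := by rw [← hh2]; field_simp; ring
        _ ≤ 12 * h := by nlinarith
    calc ∑ q ∈ P, G p q = ∑ x ∈ A, ∑ y ∈ A, G p (x, y) := Finset.sum_product _ _ _
      _ ≤ ∑ x ∈ A, (K (p.1 - x) + K (x - p.2)) := Finset.sum_le_sum hinner
      _ = ∑ x ∈ A, K (x - p.1) + ∑ x ∈ A, K (x - p.2) := by
          rw [Finset.sum_add_distrib]
          congr 1
          exact Finset.sum_congr rfl fun x _ => by rw [← hKneg, neg_sub]
      _ ≤ 24 * h := by linarith [hsumK p.1, hsumK p.2]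
  have hsymm : ∀ p q, G p q = G q p := by
    intro p q
    dsimp only [G]
    by_cases hpq : p.1 + p.2 = q.1 + q.2
    · rw [if_pos hpq, if_pos hpq.symm, ← hKneg (p.1 - q.1), neg_sub,
        show q.1 - p.2 = p.1 - q.2 by omega]
    · rw [if_neg hpq, if_neg (Ne.symm hpq)]
  have hw : ∑ p ∈ P, (‖d p.1‖ * ‖d p.2‖) ^ 2 = l2 A d ^ 4 := by
    rw [show l2 A d ^ 4 = l2 A d ^ 2 * l2 A d ^ 2 by ring, l2_sq, Finset.sum_mul_sum,
      Finset.sum_product]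
    simp only [mul_pow]
  have hcomplex : ((∫ z, ‖mode A freeMul d z‖ ^ 4 ∂(slab a b) : ℝ) : ℂ) =
      ∑ p ∈ P, ∑ q ∈ P, ∫ z, c p z * conj (c q z) ∂(slab a b) := by
    rw [← integral_complex_ofReal]
    have : ∀ z, ((‖mode A freeMul d z‖ ^ 4 : ℝ) : ℂ) = ∑ p ∈ P, ∑ q ∈ P, c p z * conj (c q z) := by
      intro z
      rw [← Finset.sum_mul_sum, ← map_sum, ← hsq, Complex.mul_conj, Complex.normSq_eq_norm_sq,
        norm_pow]
      push_cast
      ring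
    simp_rw [this]
    rw [integral_finsetSum _ fun p _ => integrable_finsetSum _ fun q _ => hint p q]
    exact Finset.sum_congr rfl fun p _ => integral_finsetSum _ fun q _ => hint p q
  calc ∫ z, ‖mode A freeMul d z‖ ^ 4 ∂(slab a b)
      ≤ ‖((∫ z, ‖mode A freeMul d z‖ ^ 4 ∂(slab a b) : ℝ) : ℂ)‖ := by
        rw [Complex.norm_real]; exact le_abs_self _
    _ ≤ ∑ p ∈ P, ∑ q ∈ P, (‖d p.1‖ * ‖d p.2‖) * (‖d q.1‖ * ‖d q.2‖) * G p q := by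
        rw [hcomplex]
        exact norm_sum_le_of_le _ fun p _ => norm_sum_le_of_le _ fun q _ => hval p q
    _ ≤ 24 * h * ∑ p ∈ P, (‖d p.1‖ * ‖d p.2‖) ^ 2 :=
        sum_mul_le_of_symm P G (fun p => ‖d p.1‖ * ‖d p.2‖) (fun p _ q _ => hG0 p q)
          (fun p _ q _ => hsymm p q) hrow
    _ = 24 * h * l2 A d ^ 4 := by rw [hw]

/-- The homogeneous Strichartz estimate for the multiplier `ω` on `(a, b]` with constant `C`. -/
def HomBound (A : Finset ℤ) (ω : ℝ → ℤ → ℂ) (a b C : ℝ) : Prop :=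
  ∀ d : ℤ → ℂ, lpNorm (mode A ω d) 4 (slab a b) ≤ C * l2 A d

/-- Fourth root of the preceding bound, with $24\le3^4$. The positive power of the length is what
later makes the dyadic sum converge and the blocks contract. -/
theorem homBound_freeMul {a b : ℝ} (hab : a ≤ b) (hab' : b - a ≤ 1) (A : Finset ℤ) :
    HomBound A freeMul a b (3 * (b - a) ^ (1 / 8 : ℝ)) := by
  intro d
  rcases hab.eq_or_lt with rfl | hab
  · have : slab a a = 0 := by simp [slab]
    rw [this, lpNorm_measure_zero]
    exact mul_nonneg (by positivity) (l2_nonneg _ _)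
  have h0 : 0 < b - a := by linarith
  have hl := l2_nonneg A d
  refine le_of_pow_le_pow_left₀ (n := 4) (by norm_num) (by positivity) ?_
  rw [lpNorm_four_pow (memLp_mode isMultiplier_freeMul A d 4 a b).1]
  refine (integral_norm_mode_freeMul_pow_le hab hab' A d).trans ?_
  have : ((b - a) ^ (1 / 8 : ℝ)) ^ 4 = Real.sqrt (b - a) := by
    rw [← Real.rpow_natCast, ← Real.rpow_mul h0.le, Real.sqrt_eq_rpow]
    norm_num
  rw [mul_pow, mul_pow, this]
  have := Real.sqrt_nonneg (b - a)
  have : 0 ≤ Real.sqrt (b - a) * l2 A d ^ 4 := by positivity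
  nlinarith

/-! ### Auxiliary facts on `L^p` norms -/

instance holderTriple_fourThirds_four_one : ENNReal.HolderTriple (4 / 3) 4 1 where
  inv_add_inv_eq_inv := by
    rw [ENNReal.inv_div (by simp) (by simp), inv_one]
    rw [← ENNReal.toReal_eq_toReal_iff' (by finiteness) (by finiteness),
      ENNReal.toReal_add (by finiteness) (by finiteness)]
    norm_num

instance holderTriple_four_four_two : ENNReal.HolderTriple 4 4 2 where
  inv_add_inv_eq_inv := by
    rw [← ENNReal.toReal_eq_toReal_iff' (by finiteness) (by finiteness),
      ENNReal.toReal_add (by finiteness) (by finiteness)]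
    norm_num

instance holderTriple_two_four_fourThirds : ENNReal.HolderTriple 2 4 (4 / 3) where
  inv_add_inv_eq_inv := by
    rw [ENNReal.inv_div (by simp) (by simp)]
    rw [← ENNReal.toReal_eq_toReal_iff' (by finiteness) (by finiteness),
      ENNReal.toReal_add (by finiteness) (by finiteness)]
    norm_num

theorem one_le_fourThirds : (1 : ℝ≥0∞) ≤ 4 / 3 := by
  rw [ENNReal.le_div_iff_mul_le (by simp) (by simp)]
  norm_num

section LpNorm

variable {α : Type*} [MeasurableSpace α] {μ : Measure α}

theorem lpNorm_mul_le {f g : α → ℂ} {p q r : ℝ≥0∞} [ENNReal.HolderTriple p q r]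
    (hf : MemLp f p μ) (hg : MemLp g q μ) :
    lpNorm (fun x => f x * g x) r μ ≤ lpNorm f p μ * lpNorm g q μ := by
  have h : MemLp (fun x => f x * g x) r μ := hg.mul' hf
  rw [← toReal_eLpNorm h.1, ← toReal_eLpNorm hf.1, ← toReal_eLpNorm hg.1, ← ENNReal.toReal_mul]
  exact ENNReal.toReal_mono (ENNReal.mul_ne_top hf.2.ne hg.2.ne)
    (eLpNorm_smul_le_mul_eLpNorm (φ := f) (f := g) hg.1 hf.1)

theorem lpNorm_mono_ae {f : α → ℂ} {g : α → ℝ} {p : ℝ≥0∞} (hg : MemLp g p μ)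
    (h : ∀ᵐ x ∂μ, ‖f x‖ ≤ g x) : lpNorm f p μ ≤ lpNorm g p μ := by
  by_cases hf : AEStronglyMeasurable f μ
  · rw [← toReal_eLpNorm hf, ← toReal_eLpNorm hg.1]
    exact ENNReal.toReal_mono hg.2.ne (eLpNorm_mono_ae_real h)
  -- Without measurability `lpNorm` takes the value $0$, so no assumption on $f$ is needed.
  · rw [lpNorm_of_not_aestronglyMeasurable hf]
    exact lpNorm_nonneg

theorem lpNorm_congr {f g : α → ℂ} {p : ℝ≥0∞} (h : f =ᵐ[μ] g) : lpNorm f p μ = lpNorm g p μ := by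
  by_cases hf : AEStronglyMeasurable f μ
  · rw [← toReal_eLpNorm hf, ← toReal_eLpNorm (hf.congr h), eLpNorm_congr_ae h]
  · rw [lpNorm_of_not_aestronglyMeasurable hf,
      lpNorm_of_not_aestronglyMeasurable fun hg => hf (hg.congr h.symm)]

theorem norm_integral_mul_le {f g : α → ℂ} {p q : ℝ≥0∞} [ENNReal.HolderTriple p q 1]
    (hf : MemLp f p μ) (hg : MemLp g q μ) :
    ‖∫ x, f x * g x ∂μ‖ ≤ lpNorm f p μ * lpNorm g q μ := by
  have h : MemLp (fun x => f x * g x) 1 μ := hg.mul' hf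
  refine (norm_integral_le_integral_norm _).trans ?_
  rw [← lpNorm_one_eq_integral_norm h.1]
  exact lpNorm_mul_le hf hg

/-- Fatou's lemma; it also delivers the membership of the limit in $L^p$. -/
theorem lpNorm_le_of_tendsto {f : ℕ → α → ℂ} {g : α → ℂ} {p : ℝ≥0∞} {C : ℝ} (hC : 0 ≤ C)
    (hf : ∀ n, MemLp (f n) p μ) (hle : ∀ n, lpNorm (f n) p μ ≤ C)
    (hlim : ∀ᵐ x ∂μ, Tendsto (fun n => f n x) atTop (𝓝 (g x))) :
    MemLp g p μ ∧ lpNorm g p μ ≤ C := by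
  have hg : AEStronglyMeasurable g μ :=
    aestronglyMeasurable_of_tendsto_ae atTop (fun n => (hf n).1) hlim
  have h : eLpNorm g p μ ≤ ENNReal.ofReal C := by
    refine (Lp.eLpNorm_lim_le_liminf_eLpNorm (fun n => (hf n).1) g hlim).trans ?_
    refine liminf_le_of_le (by isBoundedDefault) fun b hb => ?_
    obtain ⟨n, hn⟩ := hb.exists
    refine hn.trans ?_
    rw [← ofReal_lpNorm (hf n)]
    exact ENNReal.ofReal_le_ofReal (hle n)
  refine ⟨⟨hg, h.trans_lt ENNReal.ofReal_lt_top⟩, ?_⟩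
  rw [← toReal_eLpNorm hg]
  exact ENNReal.toReal_le_of_le_ofReal hC h

theorem lpNorm_mul_bounded_le {f c : α → ℂ} {p : ℝ≥0∞} {β : ℝ} (hβ : 0 ≤ β)
    (hf : MemLp f p μ) (hc : ∀ x, ‖c x‖ ≤ β) :
    lpNorm (fun x => c x * f x) p μ ≤ β * lpNorm f p μ := by
  have h1 : MemLp (fun x => β * ‖f x‖) p μ := hf.norm.const_mul β
  refine (lpNorm_mono_real h1 fun x => ?_).trans ?_
  · rw [norm_mul]; gcongr; exact hc x
  · have := lpNorm_const_smul (p := p) β (fun x => ‖f x‖) μ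
    rw [lpNorm_norm hf.1] at this
    rw [show (fun x => β * ‖f x‖) = β • fun x => ‖f x‖ from rfl, this]
    simp [abs_of_nonneg hβ]

end LpNorm

/-! ### Multipliers attached to a step size -/

/-- The largest multiple of `τ` which is strictly smaller than `t`. -/
def stepTime (τ t : ℝ) : ℝ := τ * (⌈t / τ⌉ - 1)

theorem measurable_stepTime (τ : ℝ) : Measurable (stepTime τ) := by
  unfold stepTime
  have : Measurable fun t : ℝ => (⌈t / τ⌉ : ℝ) :=
    (measurable_from_top (f := fun n : ℤ => (n : ℝ))).comp
      (Int.measurable_ceil.comp (measurable_id.div_const τ))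
  fun_prop

theorem stepTime_lt {τ : ℝ} (hτ : 0 < τ) (t : ℝ) : stepTime τ t < t := by
  have := Int.ceil_lt_add_one (t / τ)
  unfold stepTime
  calc τ * (⌈t / τ⌉ - 1) < τ * (t / τ) := by gcongr; linarith
    _ = t := by field_simp

theorem le_stepTime_add {τ : ℝ} (hτ : 0 < τ) (t : ℝ) : t ≤ stepTime τ t + τ := by
  have := Int.le_ceil (t / τ)
  unfold stepTime
  calc t = τ * (t / τ) := by field_simp
    _ ≤ τ * ⌈t / τ⌉ := by gcongr
    _ = _ := by ring

theorem stepTime_eq {τ : ℝ} (hτ : 0 < τ) {n : ℕ} {t : ℝ}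
    (ht : t ∈ Set.Ioc (n * τ) ((n + 1) * τ)) : stepTime τ t = n * τ := by
  have : ⌈t / τ⌉ = (n : ℤ) + 1 := by
    rw [Int.ceil_eq_iff]
    push_cast
    rw [lt_div_iff₀ hτ, div_le_iff₀ hτ]
    constructor
    · linarith [ht.1]
    · exact ht.2
  rw [stepTime, this]
  push_cast
  ring

theorem le_stepTime {τ : ℝ} (hτ : 0 < τ) {n : ℕ} {t : ℝ} (ht : n * τ < t) : n * τ ≤ stepTime τ t := by
  have : (n : ℤ) < ⌈t / τ⌉ := by
    rw [Int.lt_ceil, lt_div_iff₀ hτ]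
    exact_mod_cast ht
  have h2 : (n : ℝ) ≤ ⌈t / τ⌉ - 1 := by
    have : (n : ℤ) ≤ ⌈t / τ⌉ - 1 := by omega
    exact_mod_cast this
  unfold stepTime
  nlinarith

/-- The free multiplier frozen at the last grid point. -/
def stepMul (τ t : ℝ) (k : ℤ) : ℂ := freeMul (stepTime τ t) k

/-- The increment of the free multiplier since the last grid point, divided by `k²`. -/
def diffMul (τ t : ℝ) (k : ℤ) : ℂ := (freeMul t k - stepMul τ t k) / (k : ℂ) ^ 2

theorem norm_stepMul (τ t : ℝ) (k : ℤ) : ‖stepMul τ t k‖ = 1 := norm_freeMul _ _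

theorem isMultiplier_stepMul (τ : ℝ) : IsMultiplier (stepMul τ) :=
  ⟨fun k => (isMultiplier_freeMul.1 k).comp (measurable_stepTime τ),
    fun _ _ => isMultiplier_freeMul.2 _ _⟩

theorem isMultiplier_diffMul (τ : ℝ) : IsMultiplier (diffMul τ) := by
  refine ⟨fun k => ((isMultiplier_freeMul.1 k).sub ((isMultiplier_stepMul τ).1 k)).div_const _,
    fun t k => ?_⟩
  rw [diffMul, norm_div]
  have h1 : ‖freeMul t k - stepMul τ t k‖ ≤ 2 := by
    refine (norm_sub_le _ _).trans ?_
    rw [norm_freeMul, norm_stepMul]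
    norm_num
  rcases eq_or_ne k 0 with rfl | hk
  · simp
  · have h2 : 1 ≤ ‖(k : ℂ) ^ 2‖ := by
      rw [norm_pow, Complex.norm_intCast]
      have : (1 : ℝ) ≤ |(k : ℝ)| := by exact_mod_cast Int.one_le_abs hk
      exact one_le_pow₀ this
    exact (div_le_self (norm_nonneg _) h2).trans h1

/-- At $k=0$ both phases equal $1$, so the division by $k^2$ loses nothing. This identity trades the
difference between free and frozen phases for two derivatives. -/
theorem diffMul_mul_sq (τ t : ℝ) (k : ℤ) :
    diffMul τ t k * (k : ℂ) ^ 2 = freeMul t k - stepMul τ t k := by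
  rcases eq_or_ne k 0 with rfl | hk
  · simp [stepMul, freeMul]
  · have : (k : ℂ) ≠ 0 := by exact_mod_cast hk
    rw [diffMul]
    field_simp

theorem freeMul_add (s t : ℝ) (k : ℤ) : freeMul (s + t) k = freeMul s k * freeMul t k := by
  unfold freeMul
  rw [← Complex.exp_add]
  push_cast
  ring_nf

theorem hasSum_cexp (z : ℂ) : HasSum (fun j : ℕ => z ^ j / (j.factorial : ℂ)) (Complex.exp z) := by
  rw [Complex.exp_eq_exp_ℂ]
  exact NormedSpace.expSeries_div_hasSum_exp z

/-- Transference: when $\omega/$`freeMul` is a series $\sum_j c_j(t)m_j(k)$ with separated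
variables, $c_j$ leaves the $L^4$ norm as a bounded factor, $m_j$ only shrinks the coefficients, and
the constants add up to $\beta\sum_j 1/j!\le3\beta$. -/
theorem homBound_of_expansion {A : Finset ℤ} {ω : ℝ → ℤ → ℂ} {a b C β : ℝ} (hC : 0 ≤ C) (hβ : 0 ≤ β)
    (hfree : HomBound A freeMul a b C) (c : ℕ → ℝ → ℂ) (m : ℕ → ℤ → ℂ)
    (hc : ∀ j, Measurable (c j)) (hcb : ∀ j t, ‖c j t‖ ≤ β / (j.factorial : ℝ))
    (hm : ∀ j, ∀ k ∈ A, ‖m j k‖ ≤ 1)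
    (hsum : ∀ t, ∀ k ∈ A, HasSum (fun j => freeMul t k * (c j t * m j k)) (ω t k)) :
    HomBound A ω a b (3 * β * C) := by
  intro d
  have hl := l2_nonneg A d
  let g : ℕ → ℝ × Torus → ℂ := fun j p => c j p.1 * mode A freeMul (fun k => m j k * d k) p
  have hg : ∀ j, MemLp (g j) 4 (slab a b) := by
    intro j
    refine memLp_of_bounded (((hc j).comp measurable_fst).mul
      (measurable_mode isMultiplier_freeMul.1 A _)) (C := β / (j.factorial : ℝ) *
        ∑ k ∈ A, 2 * ‖m j k * d k‖) (fun p => ?_) 4 a b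
    refine (norm_mul_le _ _).trans ?_
    gcongr
    · exact hcb j p.1
    · exact norm_mode_le isMultiplier_freeMul.2 A _ p
  have hgn : ∀ j, lpNorm (g j) 4 (slab a b) ≤ β * C * l2 A d * (1 ^ j / (j.factorial : ℝ)) := by
    intro j
    refine (lpNorm_mul_bounded_le (by positivity)
      (memLp_mode isMultiplier_freeMul A (fun k => m j k * d k) 4 a b) (fun p => hcb j p.1)).trans ?_
    have h1 := hfree (fun k => m j k * d k)
    have h2 : l2 A (fun k => m j k * d k) ≤ l2 A d := l2_mono fun k hk => by
      rw [norm_mul]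
      exact mul_le_of_le_one_left (norm_nonneg _) (hm j k hk)
    calc β / (j.factorial : ℝ) * lpNorm (mode A freeMul fun k => m j k * d k) 4 (slab a b)
        ≤ β / (j.factorial : ℝ) * (C * l2 A d) := by
          gcongr
          exact h1.trans (by gcongr)
      _ = _ := by rw [one_pow]; ring
  refine (lpNorm_le_of_tendsto (f := fun J => ∑ j ∈ Finset.range J, g j) (by positivity)
    (fun J => memLp_finsetSum' _ fun j _ => hg j) (fun J => ?_) (Eventually.of_forall fun p => ?_)).2
  · refine (lpNorm_sum_le (fun j _ => hg j) (by norm_num)).trans ?_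
    refine (Finset.sum_le_sum fun j _ => hgn j).trans ?_
    rw [← Finset.mul_sum]
    have h3 := Real.sum_le_exp_of_nonneg (x := 1) zero_le_one J
    have h4 := Real.exp_one_lt_three
    have h5 : 0 ≤ β * C * l2 A d := by positivity
    nlinarith
  · have : HasSum (fun j => g j p) (mode A ω d p) := by
      have h := hasSum_sum (s := A) fun k hk => ((hsum p.1 k hk).mul_right (d k)).mul_right (expi k p.2)
      refine h.congr_fun ?_ |> fun h => h
      intro j
      simp only [g, mode, Finset.mul_sum]
      exact Finset.sum_congr rfl fun k _ => by ring
    simpa using this.tendsto_sum_nat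

/-! ### Strichartz estimates for the frozen phase and for the phase difference -/

section

variable {τ : ℝ} (hτ : 0 < τ) {A : Finset ℤ} (hA : ∀ k ∈ A, τ * (k : ℝ) ^ 2 ≤ 1)
include hτ hA

/-- With $\theta=(t-t_n)/\tau\in[0,1]$, where $t_n$ is the last grid point, the correcting phase is
$e^{i\theta\tau k^2}=\sum_j\frac{(i\theta)^j}{j!}(\tau k^2)^j$, and the filter gives $\tau k^2\le1$.
-/
theorem homBound_stepMul {a b C : ℝ} (hC : 0 ≤ C) (hfree : HomBound A freeMul a b C) :
    HomBound A (stepMul τ) a b (3 * C) := by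
  have hs : ∀ t, ‖Complex.I * (((t - stepTime τ t) / τ : ℝ) : ℂ)‖ ≤ 1 := by
    intro t
    rw [norm_mul, Complex.norm_I, one_mul, Complex.norm_real, Real.norm_eq_abs,
      abs_of_nonneg (div_nonneg (by linarith [stepTime_lt hτ t]) hτ.le), div_le_one hτ]
    linarith [le_stepTime_add hτ t]
  have := homBound_of_expansion (ω := stepMul τ) hC zero_le_one hfree
    (fun j t => (Complex.I * (((t - stepTime τ t) / τ : ℝ) : ℂ)) ^ j / (j.factorial : ℂ))
    (fun j k => ((τ * (k : ℝ) ^ 2 : ℝ) : ℂ) ^ j) (fun j => ?_) (fun j t => ?_) (fun j k hk => ?_)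
    (fun t k _ => ?_)
  · simpa using this
  · have := measurable_stepTime τ
    fun_prop
  · rw [norm_div, norm_pow, Complex.norm_natCast]
    gcongr
    exact pow_le_one₀ (norm_nonneg _) (hs t)
  · rw [norm_pow, Complex.norm_real]
    refine pow_le_one₀ (norm_nonneg _) ?_
    rw [Real.norm_eq_abs, abs_of_nonneg (by positivity)]
    exact hA k hk
  · have he : stepMul τ t k = freeMul t k *
        Complex.exp (Complex.I * ((t - stepTime τ t : ℝ) : ℂ) * (k : ℂ) ^ 2) := by
      simp only [stepMul, freeMul, ← Complex.exp_add]
      push_cast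
      ring_nf
    rw [he]
    refine HasSum.mul_left _ ?_
    have hz : Complex.I * ((t - stepTime τ t : ℝ) : ℂ) * (k : ℂ) ^ 2 =
        (Complex.I * (((t - stepTime τ t) / τ : ℝ) : ℂ)) * ((τ * (k : ℝ) ^ 2 : ℝ) : ℂ) := by
      have : (τ : ℂ) ≠ 0 := by exact_mod_cast hτ.ne'
      push_cast
      field_simp
    rw [hz]
    refine (hasSum_cexp _).congr_fun fun j => ?_
    rw [mul_pow]
    ring

/-- The same series without its constant term: every remaining term contains $\tau k^2$, whose $k^2$
cancels the denominator and whose $\tau$ is the gain. -/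
theorem homBound_diffMul {a b C : ℝ} (hC : 0 ≤ C) (hfree : HomBound A freeMul a b C) :
    HomBound A (diffMul τ) a b (3 * τ * C) := by
  have hs : ∀ t, ‖Complex.I * (((t - stepTime τ t) / τ : ℝ) : ℂ)‖ ≤ 1 := by
    intro t
    rw [norm_mul, Complex.norm_I, one_mul, Complex.norm_real, Real.norm_eq_abs,
      abs_of_nonneg (div_nonneg (by linarith [stepTime_lt hτ t]) hτ.le), div_le_one hτ]
    linarith [le_stepTime_add hτ t]
  refine homBound_of_expansion (ω := diffMul τ) hC hτ.le hfree
    (fun j t => -(τ : ℂ) * (Complex.I * (((t - stepTime τ t) / τ : ℝ) : ℂ)) ^ (j + 1) /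
      ((j + 1).factorial : ℂ))
    -- At $k=0$ the quotient defining `diffMul` has the value $0$, while the power would be $1$ for
    -- $j=0$.
    (fun j k => if k = 0 then 0 else ((τ * (k : ℝ) ^ 2 : ℝ) : ℂ) ^ j) (fun j => ?_) (fun j t => ?_)
    (fun j k hk => ?_) (fun t k _ => ?_)
  · have := measurable_stepTime τ
    fun_prop
  · rw [norm_div, norm_mul, norm_pow, Complex.norm_natCast, norm_neg, Complex.norm_real,
      Real.norm_eq_abs, abs_of_pos hτ]
    gcongr
    · exact mul_le_of_le_one_right hτ.le (pow_le_one₀ (norm_nonneg _) (hs t))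
    · omega
  · split_ifs
    · simp
    rw [norm_pow, Complex.norm_real]
    refine pow_le_one₀ (norm_nonneg _) ?_
    rw [Real.norm_eq_abs, abs_of_nonneg (by positivity)]
    exact hA k hk
  · rcases eq_or_ne k 0 with rfl | hk
    · simp [diffMul, hasSum_zero]
    simp only [if_neg hk]
    have he : diffMul τ t k = freeMul t k * (-((k : ℂ) ^ 2)⁻¹ *
        (Complex.exp (Complex.I * ((t - stepTime τ t : ℝ) : ℂ) * (k : ℂ) ^ 2) - 1)) := by
      have : stepMul τ t k = freeMul t k *
          Complex.exp (Complex.I * ((t - stepTime τ t : ℝ) : ℂ) * (k : ℂ) ^ 2) := by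
        simp only [stepMul, freeMul, ← Complex.exp_add]
        push_cast
        ring_nf
      rw [diffMul, this]
      ring
    rw [he]
    refine HasSum.mul_left _ ?_
    have h1 : (τ : ℂ) ≠ 0 := by exact_mod_cast hτ.ne'
    have h2 : (k : ℂ) ≠ 0 := by exact_mod_cast hk
    have hz : Complex.I * ((t - stepTime τ t : ℝ) : ℂ) * (k : ℂ) ^ 2 =
        (Complex.I * (((t - stepTime τ t) / τ : ℝ) : ℂ)) * ((τ * (k : ℝ) ^ 2 : ℝ) : ℂ) := by
      push_cast
      field_simp
    rw [hz]
    have h' := ((hasSum_nat_add_iff' 1).mpr (hasSum_cexp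
      ((Complex.I * (((t - stepTime τ t) / τ : ℝ) : ℂ)) * ((τ * (k : ℝ) ^ 2 : ℝ) : ℂ)))).mul_left
        (-((k : ℂ) ^ 2)⁻¹)
    simp only [Finset.range_one, Finset.sum_singleton, Nat.factorial_zero, Nat.cast_one, div_one,
      pow_zero] at h'
    refine h'.congr_fun fun j => ?_
    rw [mul_pow _ ((τ * (k : ℝ) ^ 2 : ℝ) : ℂ), pow_succ ((τ * (k : ℝ) ^ 2 : ℝ) : ℂ)]
    generalize (Complex.I * (((t - stepTime τ t) / τ : ℝ) : ℂ)) ^ (j + 1) = X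
    push_cast
    field_simp

end

/-! ### Duality and the retarded Strichartz estimate -/

theorem ae_slab_mem (a b : ℝ) : ∀ᵐ p ∂(slab a b), p.1 ∈ Set.Ioc a b := by
  have h : ∀ᵐ t ∂(volume.restrict (Set.Ioc a b)), t ∈ Set.Ioc a b := ae_restrict_mem measurableSet_Ioc
  exact Measure.quasiMeasurePreserving_fst.ae h

theorem slab_add {a m b : ℝ} (h₁ : a ≤ m) (h₂ : m ≤ b) : slab a b = slab a m + slab m b := by
  unfold slab
  rw [← Measure.add_prod, ← Measure.restrict_union (Set.Ioc_disjoint_Ioc_of_le le_rfl)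
    measurableSet_Ioc, Set.Ioc_union_Ioc_eq_Ioc h₁ h₂]

theorem slab_mono {a a' b b' : ℝ} (h₁ : a' ≤ a) (h₂ : b ≤ b') : slab a b ≤ slab a' b' := by
  unfold slab
  exact Measure.prod_mono (Measure.restrict_mono (Set.Ioc_subset_Ioc h₁ h₂) le_rfl) le_rfl

theorem lpNorm_mono_measure' {α : Type*} [MeasurableSpace α] {μ ν : Measure α} {f : α → ℂ}
    {p : ℝ≥0∞} (hf : MemLp f p ν) (h : μ ≤ ν) : lpNorm f p μ ≤ lpNorm f p ν := by
  rw [← toReal_eLpNorm hf.1, ← toReal_eLpNorm (hf.1.mono_measure h)]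
  exact ENNReal.toReal_mono hf.2.ne (eLpNorm_mono_measure f h)

/-- The spatial Fourier coefficient of a space-time function. -/
def coef (F : ℝ × Torus → ℂ) (r : ℝ) (k : ℤ) : ℂ := fourierCoeff (fun x => F (r, x)) k

theorem integrable_expi_mul {F : ℝ × Torus → ℂ} {a b : ℝ} (hF : Integrable F (slab a b)) (k : ℤ) :
    Integrable (fun p : ℝ × Torus => expi (-k) p.2 * F p) (slab a b) :=
  hF.bdd_mul (c := 1) ((continuous_expi (-k)).comp continuous_snd).aestronglyMeasurable
    (Eventually.of_forall fun _ => (norm_expi _ _).le)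

theorem integrable_coef {F : ℝ × Torus → ℂ} {a b : ℝ} (hF : Integrable F (slab a b)) (k : ℤ) :
    Integrable (fun r => coef F r k) (volume.restrict (Set.Ioc a b)) :=
  (integrable_expi_mul hF k).integral_prod_left

theorem IsMultiplier.integrable_mul_coef {ω : ℝ → ℤ → ℂ} (hω : IsMultiplier ω) {F : ℝ × Torus → ℂ}
    {a b : ℝ} (hF : Integrable F (slab a b)) (k : ℤ) :
    Integrable (fun r => conj (ω r k) * coef F r k) (volume.restrict (Set.Ioc a b)) := by
  refine (integrable_coef hF k).bdd_mul (c := 2) ?_ (Eventually.of_forall fun r => ?_)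
  · exact (Complex.continuous_conj.measurable.comp (hω.1 k)).aestronglyMeasurable
  · simpa using hω.2 r k

/-- The adjoint Strichartz estimate for the multiplier `ω` on `(a, b]` with constant `C`. -/
def DualBound (A : Finset ℤ) (ω : ℝ → ℤ → ℂ) (a b C : ℝ) : Prop :=
  ∀ F : ℝ × Torus → ℂ, MemLp F (4 / 3) (slab a b) →
    l2 A (fun k => ∫ r in a..b, conj (ω r k) * coef F r k) ≤ C * lpNorm F (4 / 3) (slab a b)

/-- Duality, tested on the extremal element: pairing $F$ with the mode whose coefficients are $D$
itself gives $\|D\|^2\le\|F\|_{4/3}\,\|\mathrm{mode}\,D\|_4\le C\|F\|_{4/3}\|D\|$. -/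
theorem HomBound.dualBound {A : Finset ℤ} {ω : ℝ → ℤ → ℂ} (hω : IsMultiplier ω) {a b C : ℝ}
    (hab : a ≤ b) (hC : 0 ≤ C) (h : HomBound A ω a b C) : DualBound A ω a b C := by
  intro F hF
  set D : ℤ → ℂ := fun k => ∫ r in a..b, conj (ω r k) * coef F r k with hD
  have hFi : Integrable F (slab a b) := hF.integrable one_le_fourThirds
  have hmode := memLp_mode hω A D 4 a b
  have hmodec : MemLp (fun p => conj (mode A ω D p)) 4 (slab a b) := hmode.star
  have hterm : ∀ k, ∫ p, (conj (D k) * conj (ω p.1 k)) * (expi (-k) p.2 * F p) ∂(slab a b) =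
      conj (D k) * D k := by
    intro k
    have hi : Integrable (fun p : ℝ × Torus => (conj (D k) * conj (ω p.1 k)) *
        (expi (-k) p.2 * F p)) (slab a b) := by
      refine (integrable_expi_mul hFi k).bdd_mul (c := ‖D k‖ * 2) ?_ (Eventually.of_forall fun p => ?_)
      · exact (((Complex.continuous_conj.measurable.comp
          ((hω.1 k).comp measurable_fst))).const_mul _).aestronglyMeasurable
      · rw [norm_mul, RCLike.norm_conj, RCLike.norm_conj]
        gcongr
        exact hω.2 _ _
    unfold slab at hi ⊢
    rw [integral_prod _ hi]
    simp only [integral_const_mul, mul_assoc]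
    congr 1
    simp only [hD]
    rw [intervalIntegral.integral_of_le hab]
    rfl
  have hsum : ((l2 A D ^ 2 : ℝ) : ℂ) = ∫ p, F p * conj (mode A ω D p) ∂(slab a b) := by
    have : ∀ p, F p * conj (mode A ω D p) =
        ∑ k ∈ A, (conj (D k) * conj (ω p.1 k)) * (expi (-k) p.2 * F p) := by
      intro p
      rw [mode, map_sum, Finset.mul_sum]
      refine Finset.sum_congr rfl fun k _ => ?_
      rw [map_mul, map_mul, conj_expi]
      ring
    simp_rw [this]
    rw [integral_finsetSum]
    · simp_rw [hterm]
      rw [l2_sq]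
      push_cast
      refine Finset.sum_congr rfl fun k _ => ?_
      rw [mul_comm, Complex.mul_conj, Complex.normSq_eq_norm_sq]
      push_cast
      rfl
    · intro k _
      refine (integrable_expi_mul hFi k).bdd_mul (c := ‖D k‖ * 2) ?_ (Eventually.of_forall fun p => ?_)
      · exact (((Complex.continuous_conj.measurable.comp
          ((hω.1 k).comp measurable_fst))).const_mul _).aestronglyMeasurable
      · rw [norm_mul, RCLike.norm_conj, RCLike.norm_conj]
        gcongr
        exact hω.2 _ _
  have hle : l2 A D ^ 2 ≤ lpNorm F (4 / 3) (slab a b) * (C * l2 A D) := by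
    calc l2 A D ^ 2 = ‖((l2 A D ^ 2 : ℝ) : ℂ)‖ := by
          rw [Complex.norm_real, Real.norm_of_nonneg (by positivity)]
      _ ≤ lpNorm F (4 / 3) (slab a b) * lpNorm (fun p => conj (mode A ω D p)) 4 (slab a b) := by
          rw [hsum]; exact norm_integral_mul_le hF hmodec
      _ = lpNorm F (4 / 3) (slab a b) * lpNorm (mode A ω D) 4 (slab a b) := by
          congr 1
          exact lpNorm_conj (mode A ω D) 4 (slab a b)
      _ ≤ _ := by gcongr; exacts [lpNorm_nonneg, h D]
  rcases (l2_nonneg A D).eq_or_lt with h0 | h0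
  · rw [← h0]; exact mul_nonneg hC lpNorm_nonneg
  · refine le_of_mul_le_mul_right ?_ h0
    nlinarith

/-- The retarded Duhamel operator `∑ₖ ω₁(t, k) (∫_a^{ρ(t)} conj ω₂(r, k) F̂(r, k) dr) exp(ikx)`. -/
def retarded (A : Finset ℤ) (ω₁ ω₂ : ℝ → ℤ → ℂ) (ρ : ℝ → ℝ) (a : ℝ) (F : ℝ × Torus → ℂ)
    (p : ℝ × Torus) : ℂ :=
  ∑ k ∈ A, ω₁ p.1 k * (∫ r in a..ρ p.1, conj (ω₂ r k) * coef F r k) * expi k p.2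

theorem intervalIntegrable_of_integrable_restrict {g : ℝ → ℂ} {a b s t : ℝ}
    (hg : Integrable g (volume.restrict (Set.Ioc a b))) (hs : s ∈ Set.Icc a b)
    (ht : t ∈ Set.Icc a b) : IntervalIntegrable g volume s t := by
  rw [intervalIntegrable_iff]
  refine IntegrableOn.mono_set hg fun x hx => ?_
  rw [Set.mem_uIoc] at hx
  rcases hx with hx | hx
  · exact ⟨hs.1.trans_lt hx.1, hx.2.trans ht.2⟩
  · exact ⟨ht.1.trans_lt hx.1, hx.2.trans hs.2⟩

/-- Mostly qualitative, to make the norm manipulations legitimate. The pointwise bound depends on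
the cardinality of $A$ and serves only as the starting point of a dyadic subdivision. -/
theorem memLp_retarded {A : Finset ℤ} {ω₁ ω₂ : ℝ → ℤ → ℂ} (hω₁ : IsMultiplier ω₁)
    (hω₂ : IsMultiplier ω₂) {ρ : ℝ → ℝ} (hρ : Measurable ρ) {a b : ℝ}
    (hρab : ∀ t ∈ Set.Ioc a b, ρ t ∈ Set.Icc a b) {F : ℝ × Torus → ℂ}
    (hF : Integrable F (slab a b)) :
    MemLp (retarded A ω₁ ω₂ ρ a F) 4 (slab a b) ∧
      ∀ p, p.1 ∈ Set.Ioc a b → ‖retarded A ω₁ ω₂ ρ a F p‖ ≤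
        4 * A.card * ∫ p, ‖F p‖ ∂(slab a b) := by
  have hcoef : ∀ k r, ‖conj (ω₂ r k) * coef F r k‖ ≤ 2 * ∫ x, ‖F (r, x)‖ ∂haarT := by
    intro k r
    rw [norm_mul, RCLike.norm_conj]
    gcongr
    · exact hω₂.2 r k
    · rw [coef, fourierCoeff_eq_integral]
      refine (norm_integral_le_integral_norm _).trans (le_of_eq ?_)
      congr 1
      ext x
      rw [norm_mul, norm_expi, one_mul]
  have hFn : Integrable (fun r => ∫ x, ‖F (r, x)‖ ∂haarT) (volume.restrict (Set.Ioc a b)) :=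
    hF.norm.integral_prod_left
  have hbound : ∀ p, p.1 ∈ Set.Ioc a b → ‖retarded A ω₁ ω₂ ρ a F p‖ ≤
      4 * A.card * ∫ p, ‖F p‖ ∂(slab a b) := by
    intro p hp
    have hk : ∀ k ∈ A, ‖ω₁ p.1 k * (∫ r in a..ρ p.1, conj (ω₂ r k) * coef F r k) * expi k p.2‖ ≤
        4 * ∫ p, ‖F p‖ ∂(slab a b) := by
      intro k _
      rw [norm_mul, norm_mul, norm_expi, mul_one]
      have h1 : ‖∫ r in a..ρ p.1, conj (ω₂ r k) * coef F r k‖ ≤ 2 * ∫ p, ‖F p‖ ∂(slab a b) := by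
        obtain ⟨h1, h2⟩ := hρab _ hp
        refine (intervalIntegral.norm_integral_le_of_norm_le h1
          (Eventually.of_forall fun r _ => hcoef k r)
          ((intervalIntegrable_iff_integrableOn_Ioc_of_le h1).mpr
            (IntegrableOn.mono_set hFn (Set.Ioc_subset_Ioc_right h2)) |>.const_mul 2)).trans ?_
        · rw [intervalIntegral.integral_const_mul, intervalIntegral.integral_of_le h1]
          have h3 : ∫ p, ‖F p‖ ∂(slab a b) = ∫ r in Set.Ioc a b, ∫ x, ‖F (r, x)‖ ∂haarT :=
            integral_prod _ hF.norm
          rw [h3]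
          gcongr
          exact Eventually.of_forall fun r => integral_nonneg fun _ => norm_nonneg _
      calc ‖ω₁ p.1 k‖ * _ ≤ 2 * (2 * ∫ p, ‖F p‖ ∂(slab a b)) := by
            gcongr
            exact hω₁.2 _ _
        _ = _ := by ring
    refine (norm_sum_le_of_le _ hk).trans (le_of_eq ?_)
    rw [Finset.sum_const, nsmul_eq_mul]
    ring
  refine ⟨?_, hbound⟩
  have hmeas : AEStronglyMeasurable (retarded A ω₁ ω₂ ρ a F) (slab a b) := by
    unfold retarded
    refine Finset.aestronglyMeasurable_fun_sum _ fun k _ => ?_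
    refine AEStronglyMeasurable.mul (AEStronglyMeasurable.mul
      ((hω₁.1 k).comp measurable_fst).aestronglyMeasurable ?_)
      ((continuous_expi k).comp continuous_snd).aestronglyMeasurable
    -- Truncation makes the primitive continuous on all of $\mathbb R$, so that its composition with
    -- the measurable $\rho$ is measurable.
    let g : ℝ → ℂ := (Set.Ioc a b).indicator fun r => conj (ω₂ r k) * coef F r k
    have hg : Integrable g volume :=
      (integrable_indicator_iff measurableSet_Ioc).mpr (hω₂.integrable_mul_coef hF k)
    have hcont : Continuous fun s => ∫ r in a..s, g r :=
      intervalIntegral.continuous_primitive (fun _ _ => hg.intervalIntegrable) a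
    have hm : Measurable fun p : ℝ × Torus => ∫ r in a..ρ p.1, g r :=
      hcont.measurable.comp (hρ.comp measurable_fst)
    refine hm.aestronglyMeasurable.congr ?_
    filter_upwards [ae_slab_mem a b] with p hp
    obtain ⟨h1, h2⟩ := hρab _ hp
    refine intervalIntegral.integral_congr_ae (Eventually.of_forall fun r hr => ?_)
    rw [Set.uIoc_of_le h1] at hr
    exact Set.indicator_of_mem (s := Set.Ioc a b) ⟨hr.1, hr.2.trans h2⟩ _
  refine MemLp.of_bound hmeas (4 * A.card * ∫ p, ‖F p‖ ∂(slab a b)) ?_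
  filter_upwards [ae_slab_mem a b] with p hp using hbound p hp

/-- The retarded Strichartz estimate on `(a, b]` with constant `B`. -/
def RetBound (A : Finset ℤ) (ω₁ ω₂ : ℝ → ℤ → ℂ) (ρ : ℝ → ℝ) (a b B : ℝ) : Prop :=
  ∀ F : ℝ × Torus → ℂ, MemLp F (4 / 3) (slab a b) →
    lpNorm (retarded A ω₁ ω₂ ρ a F) 4 (slab a b) ≤ B * lpNorm F (4 / 3) (slab a b)

theorem lpNorm_slab_rpow_add {f : ℝ × Torus → ℂ} {p : ℝ≥0∞} (hp0 : p ≠ 0) (hp : p ≠ ∞)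
    {a m b : ℝ} (h₁ : a ≤ m) (h₂ : m ≤ b) (hf : MemLp f p (slab a b)) :
    lpNorm f p (slab a b) ^ p.toReal =
      lpNorm f p (slab a m) ^ p.toReal + lpNorm f p (slab m b) ^ p.toReal := by
  have hp' : p.toReal ≠ 0 := (ENNReal.toReal_pos hp0 hp).ne'
  have key : ∀ μ : Measure (ℝ × Torus), MemLp f p μ →
      lpNorm f p μ ^ p.toReal = ∫ x, ‖f x‖ ^ p.toReal ∂μ := by
    intro μ h
    rw [lpNorm_eq_integral_norm_rpow_toReal hp0 hp h.1,
      Real.rpow_inv_rpow (integral_nonneg fun _ => by positivity) hp']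
  have ham := hf.mono_measure (slab_mono le_rfl h₂)
  have hmb := hf.mono_measure (slab_mono h₁ le_rfl)
  rw [key _ hf, key _ ham, key _ hmb, slab_add h₁ h₂]
  exact integral_add_measure (ham.integrable_norm_rpow hp0 hp) (hmb.integrable_norm_rpow hp0 hp)

theorem lpNorm_slab_four_pow_add {f : ℝ × Torus → ℂ} {a m b : ℝ} (h₁ : a ≤ m) (h₂ : m ≤ b)
    (hf : MemLp f 4 (slab a b)) :
    lpNorm f 4 (slab a b) ^ 4 = lpNorm f 4 (slab a m) ^ 4 + lpNorm f 4 (slab m b) ^ 4 := by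
  have h := lpNorm_slab_rpow_add (p := 4) (by simp) (by simp) h₁ h₂ hf
  norm_num at h
  exact h

/-- For $t\le m$ the operator is the one started at $a$; for $t>m$ it is the one started at $m$ plus
the evolution of what was accumulated on $(a,m]$. The two diagonal pieces live at disjoint times and
combine without loss, since $x^{4/3}+y^{4/3}=z^{4/3}$ implies $x^4+y^4\le z^4$. The off-diagonal
piece factors through the adjoint and the homogeneous estimates, at cost $C_1C_2$. -/
theorem RetBound.concat {A : Finset ℤ} {ω₁ ω₂ : ℝ → ℤ → ℂ} (hω₁ : IsMultiplier ω₁)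
    (hω₂ : IsMultiplier ω₂) {ρ : ℝ → ℝ} (hρ : Measurable ρ) {a m b B C₁ C₂ : ℝ}
    (ham : a ≤ m) (hmb : m ≤ b) (hB : 0 ≤ B) (hC₁ : 0 ≤ C₁) (hC₂ : 0 ≤ C₂)
    (hρ₁ : ∀ t ∈ Set.Ioc a m, ρ t ∈ Set.Icc a m) (hρ₂ : ∀ t ∈ Set.Ioc m b, ρ t ∈ Set.Icc m b)
    (h₁ : RetBound A ω₁ ω₂ ρ a m B) (h₂ : RetBound A ω₁ ω₂ ρ m b B)
    (hhom : HomBound A ω₁ m b C₁) (hdual : DualBound A ω₂ a m C₂) :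
    RetBound A ω₁ ω₂ ρ a b (B + C₁ * C₂) := by
  intro F hF
  have hF₁ := hF.mono_measure (slab_mono (le_refl a) hmb)
  have hF₂ := hF.mono_measure (slab_mono ham (le_refl b))
  have hFi := hF.integrable one_le_fourThirds
  set x := lpNorm F (4 / 3) (slab a m) with hx
  set y := lpNorm F (4 / 3) (slab m b) with hy
  set z := lpNorm F (4 / 3) (slab a b) with hz
  have hx0 : 0 ≤ x := lpNorm_nonneg
  have hy0 : 0 ≤ y := lpNorm_nonneg
  have hz0 : 0 ≤ z := lpNorm_nonneg
  have hxz : x ≤ z := lpNorm_mono_measure' hF (slab_mono le_rfl hmb)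
  have hpow : x ^ 4 + y ^ 4 ≤ z ^ 4 := by
    have h := lpNorm_slab_rpow_add (p := 4 / 3) (by simp) (by finiteness) ham hmb hF
    rw [← hx, ← hy, ← hz] at h
    have e : ∀ w : ℝ, 0 ≤ w → w ^ 4 = (w ^ ((4 / 3 : ℝ≥0∞)).toReal) ^ 3 := by
      intro w hw
      rw [← Real.rpow_natCast, ← Real.rpow_natCast, ← Real.rpow_mul hw]
      norm_num
    rw [e x hx0, e y hy0, e z hz0, h]
    have hX : 0 ≤ x ^ ((4 / 3 : ℝ≥0∞)).toReal := by positivity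
    have hY : 0 ≤ y ^ ((4 / 3 : ℝ≥0∞)).toReal := by positivity
    nlinarith [mul_nonneg hX hY, mul_nonneg (mul_nonneg hX hY) hX, mul_nonneg (mul_nonneg hX hY) hY]
  set D : ℤ → ℂ := fun k => ∫ r in a..m, conj (ω₂ r k) * coef F r k with hD
  have hDle : l2 A D ≤ C₂ * x := hdual F hF₁
  let S : Set (ℝ × Torus) := {p | p.1 ≤ m}
  have hS : MeasurableSet S := measurableSet_le measurable_fst measurable_const
  classical
  let R₂ : ℝ × Torus → ℂ := S.piecewise 0 (mode A ω₁ D)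
  let R₁ : ℝ × Torus → ℂ := retarded A ω₁ ω₂ ρ a F - R₂
  have hρab : ∀ t ∈ Set.Ioc a b, ρ t ∈ Set.Icc a b := by
    intro t ht
    rcases le_or_gt t m with h | h
    · exact ⟨(hρ₁ t ⟨ht.1, h⟩).1, (hρ₁ t ⟨ht.1, h⟩).2.trans hmb⟩
    · exact ⟨ham.trans (hρ₂ t ⟨h, ht.2⟩).1, (hρ₂ t ⟨h, ht.2⟩).2⟩
  have hR : MemLp (retarded A ω₁ ω₂ ρ a F) 4 (slab a b) :=
    (memLp_retarded hω₁ hω₂ hρ hρab hFi).1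
  have hR₂ : MemLp R₂ 4 (slab a b) := by
    refine memLp_of_bounded (Measurable.piecewise hS measurable_const (measurable_mode hω₁.1 A D))
      (C := ∑ k ∈ A, 2 * ‖D k‖) (fun p => ?_) 4 a b
    by_cases hp : p ∈ S
    · rw [Set.piecewise_eq_of_mem _ _ _ hp]
      exact (norm_zero (E := ℂ)).le.trans (by positivity)
    · rw [Set.piecewise_eq_of_notMem _ _ _ hp]
      exact norm_mode_le hω₁.2 A D p
  have hR₁ : MemLp R₁ 4 (slab a b) := hR.sub hR₂
  have hR₂l : R₂ =ᵐ[slab a m] 0 := by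
    filter_upwards [ae_slab_mem a m] with p hp
    exact Set.piecewise_eq_of_mem _ _ _ (show p.1 ≤ m from hp.2)
  have hR₂r : R₂ =ᵐ[slab m b] mode A ω₁ D := by
    filter_upwards [ae_slab_mem m b] with p hp
    exact Set.piecewise_eq_of_notMem _ _ _ (show ¬ p.1 ≤ m from not_le.mpr hp.1)
  have hR₁l : R₁ =ᵐ[slab a m] retarded A ω₁ ω₂ ρ a F := by
    filter_upwards [hR₂l] with p hp
    simp only [R₁, Pi.sub_apply, hp, Pi.zero_apply, sub_zero]
  have hR₁r : R₁ =ᵐ[slab m b] retarded A ω₁ ω₂ ρ m F := by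
    filter_upwards [hR₂r, ae_slab_mem m b] with p hp hpm
    simp only [R₁, Pi.sub_apply, hp, retarded, mode]
    rw [← Finset.sum_sub_distrib]
    refine Finset.sum_congr rfl fun k _ => ?_
    have hk := hω₂.integrable_mul_coef hFi k
    have hpρ := hρ₂ _ hpm
    rw [← intervalIntegral.integral_add_adjacent_intervals
      (intervalIntegrable_of_integrable_restrict hk ⟨le_rfl, ham.trans hmb⟩ ⟨ham, hmb⟩)
      (intervalIntegrable_of_integrable_restrict hk ⟨ham, hmb⟩ ⟨ham.trans hpρ.1, hpρ.2⟩)]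
    simp only [hD]
    ring
  have hn₂ : lpNorm R₂ 4 (slab a b) ≤ C₁ * C₂ * z := by
    have h4 := lpNorm_slab_four_pow_add ham hmb hR₂
    rw [lpNorm_congr hR₂l, lpNorm_congr hR₂r, lpNorm_zero, zero_pow (by norm_num), zero_add] at h4
    rw [pow_left_inj₀ lpNorm_nonneg lpNorm_nonneg (by norm_num)] at h4
    rw [h4, mul_assoc]
    refine (hhom D).trans ?_
    gcongr
    exact hDle.trans (by gcongr)
  have hn₁ : lpNorm R₁ 4 (slab a b) ≤ B * z := by
    refine le_of_pow_le_pow_left₀ (n := 4) (by norm_num) (by positivity) ?_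
    rw [lpNorm_slab_four_pow_add ham hmb hR₁, lpNorm_congr hR₁l, lpNorm_congr hR₁r, mul_pow]
    have e₁ := pow_le_pow_left₀ lpNorm_nonneg (h₁ F hF₁) 4
    have e₂ := pow_le_pow_left₀ lpNorm_nonneg (h₂ F hF₂) 4
    rw [mul_pow, ← hx] at e₁
    rw [mul_pow, ← hy] at e₂
    have : 0 ≤ B ^ 4 := by positivity
    nlinarith
  calc lpNorm (retarded A ω₁ ω₂ ρ a F) 4 (slab a b) = lpNorm (R₁ + R₂) 4 (slab a b) := by
        simp only [R₁, sub_add_cancel]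
    _ ≤ lpNorm R₁ 4 (slab a b) + lpNorm R₂ 4 (slab a b) := lpNorm_add_le hR₁ (by norm_num)
    _ ≤ (B + C₁ * C₂) * z := by linarith

/-- Causality: extend $F$ by zero beyond $b$; on $(a,b]$ the operator does not notice. It passes
from a dyadic number of cells to an arbitrary one. -/
theorem RetBound.mono_right {A : Finset ℤ} {ω₁ ω₂ : ℝ → ℤ → ℂ} (hω₁ : IsMultiplier ω₁)
    (hω₂ : IsMultiplier ω₂) {ρ : ℝ → ℝ} (hρ : Measurable ρ) {a b b' B : ℝ} (hbb' : b ≤ b')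
    (hρab : ∀ b'', ∀ t ∈ Set.Ioc a b'', ρ t ∈ Set.Icc a b'')
    (h : RetBound A ω₁ ω₂ ρ a b' B) : RetBound A ω₁ ω₂ ρ a b B := by
  intro F hF
  let S : Set (ℝ × Torus) := {p | p.1 ≤ b}
  have hS : MeasurableSet S := measurableSet_le measurable_fst measurable_const
  have hres : (slab a b').restrict S = slab a b := by
    unfold slab
    rw [show S = Set.Iic b ×ˢ Set.univ by ext p; simp [S]]
    conv_lhs => rw [← Measure.prod_restrict]
    rw [Measure.restrict_restrict measurableSet_Iic, Measure.restrict_univ]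
    congr 2
    ext t
    simp only [Set.mem_inter_iff, Set.mem_Iic, Set.mem_Ioc]
    constructor
    · rintro ⟨h1, h2, h3⟩; exact ⟨h2, h1⟩
    · rintro ⟨h1, h2⟩; exact ⟨h2, h1, h2.trans hbb'⟩
  have hF' : MemLp (S.indicator F) (4 / 3) (slab a b') :=
    (memLp_indicator_iff_restrict hS).mpr (by rwa [hres])
  have hn : lpNorm (S.indicator F) (4 / 3) (slab a b') = lpNorm F (4 / 3) (slab a b) := by
    rw [← toReal_eLpNorm hF'.1, ← toReal_eLpNorm hF.1, eLpNorm_indicator_eq_eLpNorm_restrict hS, hres]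
  have hret := (memLp_retarded (A := A) hω₁ hω₂ hρ (hρab b') (hF'.integrable one_le_fourThirds)).1
  have heq : retarded A ω₁ ω₂ ρ a F =ᵐ[slab a b] retarded A ω₁ ω₂ ρ a (S.indicator F) := by
    filter_upwards [ae_slab_mem a b] with p hp
    unfold retarded
    refine Finset.sum_congr rfl fun k _ => ?_
    congr 2
    refine intervalIntegral.integral_congr_ae (Eventually.of_forall fun r hr => ?_)
    obtain ⟨h1, h2⟩ := hρab b _ hp
    rw [Set.uIoc_of_le h1] at hr
    congr 1
    unfold coef
    congr 1
    ext x
    exact (Set.indicator_of_mem (s := S) (show r ≤ b from hr.2.trans h2) F).symm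
  rw [lpNorm_congr heq, ← hn]
  exact (lpNorm_mono_measure' hret (slab_mono le_rfl hbb')).trans (h _ hF')

/-- A Strichartz estimate for the multiplier `ω` on all intervals of length at most one. -/
def Strichartz (A : Finset ℤ) (ω : ℝ → ℤ → ℂ) (C : ℝ) : Prop :=
  ∀ a b : ℝ, a ≤ b → b - a ≤ 1 → HomBound A ω a b (C * (b - a) ^ (1 / 8 : ℝ))

theorem strichartz_freeMul (A : Finset ℤ) : Strichartz A freeMul 3 :=
  fun _ _ hab hab' => homBound_freeMul hab hab' A

theorem strichartz_stepMul {τ : ℝ} (hτ : 0 < τ) {A : Finset ℤ} (hA : ∀ k ∈ A, τ * (k : ℝ) ^ 2 ≤ 1) :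
    Strichartz A (stepMul τ) 9 := by
  intro a b hab hab'
  have h := homBound_stepMul hτ hA (by have := sub_nonneg.mpr hab; positivity)
    (strichartz_freeMul A a b hab hab')
  rwa [← mul_assoc, show (3 : ℝ) * 3 = 9 by norm_num] at h

theorem strichartz_diffMul {τ : ℝ} (hτ : 0 < τ) {A : Finset ℤ} (hA : ∀ k ∈ A, τ * (k : ℝ) ^ 2 ≤ 1) :
    Strichartz A (diffMul τ) (9 * τ) := by
  intro a b hab hab'
  have h := homBound_diffMul hτ hA (by have := sub_nonneg.mpr hab; positivity)
    (strichartz_freeMul A a b hab hab')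
  rwa [← mul_assoc, show (3 : ℝ) * τ * 3 = 9 * τ by ring] at h

theorem Strichartz.dualBound {A : Finset ℤ} {ω : ℝ → ℤ → ℂ} (hω : IsMultiplier ω) {C : ℝ}
    (hC : 0 ≤ C) (h : Strichartz A ω C) {a b : ℝ} (hab : a ≤ b) (hab' : b - a ≤ 1) :
    DualBound A ω a b (C * (b - a) ^ (1 / 8 : ℝ)) :=
  (h a b hab hab').dualBound hω hab (by have := sub_nonneg.mpr hab; positivity)

theorem RetBound.mono {A : Finset ℤ} {ω₁ ω₂ : ℝ → ℤ → ℂ} {ρ : ℝ → ℝ} {a b B B' : ℝ}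
    (h : RetBound A ω₁ ω₂ ρ a b B) (hB : B ≤ B') : RetBound A ω₁ ω₂ ρ a b B' :=
  fun F hF => (h F hF).trans (mul_le_mul_of_nonneg_right hB lpNorm_nonneg)

/-! ### Retarded estimates by dyadic subdivision of time -/

section

variable {A : Finset ℤ} {ω₁ ω₂ : ℝ → ℤ → ℂ} (hω₁ : IsMultiplier ω₁) (hω₂ : IsMultiplier ω₂)
  {C₁ C₂ : ℝ} (hC₁ : 0 ≤ C₁) (hC₂ : 0 ≤ C₂) (h₁ : Strichartz A ω₁ C₁) (h₂ : Strichartz A ω₂ C₂)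
include hω₁ hω₂ hC₁ hC₂ h₁ h₂

/-- Each doubling of the length adds $C_1C_2\delta^{1/4}$, a geometric series dominated by its last
term. The set $S$ holds the admissible left endpoints: all reals in continuous time, grid points in
discrete time. -/
theorem retBound_dyadic {ρ : ℝ → ℝ} (hρ : Measurable ρ) {S : Set ℝ} {ℓ B : ℝ} (hℓ : 0 < ℓ)
    (hB : 0 ≤ B) (hS : ∀ a ∈ S, ∀ j : ℕ, a + 2 ^ j * ℓ ∈ S) (hρS : ∀ m ∈ S, ∀ t, m < t → m ≤ ρ t)
    (hρle : ∀ t, ρ t ≤ t) (hbase : ∀ a ∈ S, RetBound A ω₁ ω₂ ρ a (a + ℓ) B) (J : ℕ) :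
    2 ^ J * ℓ ≤ 1 → ∀ a ∈ S,
      RetBound A ω₁ ω₂ ρ a (a + 2 ^ J * ℓ) (B + 6 * (C₁ * C₂) * (2 ^ J * ℓ) ^ (1 / 4 : ℝ)) := by
  induction J with
  | zero =>
    intro _ a ha
    rw [pow_zero, one_mul]
    exact (hbase a ha).mono (le_add_of_nonneg_right (by positivity))
  | succ J ih =>
    intro hJ a ha
    set δ := 2 ^ J * ℓ with hδ
    have hδ0 : 0 < δ := by positivity
    have h2δ : 2 ^ (J + 1) * ℓ = 2 * δ := by rw [hδ]; ring
    rw [h2δ] at hJ ⊢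
    have hδ1 : δ ≤ 1 := by linarith
    have ham : a + δ ∈ S := hS a ha J
    have e₁ : a + δ - a = δ := by ring
    have e₂ : a + 2 * δ - (a + δ) = δ := by ring
    have hhom := h₁ (a + δ) (a + 2 * δ) (by linarith) (by rw [e₂]; exact hδ1)
    have hdual := h₂.dualBound hω₂ hC₂ (a := a) (b := a + δ) (by linarith) (by rw [e₁]; exact hδ1)
    rw [e₂] at hhom
    rw [e₁] at hdual
    have hr := ih hδ1 (a + δ) ham
    rw [show a + δ + δ = a + 2 * δ by ring] at hr
    refine (RetBound.concat hω₁ hω₂ hρ (a := a) (m := a + δ) (b := a + 2 * δ) (by linarith)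
      (by linarith) (by positivity) (by positivity) (by positivity) ?_ ?_ (ih hδ1 a ha) hr hhom
      hdual).mono ?_
    · exact fun t ht => ⟨hρS a ha t ht.1, (hρle t).trans ht.2⟩
    · exact fun t ht => ⟨hρS _ ham t ht.1, (hρle t).trans ht.2⟩
    · have hq : δ ^ (1 / 8 : ℝ) * δ ^ (1 / 8 : ℝ) = δ ^ (1 / 4 : ℝ) := by
        rw [← Real.rpow_add hδ0]; norm_num
      have h2 : (2 * δ) ^ (1 / 4 : ℝ) = 2 ^ (1 / 4 : ℝ) * δ ^ (1 / 4 : ℝ) :=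
        Real.mul_rpow (by norm_num) hδ0.le
      -- The constant $6$ reproduces itself because $6+1\le6\cdot2^{1/4}$.
      have h7 : (7 / 6 : ℝ) ≤ 2 ^ (1 / 4 : ℝ) := by
        refine le_of_pow_le_pow_left₀ (n := 4) (by norm_num) (by positivity) ?_
        rw [← Real.rpow_natCast (2 ^ (1 / 4 : ℝ)), ← Real.rpow_mul (by norm_num)]
        norm_num
      rw [h2]
      have : 0 ≤ C₁ * C₂ * δ ^ (1 / 4 : ℝ) := by positivity
      calc B + 6 * (C₁ * C₂) * δ ^ (1 / 4 : ℝ) + C₁ * δ ^ (1 / 8 : ℝ) * (C₂ * δ ^ (1 / 8 : ℝ))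
          = B + 7 * (C₁ * C₂ * δ ^ (1 / 4 : ℝ)) := by rw [← hq]; ring
        _ ≤ B + 6 * (2 ^ (1 / 4 : ℝ)) * (C₁ * C₂ * δ ^ (1 / 4 : ℝ)) := by nlinarith
        _ = _ := by ring

omit hC₁ hC₂ h₁ h₂ in
-- Not uniform in $A$, but the factor $\sqrt{b-a}$ makes it negligible on very short intervals.
theorem retBound_crude {a b : ℝ} (hab : a ≤ b) :
    RetBound A ω₁ ω₂ id a b (4 * A.card * Real.sqrt (b - a)) := by
  intro F hF
  have hFi := hF.integrable one_le_fourThirds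
  have h0 : 0 ≤ b - a := by linarith
  have hunif := (memLp_retarded (A := A) hω₁ hω₂ measurable_id (fun t ht => ⟨ht.1.le, ht.2⟩) hFi).2
  have hone : ∀ c : ℝ, 0 ≤ c → lpNorm (fun _ : ℝ × Torus => c) 4 (slab a b) =
      c * (b - a) ^ (1 / 4 : ℝ) := by
    intro c hc
    rw [lpNorm_const' (by norm_num) (by norm_num), measureReal_def, slab_univ,
      ENNReal.toReal_ofReal h0, Real.norm_of_nonneg hc]
    norm_num
  have hL1 : ∫ p, ‖F p‖ ∂(slab a b) ≤ (b - a) ^ (1 / 4 : ℝ) * lpNorm F (4 / 3) (slab a b) := by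
    have h1 := lpNorm_mul_le (r := 1) hF (memLp_of_bounded (f := fun _ => (1 : ℂ)) measurable_const
      (C := 1) (fun _ => by simp) 4 a b)
    simp only [mul_one] at h1
    rw [lpNorm_one_eq_integral_norm hFi.1, lpNorm_const' (by norm_num) (by norm_num),
      measureReal_def, slab_univ, ENNReal.toReal_ofReal h0] at h1
    norm_num at h1
    linarith
  refine (lpNorm_mono_ae (g := fun _ => 4 * A.card * ∫ p, ‖F p‖ ∂(slab a b))
    (memLp_const _) ?_).trans ?_
  · filter_upwards [ae_slab_mem a b] with p hp using hunif p hp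
  · rw [hone _ (by positivity)]
    have hq : Real.sqrt (b - a) = (b - a) ^ (1 / 4 : ℝ) * (b - a) ^ (1 / 4 : ℝ) := by
      rw [Real.sqrt_eq_rpow, ← Real.rpow_add' h0 (by norm_num)]
      norm_num
    rw [hq]
    calc 4 * A.card * (∫ p, ‖F p‖ ∂(slab a b)) * (b - a) ^ (1 / 4 : ℝ)
        ≤ 4 * A.card * ((b - a) ^ (1 / 4 : ℝ) * lpNorm F (4 / 3) (slab a b)) *
          (b - a) ^ (1 / 4 : ℝ) := by gcongr
      _ = _ := by ring

/-- The retarded Strichartz estimate in continuous time. -/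
theorem retBound_id {a b : ℝ} (hab : a ≤ b) (hab' : b - a ≤ 1) :
    RetBound A ω₁ ω₂ id a b (6 * (C₁ * C₂) * (b - a) ^ (1 / 4 : ℝ)) := by
  rcases hab.eq_or_lt with rfl | hlt
  · intro F _
    have : slab a a = 0 := by simp [slab]
    rw [this]
    simp
  intro F hF
  have h0 : 0 < b - a := by linarith
  have hJ : ∀ J : ℕ, lpNorm (retarded A ω₁ ω₂ id a F) 4 (slab a b) ≤
      (4 * A.card * Real.sqrt ((b - a) * (1 / 2) ^ J) + 6 * (C₁ * C₂) * (b - a) ^ (1 / 4 : ℝ)) *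
        lpNorm F (4 / 3) (slab a b) := by
    intro J
    have e : 2 ^ J * ((b - a) * (1 / 2) ^ J) = b - a := by
      rw [mul_comm, mul_assoc, ← mul_pow]; norm_num
    have h := retBound_dyadic hω₁ hω₂ hC₁ hC₂ h₁ h₂ measurable_id (S := Set.univ)
      (ℓ := (b - a) * (1 / 2) ^ J) (B := 4 * A.card * Real.sqrt ((b - a) * (1 / 2) ^ J))
      (by positivity) (by positivity) (fun _ _ _ => trivial) (fun _ _ _ h => h.le) (fun _ => le_rfl)
      (fun x _ => by
        have := retBound_crude hω₁ hω₂ (A := A) (a := x) (b := x + (b - a) * (1 / 2) ^ J)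
          (by have : 0 ≤ (b - a) * (1 / 2) ^ J := by positivity
              linarith)
        rwa [add_sub_cancel_left] at this) J (by rw [e]; exact hab') a trivial
    rw [e, add_sub_cancel] at h
    exact h F hF
  -- As the subdivision gets finer the crude base term disappears, and with it the dependence on the
  -- cardinality of $A$.
  refine ge_of_tendsto' (b := lpNorm (retarded A ω₁ ω₂ id a F) 4 (slab a b)) (x := atTop) ?_ hJ
  have hlim : Tendsto (fun J : ℕ => (b - a) * (1 / 2 : ℝ) ^ J) atTop (𝓝 0) := by
    have := (tendsto_pow_atTop_nhds_zero_of_lt_one (r := (1 / 2 : ℝ)) (by norm_num)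
      (by norm_num)).const_mul (b - a)
    rwa [mul_zero] at this
  have h3 : Tendsto (fun J : ℕ => Real.sqrt ((b - a) * (1 / 2 : ℝ) ^ J)) atTop (𝓝 0) := by
    have := (Real.continuous_sqrt.tendsto 0).comp hlim
    rwa [Real.sqrt_zero] at this
  have := ((h3.const_mul (4 * (A.card : ℝ))).add_const
    (6 * (C₁ * C₂) * (b - a) ^ (1 / 4 : ℝ))).mul_const (lpNorm F (4 / 3) (slab a b))
  rwa [mul_zero, zero_add] at this

/-- The retarded Strichartz estimate in discrete time. -/
theorem retBound_stepTime {τ : ℝ} (hτ : 0 < τ) {m n : ℕ} (hmn : m ≤ n)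
    (hle : ((n : ℝ) - m) * τ ≤ 1 / 2) :
    RetBound A ω₁ ω₂ (stepTime τ) (m * τ) (n * τ)
      (12 * (C₁ * C₂) * (((n : ℝ) - m) * τ) ^ (1 / 4 : ℝ)) := by
  rcases hmn.eq_or_lt with rfl | hlt
  · intro F _
    have : slab (m * τ) (m * τ) = 0 := by simp [slab]
    rw [this]
    simp
  obtain ⟨N, rfl⟩ := Nat.exists_eq_add_of_lt hlt
  -- The $N+1$ cells are embedded in $2^J\le2(N+1)$ cells. This factor $2$ explains the bound $1/2$
  -- on the length and the constant $12$ in place of $6$.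
  set J := Nat.log 2 (N + 1) + 1 with hJ
  have hJ1 : N + 1 < 2 ^ J := Nat.lt_pow_succ_log_self (by norm_num) _
  have hJ2 : 2 ^ J ≤ 2 * (N + 1) := by
    have := Nat.pow_log_le_self 2 (x := N + 1) (by omega)
    rw [hJ, pow_succ]
    omega
  have hJ1' : ((N : ℝ) + 1) ≤ 2 ^ J := by exact_mod_cast hJ1.le
  have hJ2' : (2 : ℝ) ^ J ≤ 2 * (N + 1) := by exact_mod_cast hJ2
  have eN : ((m + N + 1 : ℕ) : ℝ) - m = N + 1 := by push_cast; ring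
  rw [eN] at hle ⊢
  have hN0 : (0 : ℝ) ≤ N := N.cast_nonneg
  have h := retBound_dyadic hω₁ hω₂ hC₁ hC₂ h₁ h₂ (measurable_stepTime τ)
    (S := {x | ∃ j : ℕ, x = j * τ}) (ℓ := τ) (B := 0) hτ le_rfl
    (by
      rintro _ ⟨i, rfl⟩ j
      exact ⟨i + 2 ^ j, by push_cast; ring⟩)
    (by
      rintro _ ⟨i, rfl⟩ t ht
      exact le_stepTime hτ ht)
    (fun t => (stepTime_lt hτ t).le)
    (by
      rintro _ ⟨i, rfl⟩ F hF
      -- Inside a single cell the upper limit of integration is its left endpoint, so the operator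
      -- vanishes and the base constant is $0$.
      have hz : retarded A ω₁ ω₂ (stepTime τ) (i * τ) F =ᵐ[slab (i * τ) (i * τ + τ)] 0 := by
        filter_upwards [ae_slab_mem (i * τ) (i * τ + τ)] with p hp
        have : stepTime τ p.1 = i * τ := stepTime_eq hτ ⟨hp.1, by linarith [hp.2]⟩
        simp [retarded, this]
      rw [lpNorm_congr hz]
      simp)
    J (by nlinarith) (m * τ) ⟨m, rfl⟩
  have hle' : ((m + N + 1 : ℕ) : ℝ) * τ ≤ m * τ + 2 ^ J * τ := by
    push_cast
    nlinarith
  refine (h.mono_right hω₁ hω₂ (measurable_stepTime τ) hle' fun b t ht =>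
    ⟨le_stepTime hτ ht.1, (stepTime_lt hτ t).le.trans ht.2⟩).mono ?_
  rw [zero_add]
  have h1 : (2 ^ J * τ) ^ (1 / 4 : ℝ) ≤ (2 * ((N + 1) * τ)) ^ (1 / 4 : ℝ) := by
    refine Real.rpow_le_rpow (by positivity) ?_ (by norm_num)
    nlinarith
  have h2 : (2 * (((N : ℝ) + 1) * τ)) ^ (1 / 4 : ℝ) ≤ 2 * (((N : ℝ) + 1) * τ) ^ (1 / 4 : ℝ) := by
    rw [Real.mul_rpow (by norm_num) (by positivity)]
    gcongr
    calc (2 : ℝ) ^ (1 / 4 : ℝ) ≤ 2 ^ (1 : ℝ) := Real.rpow_le_rpow_of_exponent_le (by norm_num) (by norm_num)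
      _ = 2 := by norm_num
  have : 0 ≤ C₁ * C₂ := by positivity
  nlinarith

end

/-! ### Piecewise constant functions of time -/

/-- The index of the last grid point strictly before `t`. -/
def stepIdx (τ t : ℝ) : ℕ := ⌈t / τ⌉₊ - 1

theorem stepIdx_eq {τ : ℝ} (hτ : 0 < τ) {n : ℕ} {t : ℝ}
    (ht : t ∈ Set.Ioc (n * τ) ((n + 1) * τ)) : stepIdx τ t = n := by
  have h : ⌈t / τ⌉₊ = n + 1 := by
    rw [Nat.ceil_eq_iff (by omega)]
    push_cast
    rw [lt_div_iff₀ hτ, div_le_iff₀ hτ]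
    exact ht
  rw [stepIdx, h, Nat.add_sub_cancel]

theorem mem_Ioc_stepIdx {τ : ℝ} (hτ : 0 < τ) {t : ℝ} (ht : 0 < t) :
    t ∈ Set.Ioc (stepIdx τ t * τ) ((stepIdx τ t + 1) * τ) := by
  have h0 : 0 < t / τ := by positivity
  have h1 : 0 < ⌈t / τ⌉₊ := Nat.ceil_pos.mpr h0
  have h2 : ((stepIdx τ t : ℕ) : ℝ) + 1 = ⌈t / τ⌉₊ := by
    rw [stepIdx]
    have : ⌈t / τ⌉₊ - 1 + 1 = ⌈t / τ⌉₊ := by omega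
    exact_mod_cast this
  have h3 := Nat.ceil_lt_add_one h0.le
  have h4 := Nat.le_ceil (t / τ)
  rw [← h2] at h3 h4
  constructor
  · rw [← lt_div_iff₀ hτ]; linarith
  · rw [← div_le_iff₀ hτ]; exact h4

theorem stepTime_eq_stepIdx {τ : ℝ} (hτ : 0 < τ) {t : ℝ} (ht : 0 < t) :
    stepTime τ t = stepIdx τ t * τ := stepTime_eq hτ (mem_Ioc_stepIdx hτ ht)

theorem stepIdx_mem {τ : ℝ} (hτ : 0 < τ) {m n : ℕ} {t : ℝ} (ht : t ∈ Set.Ioc (m * τ) (n * τ)) :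
    m ≤ stepIdx τ t ∧ stepIdx τ t < n := by
  have h0 : 0 < t := lt_of_le_of_lt (by positivity) ht.1
  obtain ⟨h1, h2⟩ := mem_Ioc_stepIdx hτ h0
  constructor
  · have : (m : ℝ) * τ < (stepIdx τ t + 1) * τ := ht.1.trans_le h2
    have := lt_of_mul_lt_mul_right this hτ.le
    have : m < stepIdx τ t + 1 := by exact_mod_cast this
    omega
  · have : (stepIdx τ t : ℝ) * τ < n * τ := h1.trans_le ht.2
    have := lt_of_mul_lt_mul_right this hτ.le
    exact_mod_cast this

theorem measurable_stepIdx (τ : ℝ) : Measurable (stepIdx τ) :=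
  (measurable_from_top (f := fun n : ℕ => n - 1)).comp
    (Nat.measurable_ceil.comp (measurable_id.div_const τ))

/-- The space-time function equal to `f n` on the cell `(n τ, (n + 1) τ]`. -/
def stepFun (τ : ℝ) (f : ℕ → Torus → ℂ) (p : ℝ × Torus) : ℂ := f (stepIdx τ p.1) p.2

/-- Uniformly bounded sequences of continuous functions on the torus. -/
def BddSeq (f : ℕ → Torus → ℂ) : Prop := (∀ n, Continuous (f n)) ∧ ∃ C, ∀ n x, ‖f n x‖ ≤ C

theorem BddSeq.memLp {f : ℕ → Torus → ℂ} (hf : BddSeq f) (τ : ℝ) (p : ℝ≥0∞) (a b : ℝ) :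
    MemLp (stepFun τ f) p (slab a b) := by
  obtain ⟨C, hC⟩ := hf.2
  have h : Measurable fun q : ℕ × Torus => f q.1 q.2 :=
    measurable_from_prod_countable_right fun n => (hf.1 n).measurable
  exact memLp_of_bounded (h.comp (((measurable_stepIdx τ).comp measurable_fst).prodMk measurable_snd))
    (fun p => hC _ _) p a b

theorem integral_cell {τ : ℝ} (hτ : 0 < τ) (f : ℕ → Torus → ℂ) (n : ℕ) (k : ℤ) :
    ∫ r in (n * τ)..((n + 1) * τ), conj (stepMul τ r k) * coef (stepFun τ f) r k =
      τ * (conj (freeMul (n * τ) k) * fourierCoeff (f n) k) := by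
  have h : ∫ r in (n * τ)..((n + 1) * τ), conj (stepMul τ r k) * coef (stepFun τ f) r k =
      ∫ _ in (n * τ)..((n + 1) * τ), conj (freeMul (n * τ) k) * fourierCoeff (f n) k := by
    refine intervalIntegral.integral_congr_ae (Eventually.of_forall fun r hr => ?_)
    rw [Set.uIoc_of_le (by nlinarith)] at hr
    simp only [stepMul, stepTime_eq hτ hr, coef, stepFun, stepIdx_eq hτ hr]
  rw [h, intervalIntegral.integral_const, Complex.real_smul]
  congr 1
  push_cast
  ring

/-- Forcing and frozen phase are constant on cells, so the discrete Duhamel sum is an honest time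
integral. The continuous Strichartz machinery then applies and no separate discrete theory is
required. -/
theorem sub_eq_integral_of_recursion {τ : ℝ} (hτ : 0 < τ) {f : ℕ → Torus → ℂ} (hf : BddSeq f)
    {c : ℕ → ℂ} {k : ℤ} {m n : ℕ} (hmn : m ≤ n)
    (hrec : ∀ n, c (n + 1) = c n + τ * (conj (freeMul (n * τ) k) * fourierCoeff (f n) k)) :
    c n = c m + ∫ r in (m * τ)..(n * τ), conj (stepMul τ r k) * coef (stepFun τ f) r k := by
  induction n, hmn using Nat.le_induction with
  | base => simp
  | succ n hmn ih =>
    have hmn' : (m : ℝ) * τ ≤ n * τ := by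
      have : (m : ℝ) ≤ n := by exact_mod_cast hmn
      gcongr
    have hi := (isMultiplier_stepMul τ).integrable_mul_coef
      ((hf.memLp τ 1 (m * τ) ((n + 1) * τ)).integrable le_rfl) k
    have hle : (n : ℝ) * τ ≤ (n + 1) * τ := by nlinarith
    push_cast
    rw [hrec, ih, ← integral_cell hτ f n k, add_assoc, intervalIntegral.integral_add_adjacent_intervals
      (intervalIntegrable_of_integrable_restrict hi ⟨le_rfl, hmn'.trans hle⟩ ⟨hmn', hle⟩)
      (intervalIntegrable_of_integrable_restrict hi ⟨hmn', hle⟩ ⟨hmn'.trans hle, le_rfl⟩)]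

/-- The space-time function `∑ₖ ω(t, k) cₙ(k) exp(ikx)` for `t` in the `n`-th cell. -/
def stepMode (A : Finset ℤ) (ω : ℝ → ℤ → ℂ) (τ : ℝ) (c : ℕ → ℤ → ℂ) (p : ℝ × Torus) : ℂ :=
  mode A ω (c (stepIdx τ p.1)) p

/-- The recursion `cₙ₊₁ = cₙ + τ e^{i n τ k²} f̂ₙ`. -/
def DuhamelSeq (A : Finset ℤ) (τ : ℝ) (c : ℕ → ℤ → ℂ) (f : ℕ → Torus → ℂ) : Prop :=
  ∀ n, ∀ k ∈ A, c (n + 1) k = c n k + τ * (conj (freeMul (n * τ) k) * fourierCoeff (f n) k)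

/-! ### Strichartz bounds for the discrete Duhamel formula -/

section

variable {A : Finset ℤ} {τ : ℝ} (hτ : 0 < τ) {c : ℕ → ℤ → ℂ} {f : ℕ → Torus → ℂ}
  (hf : BddSeq f) (hc : DuhamelSeq A τ c f)
include hτ hf hc

theorem DuhamelSeq.eq_integral {m n : ℕ} (hmn : m ≤ n) {k : ℤ} (hk : k ∈ A) :
    c n k = c m k + ∫ r in (m * τ)..(n * τ), conj (stepMul τ r k) * coef (stepFun τ f) r k :=
  sub_eq_integral_of_recursion hτ hf (c := fun n => c n k) hmn fun n => hc n k hk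

theorem DuhamelSeq.stepMode_eq {ω : ℝ → ℤ → ℂ} (m : ℕ) {p : ℝ × Torus} (hp : m * τ < p.1) :
    stepMode A ω τ c p =
      (mode A ω (c m) + retarded A ω (stepMul τ) (stepTime τ) (m * τ) (stepFun τ f)) p := by
  have h0 : 0 < p.1 := lt_of_le_of_lt (by positivity) hp
  have hm : m ≤ stepIdx τ p.1 := by
    obtain ⟨N, hN⟩ := exists_nat_ge (p.1 / τ)
    exact (stepIdx_mem hτ (n := N) ⟨hp, by rwa [div_le_iff₀ hτ] at hN⟩).1
  rw [Pi.add_apply, stepMode, mode, mode, retarded, ← Finset.sum_add_distrib]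
  refine Finset.sum_congr rfl fun k hk => ?_
  rw [stepTime_eq_stepIdx hτ h0, hc.eq_integral hτ hf hm hk]
  ring

theorem DuhamelSeq.memLp_stepMode {ω : ℝ → ℤ → ℂ} (hω : IsMultiplier ω) (m : ℕ) (b : ℝ) :
    MemLp (stepMode A ω τ c) 4 (slab (m * τ) b) := by
  have h := (memLp_mode hω A (c m) 4 (m * τ) b).add (memLp_retarded (A := A) hω
    (isMultiplier_stepMul τ) (measurable_stepTime τ) (a := m * τ) (b := b)
    (fun t ht => ⟨le_stepTime hτ ht.1, (stepTime_lt hτ t).le.trans ht.2⟩)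
    ((hf.memLp τ 1 _ _).integrable le_rfl)).1
  refine (memLp_congr_ae ?_).mpr h
  filter_upwards [ae_slab_mem (m * τ) b] with p hp using hc.stepMode_eq hτ hf m hp.1

/-- Homogeneous estimate for the value at $m$ plus discrete retarded estimate for the forcing;
$108=12\cdot9$, with $9$ the Strichartz constant of `stepMul`. -/
theorem DuhamelSeq.lpNorm_stepMode_le (hA : ∀ k ∈ A, τ * (k : ℝ) ^ 2 ≤ 1) {ω : ℝ → ℤ → ℂ}
    (hω : IsMultiplier ω) {C : ℝ} (hC : 0 ≤ C) (hS : Strichartz A ω C) {m n : ℕ} (hmn : m ≤ n)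
    (hle : ((n : ℝ) - m) * τ ≤ 1 / 2) :
    lpNorm (stepMode A ω τ c) 4 (slab (m * τ) (n * τ)) ≤ C * l2 A (c m) +
      108 * C * (((n : ℝ) - m) * τ) ^ (1 / 4 : ℝ) *
        lpNorm (stepFun τ f) (4 / 3) (slab (m * τ) (n * τ)) := by
  have hmn' : (0 : ℝ) ≤ (n : ℝ) - m := by
    have : (m : ℝ) ≤ n := by exact_mod_cast hmn
    linarith
  have e : (n : ℝ) * τ - m * τ = ((n : ℝ) - m) * τ := by ring
  have hδ : 0 ≤ ((n : ℝ) - m) * τ := by positivity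
  have h1 := hS (m * τ) (n * τ) (by linarith) (by linarith) (c m)
  rw [e] at h1
  have h2 := retBound_stepTime hω (isMultiplier_stepMul τ) hC (by norm_num) hS
    (strichartz_stepMul hτ hA) hτ hmn hle _ (hf.memLp τ (4 / 3) _ _)
  have h3 : (((n : ℝ) - m) * τ) ^ (1 / 8 : ℝ) ≤ 1 :=
    Real.rpow_le_one hδ (by linarith) (by norm_num)
  have heq : stepMode A ω τ c =ᵐ[slab (m * τ) (n * τ)]
      (mode A ω (c m) + retarded A ω (stepMul τ) (stepTime τ) (m * τ) (stepFun τ f)) := by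
    filter_upwards [ae_slab_mem (m * τ) (n * τ)] with p hp using hc.stepMode_eq hτ hf m hp.1
  rw [lpNorm_congr heq]
  refine (lpNorm_add_le (memLp_mode hω A (c m) 4 _ _) (by norm_num)).trans ?_
  have h4 : C * (((n : ℝ) - m) * τ) ^ (1 / 8 : ℝ) * l2 A (c m) ≤ C * l2 A (c m) := by
    have := l2_nonneg A (c m)
    have : 0 ≤ C * l2 A (c m) := by positivity
    nlinarith
  calc _ ≤ C * l2 A (c m) + 12 * (C * 9) * (((n : ℝ) - m) * τ) ^ (1 / 4 : ℝ) *
        lpNorm (stepFun τ f) (4 / 3) (slab (m * τ) (n * τ)) := add_le_add (h1.trans h4) h2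
    _ = _ := by ring

theorem DuhamelSeq.l2_le (hA : ∀ k ∈ A, τ * (k : ℝ) ^ 2 ≤ 1) {m n : ℕ} (hmn : m ≤ n)
    (hle : ((n : ℝ) - m) * τ ≤ 1 / 2) :
    l2 A (c n) ≤ l2 A (c m) + 9 * lpNorm (stepFun τ f) (4 / 3) (slab (m * τ) (n * τ)) := by
  have hmn' : (0 : ℝ) ≤ (n : ℝ) - m := by
    have : (m : ℝ) ≤ n := by exact_mod_cast hmn
    linarith
  have e : (n : ℝ) * τ - m * τ = ((n : ℝ) - m) * τ := by ring
  have hδ : 0 ≤ ((n : ℝ) - m) * τ := by positivity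
  have h1 := (strichartz_stepMul hτ hA).dualBound (isMultiplier_stepMul τ) (by norm_num)
    (a := m * τ) (b := n * τ) (by linarith) (by linarith) _ (hf.memLp τ (4 / 3) _ _)
  rw [e] at h1
  have h3 : (((n : ℝ) - m) * τ) ^ (1 / 8 : ℝ) ≤ 1 :=
    Real.rpow_le_one hδ (by linarith) (by norm_num)
  have h2 : l2 A (c n) ≤ l2 A (fun k => c m k +
      ∫ r in (m * τ)..(n * τ), conj (stepMul τ r k) * coef (stepFun τ f) r k) :=
    l2_mono fun k hk => by rw [hc.eq_integral hτ hf hmn hk]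
  refine h2.trans ((l2_add_le _ _ _).trans (add_le_add le_rfl (h1.trans ?_)))
  have : 0 ≤ lpNorm (stepFun τ f) (4 / 3) (slab (m * τ) (n * τ)) := lpNorm_nonneg
  nlinarith

/-- The forcing in the last cell does not influence the solution there. -/
theorem DuhamelSeq.lpNorm_stepMode_succ_le (hA : ∀ k ∈ A, τ * (k : ℝ) ^ 2 ≤ 1) {ω : ℝ → ℤ → ℂ}
    (hω : IsMultiplier ω) {C : ℝ} (hC : 0 ≤ C) (hS : Strichartz A ω C) {m n : ℕ} (hmn : m ≤ n)
    (hle : (((n + 1 : ℕ) : ℝ) - m) * τ ≤ 1 / 2) :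
    lpNorm (stepMode A ω τ c) 4 (slab (m * τ) ((n + 1 : ℕ) * τ)) ≤ C * l2 A (c m) +
      108 * C * ((((n + 1 : ℕ) : ℝ) - m) * τ) ^ (1 / 4 : ℝ) *
        lpNorm (stepFun τ f) (4 / 3) (slab (m * τ) (n * τ)) := by
  -- Switch the forcing off from index $n$ on and freeze the coefficients there. The recursion still
  -- holds and nothing changes up to index $n$, hence on the slab; but the norm of the forcing now
  -- stops at $n\tau$, which makes induction on $n$ possible.
  let f' : ℕ → Torus → ℂ := fun j => if j < n then f j else 0
  let c' : ℕ → ℤ → ℂ := fun j => c (min j n)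
  have hf' : BddSeq f' := by
    obtain ⟨h1, C, hC⟩ := hf
    refine ⟨fun j => ?_, C, fun j x => ?_⟩
    · dsimp only [f']
      split_ifs
      · exact h1 j
      · exact continuous_const
    · dsimp only [f']
      split_ifs
      · exact hC j x
      · simpa using (norm_nonneg _).trans (hC j x)
  have hc' : DuhamelSeq A τ c' f' := by
    intro j k hk
    dsimp only [c', f']
    rcases lt_or_ge j n with h | h
    · rw [if_pos h, min_eq_left h.le, min_eq_left (Nat.succ_le_of_lt h)]
      exact hc j k hk
    · rw [if_neg (not_lt.mpr h), min_eq_right h, min_eq_right (h.trans (Nat.le_succ _))]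
      have : fourierCoeff (0 : Torus → ℂ) k = 0 := by simp [fourierCoeff]
      rw [this, mul_zero, mul_zero, add_zero]
  have h := hc'.lpNorm_stepMode_le hτ hf' hA hω hC hS (hmn.trans (Nat.le_succ n)) hle
  have hmn' : (m : ℝ) * τ ≤ n * τ := by
    have : (m : ℝ) ≤ n := by exact_mod_cast hmn
    gcongr
  have hnn : (n : ℝ) * τ ≤ (n + 1 : ℕ) * τ := by push_cast; nlinarith
  have e1 : stepMode A ω τ c =ᵐ[slab (m * τ) ((n + 1 : ℕ) * τ)] stepMode A ω τ c' := by
    filter_upwards [ae_slab_mem (m * τ) ((n + 1 : ℕ) * τ)] with p hp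
    have := (stepIdx_mem hτ hp).2
    simp only [stepMode, c', min_eq_left (Nat.lt_succ_iff.mp this)]
  have e2 : lpNorm (stepFun τ f') (4 / 3) (slab (m * τ) ((n + 1 : ℕ) * τ)) =
      lpNorm (stepFun τ f) (4 / 3) (slab (m * τ) (n * τ)) := by
    have hadd := lpNorm_slab_rpow_add (p := 4 / 3) (by simp) (by finiteness) hmn' hnn
      (hf'.memLp τ (4 / 3) _ _)
    have z1 : stepFun τ f' =ᵐ[slab (n * τ) ((n + 1 : ℕ) * τ)] 0 := by
      filter_upwards [ae_slab_mem (n * τ) ((n + 1 : ℕ) * τ)] with p hp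
      have := (stepIdx_mem hτ hp).1
      simp [stepFun, f', not_lt.mpr this]
    have z2 : stepFun τ f' =ᵐ[slab (m * τ) (n * τ)] stepFun τ f := by
      filter_upwards [ae_slab_mem (m * τ) (n * τ)] with p hp
      have := (stepIdx_mem hτ hp).2
      simp [stepFun, f', this]
    have hpos : (4 / 3 : ℝ≥0∞).toReal ≠ 0 := by norm_num
    rw [lpNorm_congr z1, lpNorm_zero, Real.zero_rpow hpos, add_zero, lpNorm_congr z2] at hadd
    exact (Real.rpow_left_inj lpNorm_nonneg lpNorm_nonneg hpos).mp hadd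
  rw [lpNorm_congr e1, ← e2]
  have e3 : c' m = c m := by simp only [c', min_eq_left hmn]
  rwa [e3] at h

end

/-! ### Differentiation on the torus -/

/-- `f'` is the derivative of `f` on the torus. -/
def TorusDeriv (f f' : Torus → ℂ) : Prop :=
  ∀ x : ℝ, HasDerivAt (fun y : ℝ => f (y : Torus)) (f' (x : Torus)) x

theorem hasDerivAt_expi (k : ℤ) (x : ℝ) :
    HasDerivAt (fun y : ℝ => expi k (y : Torus)) (Complex.I * k * expi k (x : Torus)) x := by
  have h := hasDerivAt_fourier (2 * Real.pi) k x
  convert! h using 1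
  have : (Real.pi : ℂ) ≠ 0 := by exact_mod_cast Real.pi_ne_zero
  rw [expi]
  push_cast
  field_simp

theorem TorusDeriv.fourierCoeff {f f' : Torus → ℂ} (h : TorusDeriv f f') (hf' : Continuous f')
    (k : ℤ) : fourierCoeff f' k = Complex.I * k * fourierCoeff f k := by
  rw [fourierCoeff_eq_intervalIntegral f' k 0, fourierCoeff_eq_intervalIntegral f k 0]
  simp only [zero_add, smul_eq_mul]
  have hc : Continuous fun x : ℝ => f' (x : Torus) := hf'.comp (AddCircle.continuous_mk' _)
  have hfc : Continuous fun x : ℝ => f (x : Torus) :=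
    continuous_iff_continuousAt.mpr fun x => (h x).continuousAt
  have hec : ∀ j : ℤ, Continuous fun x : ℝ => expi j (x : Torus) := fun j =>
    (continuous_expi j).comp (AddCircle.continuous_mk' _)
  have hparts := intervalIntegral.integral_mul_deriv_eq_deriv_mul
    (a := 0) (b := 2 * Real.pi) (u := fun x : ℝ => expi (-k) (x : Torus))
    (v := fun x : ℝ => f (x : Torus)) (fun x _ => hasDerivAt_expi (-k) x) (fun x _ => h x)
    ((continuous_const.mul (hec (-k))).intervalIntegrable _ _) (hc.intervalIntegrable _ _)
  have hper : ((2 * Real.pi : ℝ) : Torus) = ((0 : ℝ) : Torus) := by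
    simp
  rw [hper, sub_self, zero_sub] at hparts
  have h1 : ∫ x in (0 : ℝ)..(2 * Real.pi), fourier (-k) (x : Torus) * f' x =
      -∫ x in (0 : ℝ)..(2 * Real.pi), Complex.I * ((-k : ℤ) : ℂ) * expi (-k) (x : Torus) * f x :=
    hparts
  rw [h1]
  have h2 : ∫ x in (0 : ℝ)..(2 * Real.pi), Complex.I * ((-k : ℤ) : ℂ) * expi (-k) (x : Torus) * f x =
      (Complex.I * ((-k : ℤ) : ℂ)) * ∫ x in (0 : ℝ)..(2 * Real.pi), fourier (-k) (x : Torus) * f x := by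
    rw [← intervalIntegral.integral_const_mul]
    congr 1
    ext x
    rw [mul_assoc]
    rfl
  rw [h2, Complex.real_smul, Complex.real_smul]
  push_cast
  ring

/-- The trigonometric polynomial with coefficients `c`. -/
def trig (A : Finset ℤ) (c : ℤ → ℂ) (x : Torus) : ℂ := ∑ k ∈ A, c k * expi k x

theorem continuous_trig (A : Finset ℤ) (c : ℤ → ℂ) : Continuous (trig A c) := by
  unfold trig
  exact continuous_finsetSum _ fun k _ => continuous_const.mul (continuous_expi k)

theorem norm_trig_le (A : Finset ℤ) (c : ℤ → ℂ) (x : Torus) : ‖trig A c x‖ ≤ ∑ k ∈ A, ‖c k‖ :=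
  norm_sum_le_of_le _ fun k _ => by rw [norm_mul, norm_expi, mul_one]

theorem torusDeriv_trig (A : Finset ℤ) (c : ℤ → ℂ) :
    TorusDeriv (trig A c) (trig A fun k => Complex.I * k * c k) := by
  intro x
  unfold trig
  have := HasDerivAt.fun_sum (u := A) fun k _ => (hasDerivAt_expi k x).const_mul (c k)
  convert! this using 1
  exact Finset.sum_congr rfl fun k _ => by ring

theorem integrable_of_continuous {f : Torus → ℂ} (hf : Continuous f) : Integrable f haarT :=
  hf.integrable_of_hasCompactSupport (HasCompactSupport.of_compactSpace f)

theorem memLp_of_continuous {f : Torus → ℂ} (hf : Continuous f) (p : ℝ≥0∞) : MemLp f p haarT := by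
  obtain ⟨C, hC⟩ := isCompact_univ.exists_bound_of_continuousOn hf.continuousOn
  exact MemLp.of_bound hf.aestronglyMeasurable C (Eventually.of_forall fun x => hC x trivial)

theorem fourierCoeff_trig (A : Finset ℤ) (c : ℤ → ℂ) (k : ℤ) :
    fourierCoeff (trig A c) k = if k ∈ A then c k else 0 := by
  have h : trig A c = ∑ j ∈ A, fun x => c j * expi j x := by
    ext x; simp [trig]
  have h2 := fourierCoeff.sum A (fun j (x : Torus) => c j * expi j x) fun j _ =>
    integrable_of_continuous (continuous_const.mul (continuous_expi j))
  rw [h, h2, Finset.sum_apply]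
  simp_rw [fourierCoeff.const_mul, fourierCoeff_expi]
  simp

/-! ### Parseval -/

theorem lpNorm_two_sq {f : Torus → ℂ} (hf : MemLp f 2 haarT) :
    lpNorm f 2 haarT ^ 2 = ∫ x, ‖f x‖ ^ 2 ∂haarT := by
  rw [lpNorm_eq_integral_norm_rpow_toReal (by norm_num) (by norm_num) hf.1]
  rw [← Real.rpow_natCast, ← Real.rpow_mul (integral_nonneg fun _ => by positivity)]
  norm_num

theorem hasSum_sq_norm_fourierCoeff {f : Torus → ℂ} (hf : MemLp f 2 haarT) :
    HasSum (fun k => ‖fourierCoeff f k‖ ^ 2) (lpNorm f 2 haarT ^ 2) := by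
  have h := hasSum_sq_fourierCoeff (T := 2 * Real.pi) hf.toLp
  rw [lpNorm_two_sq hf]
  convert h using 1
  · simp only [fourierCoeff_congr_ae hf.coeFn_toLp]
  · refine integral_congr_ae ?_
    filter_upwards [hf.coeFn_toLp] with x hx
    rw [hx]

theorem l2_fourierCoeff_le {f : Torus → ℂ} (hf : MemLp f 2 haarT) (A : Finset ℤ) :
    l2 A (fourierCoeff f) ≤ lpNorm f 2 haarT := by
  refine le_of_pow_le_pow_left₀ (n := 2) (by norm_num) lpNorm_nonneg ?_
  rw [l2_sq]
  exact sum_le_hasSum A (fun _ _ => by positivity) (hasSum_sq_norm_fourierCoeff hf)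

theorem lpNorm_trig (A : Finset ℤ) (c : ℤ → ℂ) : lpNorm (trig A c) 2 haarT = l2 A c := by
  have h := hasSum_sq_norm_fourierCoeff (memLp_of_continuous (continuous_trig A c) 2)
  have h2 : HasSum (fun k => ‖fourierCoeff (trig A c) k‖ ^ 2) (l2 A c ^ 2) := by
    rw [l2_sq]
    have : ∀ k ∈ A, ‖fourierCoeff (trig A c) k‖ ^ 2 = ‖c k‖ ^ 2 := fun k hk => by
      rw [fourierCoeff_trig, if_pos hk]
    rw [← Finset.sum_congr rfl this]
    exact hasSum_sum_of_ne_finset_zero fun k hk => by rw [fourierCoeff_trig, if_neg hk]; simp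
  exact (pow_left_inj₀ lpNorm_nonneg (l2_nonneg _ _) (by norm_num)).mp (h.unique h2)

theorem lpNorm_two_le_mul {f h : Torus → ℂ} (hh : Continuous h) {B : ℝ} (hB : 0 ≤ B)
    (hle : ∀ x, ‖f x‖ ≤ B * ‖h x‖) : lpNorm f 2 haarT ≤ B * lpNorm h 2 haarT := by
  have hm := memLp_of_continuous hh 2
  refine (lpNorm_mono_real (hm.norm.const_mul B) hle).trans ?_
  have := lpNorm_const_smul (p := 2) B (fun x => ‖h x‖) haarT
  rw [lpNorm_norm hm.1] at this
  rw [show (fun x => B * ‖h x‖) = B • fun x => ‖h x‖ from rfl, this]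
  simp [abs_of_nonneg hB]

/-- Agmon's inequality on the Fourier side. -/
theorem sum_norm_sq_le {y : ℝ} (hy : 1 ≤ y) (A : Finset ℤ) (c : ℤ → ℂ) :
    (∑ k ∈ A, ‖c k‖) ^ 2 ≤ 6 * y * (l2 A c ^ 2 + l2 A (fun k => k * c k) ^ 2 / y ^ 2) := by
  have hy0 : 0 < y := by linarith
  -- Cauchy–Schwarz with weight $1+k^2/y^2$; the inverse weights sum to at most $2+4y\le6y$.
  have hcs := Finset.sum_sq_le_sum_mul_sum_of_sq_le_mul A
    (r := fun k => ‖c k‖) (f := fun k : ℤ => 1 / (1 + (1 / y) ^ 2 * (k : ℝ) ^ 2))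
    (g := fun k : ℤ => (1 + (1 / y) ^ 2 * (k : ℝ) ^ 2) * ‖c k‖ ^ 2)
    (fun _ _ => by positivity) (fun _ _ => by positivity) (fun k _ => by
      have : 1 + (1 / y) ^ 2 * (k : ℝ) ^ 2 ≠ 0 := by positivity
      field_simp
      exact le_rfl)
  have h1 := sum_int_inv_one_add_sq_le (h := 1 / y) (by positivity) A 0
  simp only [Int.cast_zero, sub_zero] at h1
  have h2 : ∑ k ∈ A, (1 + (1 / y) ^ 2 * (k : ℝ) ^ 2) * ‖c k‖ ^ 2 =
      l2 A c ^ 2 + l2 A (fun k => k * c k) ^ 2 / y ^ 2 := by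
    rw [l2_sq, l2_sq, Finset.sum_div, ← Finset.sum_add_distrib]
    refine Finset.sum_congr rfl fun k _ => ?_
    rw [norm_mul, Complex.norm_intCast, mul_pow, sq_abs]
    ring
  rw [h2] at hcs
  refine hcs.trans (mul_le_mul_of_nonneg_right (h1.trans ?_) (by positivity))
  have : 4 / (1 / y) = 4 * y := by field_simp
  linarith

/-! ### The nonlinearity of the splitting scheme -/

/-- The increment `(e^{-iτ|z|²} - 1) z / τ` of the phase flow. -/
def phaseIncr (τ : ℝ) (z : ℂ) : ℂ :=
  (Complex.exp (-Complex.I * τ * (z * conj z)) - 1) / τ * z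

/-- The first derivative of `phaseIncr τ w` along a curve. -/
def phaseIncrDeriv (τ : ℝ) (w w₁ : ℂ) : ℂ :=
  -Complex.I * (w₁ * conj w + w * conj w₁) * Complex.exp (-Complex.I * τ * (w * conj w)) * w +
    (Complex.exp (-Complex.I * τ * (w * conj w)) - 1) / τ * w₁

/-- The second derivative of `phaseIncr τ w` along a curve. -/
def phaseIncrDeriv₂ (τ : ℝ) (w w₁ w₂ : ℂ) : ℂ :=
  -Complex.I * (w₂ * conj w + 2 * (w₁ * conj w₁) + w * conj w₂) *
      Complex.exp (-Complex.I * τ * (w * conj w)) * w -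
    τ * (w₁ * conj w + w * conj w₁) ^ 2 * Complex.exp (-Complex.I * τ * (w * conj w)) * w -
    2 * Complex.I * (w₁ * conj w + w * conj w₁) *
      Complex.exp (-Complex.I * τ * (w * conj w)) * w₁ +
    (Complex.exp (-Complex.I * τ * (w * conj w)) - 1) / τ * w₂

theorem hasDerivAt_mul_conj {W W' V V' : ℝ → ℂ} {x : ℝ} (hW : HasDerivAt W (W' x) x)
    (hV : HasDerivAt V (V' x) x) :
    HasDerivAt (fun y => W y * conj (V y)) (W' x * conj (V x) + W x * conj (V' x)) x :=
  hW.mul hV.star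

theorem hasDerivAt_phase (τ : ℝ) {W W₁ : ℝ → ℂ} {x : ℝ} (hW : HasDerivAt W (W₁ x) x) :
    HasDerivAt (fun y => Complex.exp (-Complex.I * τ * (W y * conj (W y))))
      (Complex.exp (-Complex.I * τ * (W x * conj (W x))) *
        (-Complex.I * τ * (W₁ x * conj (W x) + W x * conj (W₁ x)))) x :=
  ((hasDerivAt_mul_conj hW hW).const_mul (-Complex.I * τ)).cexp

theorem hasDerivAt_phaseIncr {τ : ℝ} (hτ : 0 < τ) {W W₁ : ℝ → ℂ} {x : ℝ}
    (hW : HasDerivAt W (W₁ x) x) :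
    HasDerivAt (fun y => phaseIncr τ (W y)) (phaseIncrDeriv τ (W x) (W₁ x)) x := by
  have h := (((hasDerivAt_phase τ hW).sub_const 1).div_const (τ : ℂ)).mul hW
  refine h.congr_deriv ?_
  have : (τ : ℂ) ≠ 0 := by exact_mod_cast hτ.ne'
  rw [phaseIncrDeriv]
  field_simp

theorem hasDerivAt_phaseIncrDeriv {τ : ℝ} (hτ : 0 < τ) {W W₁ W₂ : ℝ → ℂ} {x : ℝ}
    (hW : HasDerivAt W (W₁ x) x) (hW₁ : HasDerivAt W₁ (W₂ x) x) :
    HasDerivAt (fun y => phaseIncrDeriv τ (W y) (W₁ y)) (phaseIncrDeriv₂ τ (W x) (W₁ x) (W₂ x)) x := by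
  have hp := hasDerivAt_phase τ hW
  have h := (((((hasDerivAt_mul_conj hW₁ hW).add (hasDerivAt_mul_conj hW hW₁)).const_mul
    (-Complex.I)).mul hp).mul hW).add (((hp.sub_const 1).div_const (τ : ℂ)).mul hW₁)
  refine h.congr_deriv ?_
  have hτ' : (τ : ℂ) ≠ 0 := by exact_mod_cast hτ.ne'
  rw [phaseIncrDeriv₂]
  simp only [Pi.add_apply, Pi.mul_apply]
  generalize Complex.exp (-Complex.I * τ * (W x * conj (W x))) = e
  generalize conj (W x) = v
  generalize conj (W₁ x) = v₁
  generalize conj (W₂ x) = v₂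
  have hI : Complex.I ^ 2 = -1 := Complex.I_sq
  field_simp
  linear_combination (W x * τ ^ 2 * e * (W x * v₁ + v * W₁ x) ^ 2) * hI

theorem phase_eq (τ : ℝ) (z : ℂ) : Complex.exp (-Complex.I * τ * (z * conj z)) =
    Complex.exp (Complex.I * ((-(τ * ‖z‖ ^ 2) : ℝ) : ℂ)) := by
  rw [Complex.mul_conj, Complex.normSq_eq_norm_sq]
  push_cast
  ring_nf

theorem norm_phase (τ : ℝ) (z : ℂ) : ‖Complex.exp (-Complex.I * τ * (z * conj z))‖ = 1 := by
  rw [phase_eq, mul_comm, Complex.norm_exp_ofReal_mul_I]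

theorem norm_phase_sub_one_div_le {τ : ℝ} (hτ : 0 < τ) (z : ℂ) :
    ‖(Complex.exp (-Complex.I * τ * (z * conj z)) - 1) / τ‖ ≤ ‖z‖ ^ 2 := by
  rw [norm_div, phase_eq, Complex.norm_real, Real.norm_of_nonneg hτ.le, div_le_iff₀ hτ]
  refine (Real.norm_exp_I_mul_ofReal_sub_one_le).trans (le_of_eq ?_)
  rw [norm_neg, Real.norm_of_nonneg (by positivity), mul_comm]

theorem norm_phaseIncr_le {τ : ℝ} (hτ : 0 < τ) (z : ℂ) : ‖phaseIncr τ z‖ ≤ ‖z‖ ^ 3 := by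
  rw [phaseIncr, norm_mul, pow_succ]
  gcongr
  exact norm_phase_sub_one_div_le hτ z

theorem norm_exp_I_sub_one_sub_le (x : ℝ) :
    ‖Complex.exp (Complex.I * x) - 1 - Complex.I * x‖ ≤ 2 * x ^ 2 := by
  have hn : ‖Complex.I * (x : ℂ)‖ = |x| := by simp
  rcases le_or_gt |x| 1 with h | h
  · refine (Complex.norm_exp_sub_one_sub_id_le (by rwa [hn])).trans ?_
    rw [hn, sq_abs]
    nlinarith [sq_nonneg x]
  · refine (norm_sub_le _ _).trans ?_
    have := Real.norm_exp_I_mul_ofReal_sub_one_le (x := x)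
    rw [hn]
    rw [Real.norm_eq_abs] at this
    nlinarith [sq_abs x]

/-- Consistency of the splitting: the forcing of the scheme is $-i|z|^2z$ up to a quintic term,
which remains of cubic type once $\tau|z|^2$ is known to be small. -/
theorem norm_phaseIncr_add_cubic_le {τ : ℝ} (hτ : 0 < τ) (z : ℂ) :
    ‖phaseIncr τ z + Complex.I * (((‖z‖ ^ 2 : ℝ) : ℂ) * z)‖ ≤ 2 * τ * ‖z‖ ^ 5 := by
  have hτ' : (τ : ℂ) ≠ 0 := by exact_mod_cast hτ.ne'
  have e : phaseIncr τ z + Complex.I * (((‖z‖ ^ 2 : ℝ) : ℂ) * z) =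
      (Complex.exp (Complex.I * ((-(τ * ‖z‖ ^ 2) : ℝ) : ℂ)) - 1 -
        Complex.I * ((-(τ * ‖z‖ ^ 2) : ℝ) : ℂ)) / τ * z := by
    rw [phaseIncr, phase_eq]
    push_cast
    field_simp
    ring
  rw [e, norm_mul, norm_div, Complex.norm_real, Real.norm_of_nonneg hτ.le]
  have h := norm_exp_I_sub_one_sub_le (-(τ * ‖z‖ ^ 2))
  calc _ ≤ 2 * (-(τ * ‖z‖ ^ 2)) ^ 2 / τ * ‖z‖ := by gcongr
    _ = _ := by field_simp

theorem norm_conj_pair_le (w w₁ : ℂ) : ‖w₁ * conj w + w * conj w₁‖ ≤ 2 * (‖w‖ * ‖w₁‖) := by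
  refine (norm_add_le _ _).trans (le_of_eq ?_)
  simp only [norm_mul, RCLike.norm_conj]
  ring

theorem norm_phaseIncrDeriv_le {τ : ℝ} (hτ : 0 < τ) (w w₁ : ℂ) :
    ‖phaseIncrDeriv τ w w₁‖ ≤ 3 * (‖w‖ * ‖w‖ * ‖w₁‖) := by
  refine (norm_add_le _ _).trans ?_
  simp only [norm_mul, norm_neg, Complex.norm_I, one_mul, norm_phase, mul_one]
  have h1 := norm_phase_sub_one_div_le hτ w
  have h2 := norm_conj_pair_le w w₁
  calc _ ≤ 2 * (‖w‖ * ‖w₁‖) * ‖w‖ + ‖w‖ ^ 2 * ‖w₁‖ := by gcongr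
    _ = _ := by ring

/-- Differentiating the exponential twice produces one quintic term, with an explicit factor $\tau$.
The bound on $\tau|w|^2$ reduces it to $|w||w_1|^2$, so the forcing remains trilinear and Hölder
with three $L^4$ factors suffices. -/
theorem norm_phaseIncrDeriv₂_le {τ θ : ℝ} (hτ : 0 < τ) {w : ℂ} (hθ : τ * ‖w‖ ^ 2 ≤ θ) (w₁ w₂ : ℂ) :
    ‖phaseIncrDeriv₂ τ w w₁ w₂‖ ≤
      3 * (‖w‖ * ‖w‖ * ‖w₂‖) + (6 + 4 * θ) * (‖w‖ * ‖w₁‖ * ‖w₁‖) := by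
  refine (norm_add_le _ _).trans ?_
  have h1 := norm_phase_sub_one_div_le hτ w
  have h2 := norm_conj_pair_le w w₁
  have h3 : ‖w₂ * conj w + 2 * (w₁ * conj w₁) + w * conj w₂‖ ≤ 2 * (‖w‖ * ‖w₂‖) + 2 * ‖w₁‖ ^ 2 := by
    refine (norm_add_le _ _).trans ((add_le_add (norm_add_le _ _) le_rfl).trans (le_of_eq ?_))
    simp only [norm_mul, RCLike.norm_conj, Complex.norm_ofNat]
    ring
  have h4 : ‖(w₁ * conj w + w * conj w₁) ^ 2‖ ≤ 4 * (‖w‖ * ‖w₁‖) ^ 2 := by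
    rw [norm_pow]
    calc _ ≤ (2 * (‖w‖ * ‖w₁‖)) ^ 2 := by gcongr
      _ = _ := by ring
  have h5 : 0 ≤ ‖w‖ * ‖w₁‖ * ‖w₁‖ := by positivity
  refine (add_le_add ((norm_sub_le _ _).trans (add_le_add (norm_sub_le _ _) le_rfl)) le_rfl).trans ?_
  simp only [norm_mul, norm_neg, Complex.norm_I, one_mul, norm_phase, mul_one, Complex.norm_real,
    Real.norm_of_nonneg hτ.le, Complex.norm_ofNat]
  calc _ ≤ (2 * (‖w‖ * ‖w₂‖) + 2 * ‖w₁‖ ^ 2) * ‖w‖ + τ * (4 * (‖w‖ * ‖w₁‖) ^ 2) * ‖w‖ +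
        2 * (2 * (‖w‖ * ‖w₁‖)) * ‖w₁‖ + ‖w‖ ^ 2 * ‖w₂‖ := by gcongr
    _ = 3 * (‖w‖ * ‖w‖ * ‖w₂‖) + (6 + 4 * (τ * ‖w‖ ^ 2)) * (‖w‖ * ‖w₁‖ * ‖w₁‖) := by ring
    _ ≤ _ := by gcongr

theorem continuous_phaseIncr {τ : ℝ} {w : Torus → ℂ} (hw : Continuous w) :
    Continuous fun x => phaseIncr τ (w x) := by
  unfold phaseIncr
  fun_prop

theorem continuous_phaseIncrDeriv {τ : ℝ} {w w₁ : Torus → ℂ} (hw : Continuous w)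
    (hw₁ : Continuous w₁) : Continuous fun x => phaseIncrDeriv τ (w x) (w₁ x) := by
  unfold phaseIncrDeriv
  fun_prop

theorem continuous_phaseIncrDeriv₂ {τ : ℝ} {w w₁ w₂ : Torus → ℂ} (hw : Continuous w)
    (hw₁ : Continuous w₁) (hw₂ : Continuous w₂) :
    Continuous fun x => phaseIncrDeriv₂ τ (w x) (w₁ x) (w₂ x) := by
  unfold phaseIncrDeriv₂
  fun_prop

/-! ### Trilinear estimates -/

section

variable {μ : Measure (ℝ × Torus)} {f g h : ℝ × Torus → ℂ}

theorem memLp_mul_mul (hf : MemLp f 4 μ) (hg : MemLp g 4 μ) (hh : MemLp h 4 μ) :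
    MemLp (fun p => f p * g p * h p) (4 / 3) μ := by
  have h1 : MemLp (fun p => f p * g p) 2 μ := hg.mul' hf
  exact hh.mul' h1

theorem lpNorm_mul_mul_le (hf : MemLp f 4 μ) (hg : MemLp g 4 μ) (hh : MemLp h 4 μ) :
    lpNorm (fun p => f p * g p * h p) (4 / 3) μ ≤ lpNorm f 4 μ * lpNorm g 4 μ * lpNorm h 4 μ := by
  have h1 : MemLp (fun p => f p * g p) 2 μ := hg.mul' hf
  refine (lpNorm_mul_le h1 hh).trans ?_
  gcongr
  · exact lpNorm_nonneg
  · exact lpNorm_mul_le hf hg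

theorem lpNorm_le_of_norm_le_trilinear {H : ℝ × Torus → ℂ} {C : ℝ} (hC : 0 ≤ C)
    (hf : MemLp f 4 μ) (hg : MemLp g 4 μ) (hh : MemLp h 4 μ)
    (hle : ∀ᵐ p ∂μ, ‖H p‖ ≤ C * (‖f p‖ * ‖g p‖ * ‖h p‖)) :
    lpNorm H (4 / 3) μ ≤ C * (lpNorm f 4 μ * lpNorm g 4 μ * lpNorm h 4 μ) := by
  have hm := memLp_mul_mul hf hg hh
  refine (lpNorm_mono_ae (hm.norm.const_mul C) ?_).trans ?_
  · filter_upwards [hle] with p hp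
    rwa [norm_mul, norm_mul]
  · have := lpNorm_const_smul (p := 4 / 3) C (fun p => ‖f p * g p * h p‖) μ
    rw [lpNorm_norm hm.1] at this
    rw [show (fun p => C * ‖f p * g p * h p‖) = C • fun p => ‖f p * g p * h p‖ from rfl, this]
    simp only [coe_nnnorm, Real.norm_of_nonneg hC]
    gcongr
    exact lpNorm_mul_mul_le hf hg hh

theorem lpNorm_le_of_norm_le_add {H H₁ H₂ : ℝ × Torus → ℂ} {p : ℝ≥0∞} (hp : 1 ≤ p)
    (h₁ : MemLp H₁ p μ) (h₂ : MemLp H₂ p μ) (hle : ∀ᵐ x ∂μ, ‖H x‖ ≤ ‖H₁ x‖ + ‖H₂ x‖) :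
    lpNorm H p μ ≤ lpNorm H₁ p μ + lpNorm H₂ p μ := by
  refine (lpNorm_mono_ae (h₁.norm.add h₂.norm) hle).trans ?_
  refine (lpNorm_add_le h₁.norm hp).trans ?_
  rw [lpNorm_norm h₁.1, lpNorm_norm h₂.1]

end

/-! ### The numerical trajectory in the interaction picture -/

/-- The trigonometric polynomial `e^{i n τ ∂ₓ²} ∑ₖ cₙ(k) exp(ikx)`. -/
def profile (A : Finset ℤ) (τ : ℝ) (c : ℕ → ℤ → ℂ) (n : ℕ) : Torus → ℂ :=
  trig A fun k => freeMul (n * τ) k * c n k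

/-- Differentiation on the Fourier side. -/
def derivSeq (c : ℕ → ℤ → ℂ) (n : ℕ) (k : ℤ) : ℂ := Complex.I * k * c n k

theorem continuous_profile (A : Finset ℤ) (τ : ℝ) (c : ℕ → ℤ → ℂ) (n : ℕ) :
    Continuous (profile A τ c n) := continuous_trig _ _

theorem torusDeriv_profile (A : Finset ℤ) (τ : ℝ) (c : ℕ → ℤ → ℂ) (n : ℕ) :
    TorusDeriv (profile A τ c n) (profile A τ (derivSeq c) n) := by
  have h := torusDeriv_trig A fun k => freeMul (n * τ) k * c n k
  have e : (fun k : ℤ => Complex.I * k * (freeMul (n * τ) k * c n k)) =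
      fun k => freeMul (n * τ) k * derivSeq c n k := by
    ext k
    rw [derivSeq]
    ring
  rwa [e] at h

theorem norm_profile_le (A : Finset ℤ) (τ : ℝ) (c : ℕ → ℤ → ℂ) (n : ℕ) (x : Torus) :
    ‖profile A τ c n x‖ ≤ ∑ k ∈ A, ‖c n k‖ := by
  refine (norm_trig_le _ _ _).trans (le_of_eq (Finset.sum_congr rfl fun k _ => ?_))
  rw [norm_mul, norm_freeMul, one_mul]

theorem norm_le_l2 {A : Finset ℤ} (c : ℤ → ℂ) {k : ℤ} (hk : k ∈ A) : ‖c k‖ ≤ l2 A c := by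
  refine le_of_pow_le_pow_left₀ (n := 2) (by norm_num) (l2_nonneg _ _) ?_
  rw [l2_sq]
  exact Finset.single_le_sum (f := fun k => ‖c k‖ ^ 2) (fun _ _ => by positivity) hk

theorem bddSeq_profile {A : Finset ℤ} {c : ℕ → ℤ → ℂ} {M : ℝ} (hc : ∀ n, ∀ k ∈ A, ‖c n k‖ ≤ M)
    (τ : ℝ) : BddSeq (profile A τ c) :=
  ⟨continuous_profile A τ c, ∑ _k ∈ A, M, fun n x =>
    (norm_profile_le A τ c n x).trans (Finset.sum_le_sum (hc n))⟩

theorem exists_bound_derivSeq {A : Finset ℤ} {c : ℕ → ℤ → ℂ} {M : ℝ}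
    (hc : ∀ n, ∀ k ∈ A, ‖c n k‖ ≤ M) : ∃ M', ∀ n, ∀ k ∈ A, ‖derivSeq c n k‖ ≤ M' := by
  refine ⟨∑ k ∈ A, ‖(k : ℂ)‖ * M, fun n k hk => ?_⟩
  have h0 : ∀ j ∈ A, 0 ≤ ‖(j : ℂ)‖ * M := fun j hj =>
    mul_nonneg (norm_nonneg _) ((norm_nonneg _).trans (hc n j hj))
  refine le_trans ?_ (Finset.single_le_sum (f := fun k : ℤ => ‖(k : ℂ)‖ * M) h0 hk)
  rw [derivSeq, norm_mul, norm_mul, Complex.norm_I, one_mul]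
  exact mul_le_mul_of_nonneg_left (hc n k hk) (norm_nonneg _)

theorem stepFun_profile_ae {τ : ℝ} (hτ : 0 < τ) (A : Finset ℤ) (c : ℕ → ℤ → ℂ) (m : ℕ) (b : ℝ) :
    stepFun τ (profile A τ c) =ᵐ[slab (m * τ) b] stepMode A (stepMul τ) τ c := by
  filter_upwards [ae_slab_mem (m * τ) b] with p hp
  have h0 : 0 < p.1 := lt_of_le_of_lt (by positivity) hp.1
  simp only [stepFun, profile, trig, stepMode, mode, stepMul, stepTime_eq_stepIdx hτ h0]

/-- The recursion is diagonal in frequency, so it commutes with differentiation; only the forcing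
has to be differentiated. -/
theorem DuhamelSeq.deriv {A : Finset ℤ} {τ : ℝ} {c : ℕ → ℤ → ℂ} {f f' : ℕ → Torus → ℂ}
    (h : DuhamelSeq A τ c f) (hf : ∀ n, TorusDeriv (f n) (f' n)) (hf' : ∀ n, Continuous (f' n)) :
    DuhamelSeq A τ (derivSeq c) f' := by
  intro n k hk
  rw [derivSeq, derivSeq, h n k hk, (hf n).fourierCoeff (hf' n)]
  ring

/-- The Fourier coefficients `b` of a filtered Lie splitting trajectory in the interaction
picture. -/
structure Trajectory (A : Finset ℤ) (τ M : ℝ) (b : ℕ → ℤ → ℂ) : Prop where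
  pos : 0 < τ
  le_one : τ ≤ 1
  supp : ∀ k ∈ A, τ * (k : ℝ) ^ 2 ≤ 1
  mass : ∀ n, l2 A (b n) ≤ M
  duhamel : DuhamelSeq A τ b fun n x => phaseIncr τ (profile A τ b n x)

/-- The size of two derivatives. -/
def energy (A : Finset ℤ) (b : ℕ → ℤ → ℂ) (n : ℕ) : ℝ :=
  l2 A (derivSeq (derivSeq b) n) + l2 A (derivSeq b n) ^ 2

theorem energy_nonneg (A : Finset ℤ) (b : ℕ → ℤ → ℂ) (n : ℕ) : 0 ≤ energy A b n :=
  add_nonneg (l2_nonneg _ _) (by positivity)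

theorem l2_derivSeq (A : Finset ℤ) (c : ℕ → ℤ → ℂ) (n : ℕ) :
    l2 A (derivSeq c n) = l2 A (fun k => k * c n k) :=
  le_antisymm (l2_mono fun k _ => by simp [derivSeq]) (l2_mono fun k _ => by simp [derivSeq])

/-! ### Boundedness of a trajectory and its differentiated recursions -/

section

variable {A : Finset ℤ} {τ M : ℝ} {b : ℕ → ℤ → ℂ} (h : Trajectory A τ M b)
include h

theorem Trajectory.nonneg : 0 ≤ M := (l2_nonneg _ _).trans (h.mass 0)

theorem Trajectory.bound : ∀ n, ∀ k ∈ A, ‖b n k‖ ≤ M := fun n _ hk =>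
  (norm_le_l2 (b n) hk).trans (h.mass n)

theorem Trajectory.bddSeq₀ : BddSeq (profile A τ b) := bddSeq_profile h.bound τ

theorem Trajectory.bddSeq₁ : BddSeq (profile A τ (derivSeq b)) := by
  obtain ⟨M', hM'⟩ := exists_bound_derivSeq h.bound
  exact bddSeq_profile hM' τ

theorem Trajectory.bddSeq₂ : BddSeq (profile A τ (derivSeq (derivSeq b))) := by
  obtain ⟨M', hM'⟩ := exists_bound_derivSeq h.bound
  obtain ⟨M'', hM''⟩ := exists_bound_derivSeq hM'
  exact bddSeq_profile hM'' τ

theorem Trajectory.bddSeq_incr : BddSeq fun n x => phaseIncr τ (profile A τ b n x) := by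
  obtain ⟨hc, C, hC⟩ := h.bddSeq₀
  refine ⟨fun n => continuous_phaseIncr (hc n), C ^ 3, fun n x => ?_⟩
  refine (norm_phaseIncr_le h.pos _).trans ?_
  gcongr
  exact hC n x

theorem Trajectory.bddSeq_incrDeriv :
    BddSeq fun n x => phaseIncrDeriv τ (profile A τ b n x) (profile A τ (derivSeq b) n x) := by
  obtain ⟨hc, C, hC⟩ := h.bddSeq₀
  obtain ⟨hc₁, C₁, hC₁⟩ := h.bddSeq₁
  have h0 : 0 ≤ C := (norm_nonneg _).trans (hC 0 0)
  refine ⟨fun n => continuous_phaseIncrDeriv (hc n) (hc₁ n), 3 * (C * C * C₁), fun n x => ?_⟩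
  refine (norm_phaseIncrDeriv_le h.pos _ _).trans ?_
  have := hC n x
  have := hC₁ n x
  gcongr

theorem Trajectory.bddSeq_incrDeriv₂ :
    BddSeq fun n x => phaseIncrDeriv₂ τ (profile A τ b n x) (profile A τ (derivSeq b) n x)
      (profile A τ (derivSeq (derivSeq b)) n x) := by
  obtain ⟨hc, C, hC⟩ := h.bddSeq₀
  obtain ⟨hc₁, C₁, hC₁⟩ := h.bddSeq₁
  obtain ⟨hc₂, C₂, hC₂⟩ := h.bddSeq₂
  have h0 : 0 ≤ C := (norm_nonneg _).trans (hC 0 0)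
  have h1 : 0 ≤ C₁ := (norm_nonneg _).trans (hC₁ 0 0)
  have hτ := h.pos
  refine ⟨fun n => continuous_phaseIncrDeriv₂ (hc n) (hc₁ n) (hc₂ n),
    3 * (C * C * C₂) + (6 + 4 * (τ * C ^ 2)) * (C * C₁ * C₁), fun n x => ?_⟩
  have e0 := hC n x
  have e1 := hC₁ n x
  have e2 := hC₂ n x
  refine (norm_phaseIncrDeriv₂_le h.pos (θ := τ * C ^ 2) (by gcongr) _ _).trans ?_
  gcongr

theorem Trajectory.duhamel₁ : DuhamelSeq A τ (derivSeq b) fun n x =>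
    phaseIncrDeriv τ (profile A τ b n x) (profile A τ (derivSeq b) n x) :=
  h.duhamel.deriv
    (fun n x => hasDerivAt_phaseIncr h.pos (W := fun y : ℝ => profile A τ b n y)
      (W₁ := fun y : ℝ => profile A τ (derivSeq b) n y) (torusDeriv_profile A τ b n x))
    h.bddSeq_incrDeriv.1

theorem Trajectory.torusDeriv_incrDeriv (n : ℕ) :
    TorusDeriv (fun x => phaseIncrDeriv τ (profile A τ b n x) (profile A τ (derivSeq b) n x))
      fun x => phaseIncrDeriv₂ τ (profile A τ b n x) (profile A τ (derivSeq b) n x)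
        (profile A τ (derivSeq (derivSeq b)) n x) :=
  fun x => hasDerivAt_phaseIncrDeriv h.pos (W := fun y : ℝ => profile A τ b n y)
      (W₁ := fun y : ℝ => profile A τ (derivSeq b) n y)
      (W₂ := fun y : ℝ => profile A τ (derivSeq (derivSeq b)) n y)
      (torusDeriv_profile A τ b n x) (torusDeriv_profile A τ (derivSeq b) n x)

theorem Trajectory.torusDeriv_incr (n : ℕ) :
    TorusDeriv (fun x => phaseIncr τ (profile A τ b n x))
      fun x => phaseIncrDeriv τ (profile A τ b n x) (profile A τ (derivSeq b) n x) :=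
  fun x => hasDerivAt_phaseIncr h.pos (W := fun y : ℝ => profile A τ b n y)
      (W₁ := fun y : ℝ => profile A τ (derivSeq b) n y) (torusDeriv_profile A τ b n x)

theorem Trajectory.duhamel₂ : DuhamelSeq A τ (derivSeq (derivSeq b)) fun n x =>
    phaseIncrDeriv₂ τ (profile A τ b n x) (profile A τ (derivSeq b) n x)
      (profile A τ (derivSeq (derivSeq b)) n x) :=
  h.duhamel₁.deriv h.torusDeriv_incrDeriv h.bddSeq_incrDeriv₂.1

theorem Trajectory.sum_norm_sq_le (n : ℕ) {y : ℝ} (hy : 1 ≤ y) :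
    (∑ k ∈ A, ‖b n k‖) ^ 2 ≤ 6 * y * (M ^ 2 + l2 A (derivSeq b n) ^ 2 / y ^ 2) := by
  have h1 := FilteredNLS.sum_norm_sq_le hy A (b n)
  rw [← l2_derivSeq] at h1
  have := l2_nonneg A (b n)
  have := h.mass n
  exact h1.trans (by gcongr)

/-- Agmon's inequality at the cutoff scale $y=\tau^{-1/2}$: the filter gives $\tau\|\partial
w\|^2\le M^2$, and $\tau y=\sqrt\tau\le1$. It supplies $\theta=12M^2$ for the second derivative of
the forcing. -/
theorem Trajectory.mul_sq_norm_le (n : ℕ) (x : Torus) :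
    τ * ‖profile A τ b n x‖ ^ 2 ≤ 12 * M ^ 2 := by
  have hτ := h.pos
  set y : ℝ := 1 / Real.sqrt τ with hy
  have hs : 0 < Real.sqrt τ := Real.sqrt_pos.mpr hτ
  have hs1 : Real.sqrt τ ≤ 1 := Real.sqrt_le_one.mpr h.le_one
  have hsq : Real.sqrt τ ^ 2 = τ := Real.sq_sqrt hτ.le
  have h1 := h.sum_norm_sq_le n (y := y) (by rw [hy, le_div_iff₀ hs]; linarith)
  have h2 : l2 A (derivSeq b n) ^ 2 * τ ≤ M ^ 2 := by
    have hm : l2 A (b n) ^ 2 ≤ M ^ 2 := by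
      have := l2_nonneg A (b n)
      have := h.mass n
      gcongr
    refine le_trans ?_ hm
    rw [l2_sq, l2_sq, Finset.sum_mul]
    refine Finset.sum_le_sum fun k hk => ?_
    have h3 := h.supp k hk
    have h4 : ‖derivSeq b n k‖ ^ 2 = (k : ℝ) ^ 2 * ‖b n k‖ ^ 2 := by
      rw [derivSeq, norm_mul, norm_mul, Complex.norm_I, one_mul, Complex.norm_intCast, mul_pow, sq_abs]
    rw [h4]
    have : 0 ≤ ‖b n k‖ ^ 2 := by positivity
    nlinarith
  have h5 : ‖profile A τ b n x‖ ^ 2 ≤ (∑ k ∈ A, ‖b n k‖) ^ 2 := by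
    gcongr
    exact norm_profile_le A τ b n x
  have e : l2 A (derivSeq b n) ^ 2 / y ^ 2 = l2 A (derivSeq b n) ^ 2 * τ := by
    rw [hy, div_pow, hsq, one_pow]; field_simp
  rw [e] at h1
  have hty : τ * y ≤ 1 := by
    have : τ * y = Real.sqrt τ := by rw [hy, mul_one_div, div_eq_iff hs.ne', ← sq, hsq]
    linarith
  have hy0 : 0 ≤ y := by positivity
  have hM : 0 ≤ M ^ 2 := by positivity
  calc τ * ‖profile A τ b n x‖ ^ 2 ≤ τ * (6 * y * (M ^ 2 + M ^ 2)) := by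
        gcongr
        exact h5.trans (h1.trans (by gcongr))
    _ = 12 * M ^ 2 * (τ * y) := by ring
    _ ≤ 12 * M ^ 2 * 1 := by gcongr
    _ = _ := by ring

end

/-- Smallness of the length of a block. -/
def SmallBlock (M δ : ℝ) : Prop := 0 < δ ∧ δ ≤ 1 / 2 ∧ 2916 * δ ^ (1 / 4 : ℝ) * (18 * M) ^ 2 ≤ 1 / 2

theorem exists_mul_rpow_le (C : ℝ) : ∃ δ > (0 : ℝ), δ ≤ 1 / 2 ∧ C * δ ^ (1 / 4 : ℝ) ≤ 1 / 2 := by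
  have hc : Tendsto (fun δ : ℝ => C * δ ^ (1 / 4 : ℝ)) (𝓝[>] 0) (𝓝 0) := by
    have h : ContinuousAt (fun δ : ℝ => C * δ ^ (1 / 4 : ℝ)) 0 :=
      (Real.continuousAt_rpow_const 0 (1 / 4) (Or.inr (by norm_num))).const_mul _
    have h2 := h.tendsto
    rw [Real.zero_rpow (by norm_num), mul_zero] at h2
    exact h2.mono_left nhdsWithin_le_nhds
  have h1 : ∀ᶠ δ : ℝ in 𝓝[>] 0, C * δ ^ (1 / 4 : ℝ) ≤ 1 / 2 :=
    hc.eventually_le_const (by norm_num)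
  have h2 : ∀ᶠ δ : ℝ in 𝓝[>] 0, δ ≤ 1 / 2 := by
    have : ∀ᶠ δ : ℝ in 𝓝 0, δ ≤ 1 / 2 := eventually_le_nhds (by norm_num)
    exact this.filter_mono nhdsWithin_le_nhds
  obtain ⟨δ, ⟨h3, h4⟩, h5⟩ := ((h1.and h2).and self_mem_nhdsWithin).exists
  exact ⟨δ, h5, h4, h3⟩

theorem exists_smallBlock (M : ℝ) : ∃ δ, SmallBlock M δ := by
  obtain ⟨δ, h0, h1, h2⟩ := exists_mul_rpow_le (2916 * (18 * M) ^ 2)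
  exact ⟨δ, h0, h1, by linarith⟩

/-! ### A priori bounds and growth of the energy on a short block -/

section

variable {A : Finset ℤ} {τ M : ℝ} {b : ℕ → ℤ → ℂ} (h : Trajectory A τ M b) {δ : ℝ}
  (hδ : SmallBlock M δ)
include h hδ

/-- Induction on the number of cells: the bound on $n+1$ cells involves the forcing on the first $n$
only, so the cubic feedback is controlled by the induction hypothesis and no continuity argument is
needed. -/
theorem Trajectory.lpNorm_profile_le {m n : ℕ} (hmn : m ≤ n) (hle : ((n : ℝ) - m) * τ ≤ δ) :
    lpNorm (stepFun τ (profile A τ b)) 4 (slab (m * τ) (n * τ)) ≤ 18 * M := by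
  have hM := h.nonneg
  have hτ := h.pos
  obtain ⟨hδ0, hδ1, hδ2⟩ := hδ
  induction n, hmn using Nat.le_induction with
  | base =>
    have : slab (m * τ) (m * τ) = 0 := by simp [slab]
    rw [this]
    simpa using hM
  | succ n hmn ih =>
    have hmn' : (0 : ℝ) ≤ (n : ℝ) - m := by
      have : (m : ℝ) ≤ n := by exact_mod_cast hmn
      linarith
    have hle' : ((n : ℝ) - m) * τ ≤ δ := by push_cast at hle; nlinarith
    have h0 : 0 ≤ (((n + 1 : ℕ) : ℝ) - m) * τ := by
      push_cast
      have : 0 ≤ (n : ℝ) + 1 - m := by linarith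
      positivity
    specialize ih hle'
    rw [lpNorm_congr (stepFun_profile_ae hτ A b m _)]
    refine (h.duhamel.lpNorm_stepMode_succ_le hτ h.bddSeq_incr h.supp (isMultiplier_stepMul τ)
      (by norm_num) (strichartz_stepMul hτ h.supp) hmn (hle.trans hδ1)).trans ?_
    set X := lpNorm (stepFun τ (profile A τ b)) 4 (slab (m * τ) (n * τ)) with hX
    have hX0 : 0 ≤ X := lpNorm_nonneg
    have hm := h.bddSeq₀.memLp τ 4 (m * τ) (n * τ)
    have hF : lpNorm (stepFun τ fun n x => phaseIncr τ (profile A τ b n x)) (4 / 3)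
        (slab (m * τ) (n * τ)) ≤ 1 * (X * X * X) := by
      refine lpNorm_le_of_norm_le_trilinear zero_le_one hm hm hm (Eventually.of_forall fun p => ?_)
      refine (norm_phaseIncr_le hτ _).trans (le_of_eq ?_)
      simp only [stepFun]
      ring
    have hr : ((((n + 1 : ℕ) : ℝ) - m) * τ) ^ (1 / 4 : ℝ) ≤ δ ^ (1 / 4 : ℝ) :=
      Real.rpow_le_rpow h0 hle (by norm_num)
    have hmass := h.mass m
    have hd : 0 ≤ δ ^ (1 / 4 : ℝ) := by positivity
    -- As $972\cdot18M=2916\cdot6M$, the smallness of the block leaves at most $3M$ for the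
    -- nonlinear part, and $9M+3M\le18M$.
    calc _ ≤ 9 * M + 108 * 9 * δ ^ (1 / 4 : ℝ) * (1 * (18 * M * (18 * M) * (18 * M))) := by
          refine add_le_add (by gcongr) (mul_le_mul (by gcongr) (hF.trans (by gcongr))
            lpNorm_nonneg (by positivity))
      _ = 9 * M + (2916 * δ ^ (1 / 4 : ℝ) * (18 * M) ^ 2) * (6 * M) := by ring
      _ ≤ 9 * M + 1 / 2 * (6 * M) := by gcongr
      _ ≤ _ := by linarith

/-- The forcing of the differentiated recursion is at most $3|w|^2|\partial w|$, linear in the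
unknown, so on a small block half of the finite left-hand side is absorbed ($2916=3\cdot972$). -/
theorem Trajectory.lpNorm_profile_deriv_le {m n : ℕ} (hmn : m ≤ n) (hle : ((n : ℝ) - m) * τ ≤ δ) :
    lpNorm (stepFun τ (profile A τ (derivSeq b))) 4 (slab (m * τ) (n * τ)) ≤
      18 * l2 A (derivSeq b m) := by
  have hX := h.lpNorm_profile_le hδ hmn hle
  have hM := h.nonneg
  have hτ := h.pos
  obtain ⟨hδ0, hδ1, hδ2⟩ := hδ
  have hmn' : (0 : ℝ) ≤ (n : ℝ) - m := by
    have : (m : ℝ) ≤ n := by exact_mod_cast hmn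
    linarith
  have hmain := h.duhamel₁.lpNorm_stepMode_le hτ h.bddSeq_incrDeriv h.supp (isMultiplier_stepMul τ)
      (by norm_num) (strichartz_stepMul hτ h.supp) hmn (hle.trans hδ1)
  rw [← lpNorm_congr (stepFun_profile_ae hτ A (derivSeq b) m _)] at hmain
  set D := lpNorm (stepFun τ (profile A τ (derivSeq b))) 4 (slab (m * τ) (n * τ)) with hD
  have hD0 : 0 ≤ D := lpNorm_nonneg
  have hm := h.bddSeq₀.memLp τ 4 (m * τ) (n * τ)
  have hm₁ := h.bddSeq₁.memLp τ 4 (m * τ) (n * τ)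
  have hF := lpNorm_le_of_norm_le_trilinear (C := 3) (by norm_num) hm hm hm₁
    (H := stepFun τ fun n x => phaseIncrDeriv τ (profile A τ b n x) (profile A τ (derivSeq b) n x))
    (Eventually.of_forall fun p => norm_phaseIncrDeriv_le hτ _ _)
  have hr : (((n : ℝ) - m) * τ) ^ (1 / 4 : ℝ) ≤ δ ^ (1 / 4 : ℝ) :=
    Real.rpow_le_rpow (by positivity) hle (by norm_num)
  have hd : 0 ≤ δ ^ (1 / 4 : ℝ) := by positivity
  have : D ≤ 9 * l2 A (derivSeq b m) + 1 / 2 * D := by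
    calc D ≤ 9 * l2 A (derivSeq b m) + 108 * 9 * δ ^ (1 / 4 : ℝ) *
          (3 * (18 * M * (18 * M) * D)) := by
          refine hmain.trans (add_le_add le_rfl (mul_le_mul (by gcongr) (hF.trans ?_)
            lpNorm_nonneg (by positivity)))
          gcongr
          exact lpNorm_nonneg
      _ = 9 * l2 A (derivSeq b m) + (2916 * δ ^ (1 / 4 : ℝ) * (18 * M) ^ 2) * D := by ring
      _ ≤ _ := by gcongr
  linarith

/-- Second derivatives enter linearly and are absorbed as before. The source term $|w||\partial
w|^2$ is quadratic in first derivatives, which is why `energy` contains the square of their norm. -/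
theorem Trajectory.lpNorm_incrDeriv₂_le {m n : ℕ} (hmn : m ≤ n) (hle : ((n : ℝ) - m) * τ ≤ δ) :
    lpNorm (stepFun τ fun n x => phaseIncrDeriv₂ τ (profile A τ b n x) (profile A τ (derivSeq b) n x)
      (profile A τ (derivSeq (derivSeq b)) n x)) (4 / 3) (slab (m * τ) (n * τ)) ≤
    (54 * (18 * M) ^ 2 + 1000 * (6 + 48 * M ^ 2) * (18 * M)) * energy A b m := by
  have hX := h.lpNorm_profile_le hδ hmn hle
  have hY := h.lpNorm_profile_deriv_le hδ hmn hle
  have hM := h.nonneg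
  have hτ := h.pos
  obtain ⟨hδ0, hδ1, hδ2⟩ := hδ
  have hmn' : (0 : ℝ) ≤ (n : ℝ) - m := by
    have : (m : ℝ) ≤ n := by exact_mod_cast hmn
    linarith
  have hmain := h.duhamel₂.lpNorm_stepMode_le hτ h.bddSeq_incrDeriv₂ h.supp (isMultiplier_stepMul τ)
      (by norm_num) (strichartz_stepMul hτ h.supp) hmn (hle.trans hδ1)
  rw [← lpNorm_congr (stepFun_profile_ae hτ A (derivSeq (derivSeq b)) m _)] at hmain
  set D := lpNorm (stepFun τ (profile A τ (derivSeq (derivSeq b)))) 4 (slab (m * τ) (n * τ)) with hD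
  set D₁ := lpNorm (stepFun τ (profile A τ (derivSeq b))) 4 (slab (m * τ) (n * τ)) with hD₁
  set y₁ := l2 A (derivSeq b m) with hy₁
  set y₂ := l2 A (derivSeq (derivSeq b) m) with hy₂
  have hy₁0 : 0 ≤ y₁ := l2_nonneg _ _
  have hy₂0 : 0 ≤ y₂ := l2_nonneg _ _
  have hD0 : 0 ≤ D := lpNorm_nonneg
  have hD₁0 : 0 ≤ D₁ := lpNorm_nonneg
  have hm := h.bddSeq₀.memLp τ 4 (m * τ) (n * τ)
  have hm₁ := h.bddSeq₁.memLp τ 4 (m * τ) (n * τ)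
  have hm₂ := h.bddSeq₂.memLp τ 4 (m * τ) (n * τ)
  set F := lpNorm (stepFun τ fun n x => phaseIncrDeriv₂ τ (profile A τ b n x)
    (profile A τ (derivSeq b) n x) (profile A τ (derivSeq (derivSeq b)) n x)) (4 / 3)
    (slab (m * τ) (n * τ)) with hFdef
  have hθ : 0 ≤ 6 + 48 * M ^ 2 := by positivity
  have hF : F ≤ 3 * (18 * M * (18 * M) * D) + (6 + 48 * M ^ 2) * (18 * M * D₁ * D₁) := by
    have e1 := (memLp_mul_mul hm hm hm₂).const_mul 3
    have e2 := (memLp_mul_mul hm hm₁ hm₁).const_mul (((6 + 48 * M ^ 2 : ℝ) : ℂ))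
    have hadd := lpNorm_le_of_norm_le_add one_le_fourThirds e1 e2
      (H := stepFun τ fun n x => phaseIncrDeriv₂ τ (profile A τ b n x)
        (profile A τ (derivSeq b) n x) (profile A τ (derivSeq (derivSeq b)) n x))
      (Eventually.of_forall fun p => by
        refine (norm_phaseIncrDeriv₂_le hτ (θ := 12 * M ^ 2) (h.mul_sq_norm_le _ _) _ _).trans
          (le_of_eq ?_)
        simp only [norm_mul, Complex.norm_real, Real.norm_of_nonneg hθ, stepFun, Complex.norm_ofNat]
        ring)
    refine hadd.trans (add_le_add ?_ ?_)
    · refine (lpNorm_le_of_norm_le_trilinear (C := 3) (by norm_num) hm hm hm₂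
        (Eventually.of_forall fun p => ?_)).trans ?_
      · simp only [norm_mul, Complex.norm_ofNat, le_refl]
      · gcongr
        exact lpNorm_nonneg
    · refine (lpNorm_le_of_norm_le_trilinear (C := 6 + 48 * M ^ 2) hθ hm hm₁ hm₁
        (Eventually.of_forall fun p => ?_)).trans ?_
      · simp only [norm_mul, Complex.norm_real, Real.norm_of_nonneg hθ, le_refl]
      · gcongr
  have hr : (((n : ℝ) - m) * τ) ^ (1 / 4 : ℝ) ≤ δ ^ (1 / 4 : ℝ) :=
    Real.rpow_le_rpow (by positivity) hle (by norm_num)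
  have hd : 0 ≤ δ ^ (1 / 4 : ℝ) := by positivity
  have hF0 : 0 ≤ F := lpNorm_nonneg
  have hD₁sq : D₁ * D₁ ≤ 324 * y₁ ^ 2 := by nlinarith
  -- `27 (18 M)² δ^{1/4}` is small, so `D` is absorbed into the left-hand side of the estimate
  have hkey : 3 * (18 * M) ^ 2 * D ≤ 27 * (18 * M) ^ 2 * y₂ + 1 / 2 * F := by
    have h1 : D ≤ 9 * y₂ + 972 * δ ^ (1 / 4 : ℝ) * F := by
      refine hmain.trans (add_le_add le_rfl ?_)
      have : 108 * 9 * (((n : ℝ) - m) * τ) ^ (1 / 4 : ℝ) ≤ 972 * δ ^ (1 / 4 : ℝ) := by linarith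
      gcongr
    calc 3 * (18 * M) ^ 2 * D ≤ 3 * (18 * M) ^ 2 * (9 * y₂ + 972 * δ ^ (1 / 4 : ℝ) * F) := by gcongr
      _ = 27 * (18 * M) ^ 2 * y₂ + (2916 * δ ^ (1 / 4 : ℝ) * (18 * M) ^ 2) * F := by ring
      _ ≤ _ := by gcongr
  have hlast : (6 + 48 * M ^ 2) * (18 * M * D₁ * D₁) ≤ (6 + 48 * M ^ 2) * (18 * M) * (324 * y₁ ^ 2) := by
    rw [mul_assoc (18 * M), ← mul_assoc (6 + 48 * M ^ 2)]
    gcongr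
  have hfin : F ≤ 54 * (18 * M) ^ 2 * y₂ + 648 * ((6 + 48 * M ^ 2) * (18 * M)) * y₁ ^ 2 := by
    nlinarith
  rw [energy]
  have p1 : 0 ≤ (6 + 48 * M ^ 2) * (18 * M) := by positivity
  have p2 : 0 ≤ (6 + 48 * M ^ 2) * (18 * M) * y₂ := by positivity
  have p3 : 0 ≤ (6 + 48 * M ^ 2) * (18 * M) * y₁ ^ 2 := by positivity
  have p4 : 0 ≤ 54 * (18 * M) ^ 2 * y₁ ^ 2 := by positivity
  nlinarith

theorem Trajectory.l2_derivSeq_le {m n : ℕ} (hmn : m ≤ n) (hle : ((n : ℝ) - m) * τ ≤ δ) :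
    l2 A (derivSeq b n) ≤ (1 + 486 * (18 * M) ^ 2) * l2 A (derivSeq b m) := by
  have hX := h.lpNorm_profile_le hδ hmn hle
  have hY := h.lpNorm_profile_deriv_le hδ hmn hle
  have hM := h.nonneg
  have hτ := h.pos
  obtain ⟨hδ0, hδ1, hδ2⟩ := hδ
  have hmain := h.duhamel₁.l2_le hτ h.bddSeq_incrDeriv h.supp hmn (hle.trans hδ1)
  have hm := h.bddSeq₀.memLp τ 4 (m * τ) (n * τ)
  have hm₁ := h.bddSeq₁.memLp τ 4 (m * τ) (n * τ)
  have hF := lpNorm_le_of_norm_le_trilinear (C := 3) (by norm_num) hm hm hm₁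
    (H := stepFun τ fun n x => phaseIncrDeriv τ (profile A τ b n x) (profile A τ (derivSeq b) n x))
    (Eventually.of_forall fun p => norm_phaseIncrDeriv_le hτ _ _)
  have h2 : 3 * (lpNorm (stepFun τ (profile A τ b)) 4 (slab (m * τ) (n * τ)) *
      lpNorm (stepFun τ (profile A τ b)) 4 (slab (m * τ) (n * τ)) *
      lpNorm (stepFun τ (profile A τ (derivSeq b))) 4 (slab (m * τ) (n * τ))) ≤
      3 * (18 * M * (18 * M) * (18 * l2 A (derivSeq b m))) := by
    gcongr <;> exact lpNorm_nonneg
  linarith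

theorem Trajectory.energy_le {m n : ℕ} (hmn : m ≤ n) (hle : ((n : ℝ) - m) * τ ≤ δ) :
    energy A b n ≤ (1 + 9 * (54 * (18 * M) ^ 2 + 1000 * (6 + 48 * M ^ 2) * (18 * M)) +
      (1 + 486 * (18 * M) ^ 2) ^ 2) * energy A b m := by
  have h1 := h.l2_derivSeq_le hδ hmn hle
  have h2 := h.lpNorm_incrDeriv₂_le hδ hmn hle
  have hM := h.nonneg
  have hmain := h.duhamel₂.l2_le h.pos h.bddSeq_incrDeriv₂ h.supp hmn (hle.trans hδ.2.1)
  have h3 : l2 A (derivSeq b n) ^ 2 ≤ ((1 + 486 * (18 * M) ^ 2) * l2 A (derivSeq b m)) ^ 2 := by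
    have := l2_nonneg A (derivSeq b n)
    gcongr
  have h4 : l2 A (derivSeq (derivSeq b) m) ≤ energy A b m := le_add_of_nonneg_right (by positivity)
  have h5 : l2 A (derivSeq b m) ^ 2 ≤ energy A b m := le_add_of_nonneg_left (l2_nonneg _ _)
  rw [mul_pow] at h3
  have h6 : (1 + 486 * (18 * M) ^ 2) ^ 2 * l2 A (derivSeq b m) ^ 2 ≤
      (1 + 486 * (18 * M) ^ 2) ^ 2 * energy A b m := by gcongr
  rw [energy]
  linarith

end

/-! ### Iterating over blocks -/

/-- A bound over blocks of length `δ` gives a bound up to time `T`. -/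
theorem le_of_block_bound {Λ δ T : ℝ} (hΛ : 0 ≤ Λ) (hδ : 0 < δ) {τ : ℝ} (hτ : 0 < τ)
    (hτδ : τ ≤ δ / 2) {z : ℕ → ℝ} {E : ℝ} (hE : 0 ≤ E) (hz0 : 0 ≤ z 0)
    (hz : ∀ m n : ℕ, m ≤ n → ((n : ℝ) - m) * τ ≤ δ → n * τ ≤ T → z n ≤ Λ * z m + E) {n : ℕ}
    (hn : n * τ ≤ T) : z n ≤ (Λ + 1) ^ ⌈2 * T / δ⌉₊ * (z 0 + E) := by
  -- Since $\tau\le\delta/2$, a block of $L$ steps lasts at least $\delta/2$, so the number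
  -- $\lceil2T/\delta\rceil$ of blocks does not depend on $\tau$.
  set L := ⌊δ / τ⌋₊ with hL
  have hL1 : (L : ℝ) * τ ≤ δ := by
    rw [← le_div_iff₀ hτ]
    exact Nat.floor_le (by positivity)
  have hL2 : δ / 2 ≤ L * τ := by
    have h1 : δ / τ < L + 1 := Nat.lt_floor_add_one _
    rw [div_lt_iff₀ hτ] at h1
    linarith
  have key : ∀ j n : ℕ, n ≤ j * L → n * τ ≤ T → z n ≤ (Λ + 1) ^ j * (z 0 + E) := by
    intro j
    induction j with
    | zero =>
      intro n hn _
      obtain rfl : n = 0 := by omega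
      simpa using hE
    | succ j ih =>
      intro n hn hnT
      -- Truncated subtraction: if $n<L$ the block simply starts at $0$ and is shorter.
      have hm : n - L ≤ j * L := by
        rw [Nat.succ_mul] at hn
        omega
      have hmn : n - L ≤ n := Nat.sub_le _ _
      have hd : ((n : ℝ) - (n - L : ℕ)) ≤ L := by
        have h1 : n ≤ (n - L) + L := by omega
        have : (n : ℝ) ≤ ((n - L : ℕ) : ℝ) + L := by exact_mod_cast h1
        linarith
      have hmT : ((n - L : ℕ) : ℝ) * τ ≤ T := by
        refine le_trans ?_ hnT
        gcongr
      have h1 := hz (n - L) n hmn ((mul_le_mul_of_nonneg_right hd hτ.le).trans hL1) hnT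
      have h2 := ih (n - L) hm hmT
      have h3 : E ≤ (Λ + 1) ^ j * (z 0 + E) := by
        have : 1 ≤ (Λ + 1) ^ j := one_le_pow₀ (by linarith)
        nlinarith
      calc z n ≤ Λ * ((Λ + 1) ^ j * (z 0 + E)) + (Λ + 1) ^ j * (z 0 + E) :=
            h1.trans (add_le_add (mul_le_mul_of_nonneg_left h2 hΛ) h3)
        _ = _ := by ring
  refine key _ n ?_ hn
  have h1 : 2 * T / δ ≤ (⌈2 * T / δ⌉₊ : ℝ) := Nat.le_ceil _
  rw [div_le_iff₀ hδ] at h1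
  have h2 : (n : ℝ) * τ ≤ ((⌈2 * T / δ⌉₊ * L : ℕ) : ℝ) * τ := by
    push_cast
    have : (0 : ℝ) ≤ ⌈2 * T / δ⌉₊ := Nat.cast_nonneg _
    nlinarith
  exact_mod_cast le_of_mul_le_mul_right h2 hτ

/-! ### The filtered Lie splitting scheme as a trajectory -/

/-- The frequencies `|k| ≤ K`. -/
def freqs (K : ℝ) : Finset ℤ := Finset.Icc (-⌊K⌋) ⌊K⌋

theorem mem_freqs {K : ℝ} {k : ℤ} : k ∈ freqs K ↔ |(k : ℝ)| ≤ K := by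
  rw [freqs, Finset.mem_Icc, ← abs_le, Int.le_floor]
  push_cast
  rfl

theorem freqFilter_eq_trig (K : ℝ) (f : Torus → ℂ) (x : Torus) :
    freqFilter K f x = trig (freqs K) (fourierCoeff f) x := by
  simp [freqFilter, trig, freqs, expi, ContinuousMap.sum_apply]

theorem fourierCoeff_toL2 (w : C(Torus, ℂ)) (k : ℤ) :
    fourierCoeff (toL2 w : Torus → ℂ) k = fourierCoeff w k := by
  exact congrFun (fourierCoeff_congr_ae (ContinuousMap.coeFn_toLp (E := ℂ) (p := 2) (𝕜 := ℂ) haarT w)) k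

theorem fourierCoeff_schrodingerFlow (t : ℝ) (f : L2Torus) (k : ℤ) :
    fourierCoeff (schrodingerFlow t f : Torus → ℂ) k = freeMul t k * fourierCoeff (f : Torus → ℂ) k := by
  rw [← fourierBasis_repr, ← fourierBasis_repr, schrodingerFlow, LinearIsometryEquiv.apply_symm_apply]
  rfl

theorem phaseFlow_eq {τ : ℝ} (hτ : 0 < τ) (w : C(Torus, ℂ)) (x : Torus) :
    phaseFlow τ w x = w x + τ * phaseIncr τ (w x) := by
  have : (τ : ℂ) ≠ 0 := by exact_mod_cast hτ.ne'
  simp only [phaseFlow, ContinuousMap.coe_mk, phaseIncr, Complex.mul_conj, Complex.normSq_eq_norm_sq]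
  field_simp
  ring

theorem norm_phaseFlow (τ : ℝ) (w : C(Torus, ℂ)) (x : Torus) : ‖phaseFlow τ w x‖ = ‖w x‖ := by
  simp only [phaseFlow, ContinuousMap.coe_mk]
  rw [norm_mul, show -Complex.I * (τ : ℂ) * ((‖w x‖ ^ 2 : ℝ) : ℂ) =
    ((-(τ * ‖w x‖ ^ 2) : ℝ) : ℂ) * Complex.I by push_cast; ring, Complex.norm_exp_ofReal_mul_I, one_mul]

/-- The frequencies of the scheme with step size `τ`. -/
def stepFreqs (τ : ℝ) : Finset ℤ := freqs (τ ^ (-(1 / 2) : ℝ))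

theorem mul_sq_le_of_mem_stepFreqs {τ : ℝ} (hτ : 0 < τ) {k : ℤ} (hk : k ∈ stepFreqs τ) :
    τ * (k : ℝ) ^ 2 ≤ 1 := by
  have h := mem_freqs.mp hk
  have h2 : (k : ℝ) ^ 2 ≤ (τ ^ (-(1 / 2) : ℝ)) ^ 2 := by
    rw [← sq_abs]
    gcongr
  have h3 : (τ ^ (-(1 / 2) : ℝ)) ^ 2 = τ⁻¹ := by
    rw [← Real.rpow_natCast, ← Real.rpow_mul hτ.le]
    norm_num
    rw [Real.rpow_neg_one]
  rw [h3] at h2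
  calc τ * (k : ℝ) ^ 2 ≤ τ * τ⁻¹ := by gcongr
    _ = 1 := mul_inv_cancel₀ hτ.ne'

/-- The coefficients of the scheme in the interaction picture. -/
def lieCoeff (τ : ℝ) (u₀ : L2Torus) (n : ℕ) (k : ℤ) : ℂ :=
  conj (freeMul (n * τ) k) * fourierCoeff (filteredLie τ u₀ n : Torus → ℂ) k

theorem freeMul_mul_conj (t : ℝ) (k : ℤ) : freeMul t k * conj (freeMul t k) = 1 := by
  rw [Complex.mul_conj, Complex.normSq_eq_norm_sq, norm_freeMul]
  norm_num

theorem freeMul_mul_lieCoeff (τ : ℝ) (u₀ : L2Torus) (n : ℕ) (k : ℤ) :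
    freeMul (n * τ) k * lieCoeff τ u₀ n k = fourierCoeff (filteredLie τ u₀ n : Torus → ℂ) k := by
  rw [lieCoeff, ← mul_assoc, freeMul_mul_conj, one_mul]

theorem stepFilter_filteredLie (τ : ℝ) (u₀ : L2Torus) (n : ℕ) (x : Torus) :
    stepFilter τ (filteredLie τ u₀ n) x = profile (stepFreqs τ) τ (lieCoeff τ u₀) n x := by
  simp only [stepFilter, freqFilter_eq_trig, profile, freeMul_mul_lieCoeff]
  rfl

theorem fourierCoeff_stepFilter (τ : ℝ) (f : Torus → ℂ) (k : ℤ) :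
    fourierCoeff (stepFilter τ f) k = if k ∈ stepFreqs τ then fourierCoeff f k else 0 := by
  have : ⇑(stepFilter τ f) = trig (stepFreqs τ) (fourierCoeff f) := by
    ext x
    exact freqFilter_eq_trig _ _ _
  rw [this, fourierCoeff_trig]

theorem lieCoeff_zero (τ : ℝ) (u₀ : L2Torus) (k : ℤ) :
    lieCoeff τ u₀ 0 k = if k ∈ stepFreqs τ then fourierCoeff (u₀ : Torus → ℂ) k else 0 := by
  rw [lieCoeff, filteredLie, fourierCoeff_toL2, fourierCoeff_stepFilter]
  simp [freeMul]

theorem lieCoeff_succ (τ : ℝ) (u₀ : L2Torus) (n : ℕ) (k : ℤ) :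
    lieCoeff τ u₀ (n + 1) k = conj (freeMul (n * τ) k) * if k ∈ stepFreqs τ then
      fourierCoeff (phaseFlow τ (stepFilter τ (filteredLie τ u₀ n))) k else 0 := by
  rw [lieCoeff, filteredLie, fourierCoeff_schrodingerFlow, fourierCoeff_toL2,
    fourierCoeff_stepFilter, ← mul_assoc]
  congr 1
  have h : freeMul ((n + 1 : ℕ) * τ) k = freeMul (n * τ) k * freeMul τ k := by
    rw [← freeMul_add]
    congr 1
    push_cast
    ring
  rw [h, map_mul, mul_assoc, mul_comm (conj (freeMul τ k)), freeMul_mul_conj, mul_one]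

theorem lieCoeff_eq_zero {τ : ℝ} (u₀ : L2Torus) (n : ℕ) {k : ℤ} (hk : k ∉ stepFreqs τ) :
    lieCoeff τ u₀ n k = 0 := by
  cases n with
  | zero => rw [lieCoeff_zero, if_neg hk]
  | succ n => rw [lieCoeff_succ, if_neg hk, mul_zero]

theorem norm_eq_lpNorm (f : L2Torus) : ‖f‖ = lpNorm f 2 haarT := by
  rw [← toReal_eLpNorm (Lp.memLp f).1, Lp.norm_def]

/-- The phase flow is $w+\tau\,$`phaseIncr`$\,w$, and removing the free phases turns one step of the
scheme into one step of the recursion. -/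
theorem duhamelSeq_lieCoeff {τ : ℝ} (hτ : 0 < τ) (u₀ : L2Torus) :
    DuhamelSeq (stepFreqs τ) τ (lieCoeff τ u₀) fun n x =>
      phaseIncr τ (profile (stepFreqs τ) τ (lieCoeff τ u₀) n x) := by
  intro n k hk
  set w := stepFilter τ (filteredLie τ u₀ n) with hw
  have hg : Continuous fun x => phaseIncr τ (w x) := continuous_phaseIncr w.continuous
  have e1 : (fun x => phaseIncr τ (profile (stepFreqs τ) τ (lieCoeff τ u₀) n x)) =
      fun x => phaseIncr τ (w x) := by
    ext x
    rw [hw, stepFilter_filteredLie]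
  have e2 : ⇑(phaseFlow τ w) = ⇑w + fun x => (τ : ℂ) * phaseIncr τ (w x) := by
    ext x
    rw [phaseFlow_eq hτ]
    rfl
  have e3 := fourierCoeff.add (f := w) (g := fun x => (τ : ℂ) * phaseIncr τ (w x))
    (integrable_of_continuous w.continuous) (integrable_of_continuous (continuous_const.mul hg))
  beta_reduce
  rw [lieCoeff_succ, if_pos hk, ← hw, e2, e1, e3, Pi.add_apply, fourierCoeff.const_mul,
    mul_add, hw, fourierCoeff_stepFilter, if_pos hk, ← lieCoeff]
  ring

theorem l2_freeMul_mul (A : Finset ℤ) (t : ℝ) (c : ℤ → ℂ) :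
    l2 A (fun k => freeMul t k * c k) = l2 A c :=
  le_antisymm (l2_mono fun k _ => by simp [norm_freeMul]) (l2_mono fun k _ => by simp [norm_freeMul])

/-- The phase flow preserves $|w|$ pointwise, the free flow preserves the moduli of the
coefficients, and the filter only discards frequencies. -/
theorem l2_lieCoeff_le (τ : ℝ) (u₀ : L2Torus) (n : ℕ) : l2 (stepFreqs τ) (lieCoeff τ u₀ n) ≤ ‖u₀‖ := by
  induction n with
  | zero =>
    rw [norm_eq_lpNorm]
    refine le_trans ?_ (l2_fourierCoeff_le (Lp.memLp u₀) (stepFreqs τ))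
    exact l2_mono fun k hk => by rw [lieCoeff_zero, if_pos hk]
  | succ n ih =>
    refine le_trans ?_ ih
    set w := stepFilter τ (filteredLie τ u₀ n) with hw
    have h1 : l2 (stepFreqs τ) (lieCoeff τ u₀ (n + 1)) ≤ l2 (stepFreqs τ) (fourierCoeff (phaseFlow τ w)) := by
      refine l2_mono fun k hk => ?_
      rw [lieCoeff_succ, if_pos hk]
      simp [norm_freeMul, hw]
    refine h1.trans ((l2_fourierCoeff_le (memLp_of_continuous (phaseFlow τ w).continuous 2) _).trans ?_)
    refine (lpNorm_two_le_mul w.continuous zero_le_one fun x => by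
      rw [norm_phaseFlow, one_mul]).trans ?_
    have : ⇑w = profile (stepFreqs τ) τ (lieCoeff τ u₀) n := by
      ext x
      rw [hw, stepFilter_filteredLie]
    rw [one_mul, this, profile, lpNorm_trig, l2_freeMul_mul]

theorem trajectory_lieCoeff {τ : ℝ} (hτ : 0 < τ) (hτ1 : τ ≤ 1) (u₀ : L2Torus) :
    Trajectory (stepFreqs τ) τ ‖u₀‖ (lieCoeff τ u₀) :=
  ⟨hτ, hτ1, fun _ hk => mul_sq_le_of_mem_stepFreqs hτ hk, l2_lieCoeff_le τ u₀, duhamelSeq_lieCoeff hτ u₀⟩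

/-! ### Sobolev regularity of the initial value -/

theorem sum_weight_le_sobolevNorm_sq {s : ℝ} {f : L2Torus} (hf : MemSobolev s f) (A : Finset ℤ) :
    ∑ k ∈ A, (1 + (k : ℝ) ^ 2) ^ s * ‖fourierCoeff (f : Torus → ℂ) k‖ ^ 2 ≤ sobolevNorm s f ^ 2 := by
  rw [sobolevNorm, Real.sq_sqrt (tsum_nonneg fun k => by positivity)]
  exact hf.sum_le_tsum A fun k _ => by positivity

/-- Bernstein's inequality: as $\tau k^2\le1$ on the filtered range, derivatives in excess of the
available regularity become negative powers of $\tau$. -/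
theorem rpow_mul_sq_le {τ r p : ℝ} (hτ : 0 < τ) (hr : 0 ≤ r) (hrp : r ≤ p) {k : ℤ}
    (hk : τ * (k : ℝ) ^ 2 ≤ 1) : (τ * (k : ℝ) ^ 2) ^ p ≤ τ ^ r * (1 + (k : ℝ) ^ 2) ^ r := by
  rw [← Real.mul_rpow hτ.le (by positivity)]
  refine (Real.rpow_le_rpow_of_exponent_ge' (by positivity) hk hr hrp).trans ?_
  refine Real.rpow_le_rpow (by positivity) ?_ hr
  nlinarith

/-- Data in $H^s$, once filtered, satisfy $\|\partial^2u^0\|\lesssim\tau^{s/2-1}$ and $\|\partial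
u^0\|^2\lesssim\tau^{s/2-1}$. Here $s\le2$ is needed for the excess of derivatives to be
nonnegative, and this is the source of the rate. -/
theorem mul_energy_zero_le {τ s : ℝ} (hτ : 0 < τ) (hs : 0 ≤ s) (hs2 : s ≤ 2) {u₀ : L2Torus}
    (hu₀ : MemSobolev s u₀) :
    τ * energy (stepFreqs τ) (lieCoeff τ u₀) 0 ≤
      (sobolevNorm s u₀ + sobolevNorm s u₀ ^ 2) * τ ^ (s / 2) := by
  set S := sobolevNorm s u₀ with hS
  have hS0 : 0 ≤ S := Real.sqrt_nonneg _
  have hsum := sum_weight_le_sobolevNorm_sq hu₀ (stepFreqs τ)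
  have hcoef : ∀ k ∈ stepFreqs τ, lieCoeff τ u₀ 0 k = fourierCoeff (u₀ : Torus → ℂ) k := fun k hk => by
    rw [lieCoeff_zero, if_pos hk]
  have hτs : τ ^ s = (τ ^ (s / 2)) ^ 2 := by
    rw [← Real.rpow_natCast, ← Real.rpow_mul hτ.le]
    norm_num
  have h1 : τ * l2 (stepFreqs τ) (derivSeq (derivSeq (lieCoeff τ u₀)) 0) ≤ S * τ ^ (s / 2) := by
    refine le_of_pow_le_pow_left₀ (n := 2) (by norm_num) (by positivity) ?_
    rw [mul_pow, l2_sq, Finset.mul_sum, mul_pow, ← hτs, mul_comm (S ^ 2)]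
    refine le_trans ?_ (mul_le_mul_of_nonneg_left hsum (by positivity))
    rw [Finset.mul_sum]
    refine Finset.sum_le_sum fun k hk => ?_
    have h2 := rpow_mul_sq_le hτ hs hs2 (mul_sq_le_of_mem_stepFreqs hτ hk)
    rw [Real.rpow_two] at h2
    have e : τ ^ 2 * ‖derivSeq (derivSeq (lieCoeff τ u₀)) 0 k‖ ^ 2 =
        (τ * (k : ℝ) ^ 2) ^ 2 * ‖fourierCoeff (u₀ : Torus → ℂ) k‖ ^ 2 := by
      simp only [derivSeq, norm_mul, Complex.norm_I, one_mul, Complex.norm_intCast, hcoef k hk, mul_pow,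
        sq_abs]
      ring
    rw [e, ← mul_assoc]
    gcongr
  have h2 : τ * l2 (stepFreqs τ) (derivSeq (lieCoeff τ u₀) 0) ^ 2 ≤ S ^ 2 * τ ^ (s / 2) := by
    rw [l2_sq, Finset.mul_sum, mul_comm (S ^ 2)]
    refine le_trans ?_ (mul_le_mul_of_nonneg_left hsum (by positivity))
    rw [Finset.mul_sum]
    refine Finset.sum_le_sum fun k hk => ?_
    have h2 := rpow_mul_sq_le hτ (r := s / 2) (p := 1) (by linarith) (by linarith)
      (mul_sq_le_of_mem_stepFreqs hτ hk)
    have h3 : (1 + (k : ℝ) ^ 2) ^ (s / 2) ≤ (1 + (k : ℝ) ^ 2) ^ s :=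
      Real.rpow_le_rpow_of_exponent_le (by nlinarith) (by linarith)
    rw [Real.rpow_one] at h2
    have e : τ * ‖derivSeq (lieCoeff τ u₀) 0 k‖ ^ 2 =
        (τ * (k : ℝ) ^ 2) * ‖fourierCoeff (u₀ : Torus → ℂ) k‖ ^ 2 := by
      simp only [derivSeq, norm_mul, Complex.norm_I, one_mul, Complex.norm_intCast, hcoef k hk, mul_pow,
        sq_abs]
      ring
    rw [e, ← mul_assoc]
    refine mul_le_mul_of_nonneg_right (h2.trans ?_) (by positivity)
    gcongr
  rw [energy, mul_add, add_mul]
  exact add_le_add h1 h2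

/-- The energy is multiplied by at most a constant on each block, and the number of blocks is
bounded independently of $\tau$. -/
theorem exists_mul_energy_le {s T : ℝ} (hs : 0 ≤ s) (hs2 : s ≤ 2) {u₀ : L2Torus}
    (hu₀ : MemSobolev s u₀) : ∃ C ≥ (0 : ℝ), ∃ τ₀ > (0 : ℝ), ∀ τ, 0 < τ → τ ≤ τ₀ → ∀ n : ℕ, n * τ ≤ T →
      τ * energy (stepFreqs τ) (lieCoeff τ u₀) n ≤ C * τ ^ (s / 2) := by
  obtain ⟨δ, hδ⟩ := exists_smallBlock ‖u₀‖
  set M := ‖u₀‖ with hM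
  have hM0 : 0 ≤ M := norm_nonneg _
  set Λ := 1 + 9 * (54 * (18 * M) ^ 2 + 1000 * (6 + 48 * M ^ 2) * (18 * M)) +
      (1 + 486 * (18 * M) ^ 2) ^ 2 with hΛ
  have hΛ0 : 0 ≤ Λ := by positivity
  have hS0 : 0 ≤ sobolevNorm s u₀ := Real.sqrt_nonneg _
  refine ⟨(Λ + 1) ^ ⌈2 * T / δ⌉₊ * (sobolevNorm s u₀ + sobolevNorm s u₀ ^ 2), by positivity, δ / 2,
    by linarith [hδ.1], fun τ hτ hτδ n hn => ?_⟩
  have htraj := trajectory_lieCoeff hτ (by linarith [hδ.2.1]) u₀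
  have h := le_of_block_bound hΛ0 hδ.1 hτ hτδ (z := energy (stepFreqs τ) (lieCoeff τ u₀)) (T := T)
    le_rfl (energy_nonneg _ _ _) (fun m n hmn hle _ => by
      rw [add_zero]
      exact htraj.energy_le hδ hmn hle) hn
  rw [add_zero] at h
  have h0 := mul_energy_zero_le hτ hs hs2 hu₀
  calc _ ≤ τ * ((Λ + 1) ^ ⌈2 * T / δ⌉₊ * energy (stepFreqs τ) (lieCoeff τ u₀) 0) := by gcongr
    _ = (Λ + 1) ^ ⌈2 * T / δ⌉₊ * (τ * energy (stepFreqs τ) (lieCoeff τ u₀) 0) := by ring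
    _ ≤ (Λ + 1) ^ ⌈2 * T / δ⌉₊ * ((sobolevNorm s u₀ + sobolevNorm s u₀ ^ 2) * τ ^ (s / 2)) := by gcongr
    _ = _ := by ring

/-! ### Pointwise bounds -/

section

variable {A : Finset ℤ} {τ M : ℝ} {b : ℕ → ℤ → ℂ} (h : Trajectory A τ M b) {s K : ℝ}
  (hs : 0 ≤ s) (hs2 : s ≤ 2) (hK : 0 ≤ K) {n : ℕ} (hE : τ * energy A b n ≤ K * τ ^ (s / 2))
include h hs hs2 hK hE

omit hs hs2 hK in
-- The number $y=\tau^{s/4-1/2}$ is the scale of the first derivative. It is then used as the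
-- parameter of Agmon's inequality, where $y\ge1$ requires $s\le2$.
theorem Trajectory.sq_l2_derivSeq_le :
    l2 A (derivSeq b n) ^ 2 ≤ K * (τ ^ (s / 4 - 1 / 2)) ^ 2 := by
  have hτ := h.pos
  have h1 : τ * l2 A (derivSeq b n) ^ 2 ≤ K * τ ^ (s / 2) := by
    refine le_trans ?_ hE
    gcongr
    exact le_add_of_nonneg_left (l2_nonneg _ _)
  have e : τ * (τ ^ (s / 4 - 1 / 2)) ^ 2 = τ ^ (s / 2) := by
    nth_rw 1 [← Real.rpow_one τ]
    rw [← Real.rpow_natCast, ← Real.rpow_mul hτ.le, ← Real.rpow_add hτ]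
    congr 1
    push_cast
    ring
  rw [← e] at h1
  refine le_of_mul_le_mul_left (h1.trans (le_of_eq ?_)) hτ
  ring

omit hs hK hE in
theorem Trajectory.one_le_rpow : 1 ≤ τ ^ (s / 4 - 1 / 2) :=
  Real.one_le_rpow_of_pos_of_le_one_of_nonpos h.pos h.le_one (by linarith)

omit hs hK in
theorem Trajectory.sq_sum_norm_le :
    (∑ k ∈ A, ‖b n k‖) ^ 2 ≤ 6 * (M ^ 2 + K) * τ ^ (s / 4 - 1 / 2) := by
  have h1 := h.one_le_rpow hs2
  have h2 := h.sq_l2_derivSeq_le hE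
  refine (h.sum_norm_sq_le n h1).trans ?_
  have h3 : l2 A (derivSeq b n) ^ 2 / (τ ^ (s / 4 - 1 / 2)) ^ 2 ≤ K := by
    rw [div_le_iff₀ (by positivity)]
    exact h2
  calc _ ≤ 6 * τ ^ (s / 4 - 1 / 2) * (M ^ 2 + K) := by gcongr
    _ = _ := by ring

/-- Agmon gives $\tau y=\tau^{s/4+1/2}$, which is at most $\tau^{s/2}$ because $s\le2$. This is the
smallness of $\tau|w|^2$ that makes the quintic remainder of the splitting admissible. -/
theorem Trajectory.mul_sq_norm_profile_le (x : Torus) :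
    τ * ‖profile A τ b n x‖ ^ 2 ≤ 6 * (M ^ 2 + K) * τ ^ (s / 2) := by
  have hτ := h.pos
  have h1 := h.sq_sum_norm_le hs2 hE
  have h2 : ‖profile A τ b n x‖ ^ 2 ≤ (∑ k ∈ A, ‖b n k‖) ^ 2 := by
    gcongr
    exact norm_profile_le A τ b n x
  have e : τ * τ ^ (s / 4 - 1 / 2) ≤ τ ^ (s / 2) := by
    rw [← Real.rpow_one_add' hτ.le (by linarith)]
    exact Real.rpow_le_rpow_of_exponent_ge hτ h.le_one (by linarith)
  calc _ ≤ τ * (6 * (M ^ 2 + K) * τ ^ (s / 4 - 1 / 2)) := by gcongr; exact h2.trans h1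
    _ = 6 * (M ^ 2 + K) * (τ * τ ^ (s / 4 - 1 / 2)) := by ring
    _ ≤ _ := by gcongr

omit hs in
-- Controls how far the forcing of one cell can move the solution in the sup norm. With
-- $B=\sum_k|b_n(k)|$ one has $|g|\le B^2|w|$ and $|g'|\le3B^2|w'|$; Agmon's inequality is then
-- applied to $g$ itself.
theorem Trajectory.mul_sum_fourierCoeff_incr_le :
    τ * ∑ k ∈ A, ‖fourierCoeff (fun x => phaseIncr τ (profile A τ b n x)) k‖ ≤
      54 * (M ^ 2 + K) ^ 2 * τ ^ (s / 2) + 54 * (M ^ 2 + K) * τ ^ (s / 2) := by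
  have hτ := h.pos
  set y := τ ^ (s / 4 - 1 / 2) with hy
  have hy1 : 1 ≤ y := h.one_le_rpow hs2
  have hy0 : 0 < y := by linarith
  set B := ∑ k ∈ A, ‖b n k‖ with hB
  have hB0 : 0 ≤ B := Finset.sum_nonneg fun _ _ => norm_nonneg _
  have hBsq : B ^ 2 ≤ 6 * (M ^ 2 + K) * y := h.sq_sum_norm_le hs2 hE
  have hD := h.sq_l2_derivSeq_le hE
  have hw := norm_profile_le A τ b n
  set g : Torus → ℂ := fun x => phaseIncr τ (profile A τ b n x) with hg
  set g' : Torus → ℂ := fun x => phaseIncrDeriv τ (profile A τ b n x) (profile A τ (derivSeq b) n x)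
  have hgc : Continuous g := h.bddSeq_incr.1 n
  have hgc' : Continuous g' := h.bddSeq_incrDeriv.1 n
  have e0 : l2 A (fourierCoeff g) ≤ B ^ 2 * M := by
    refine (l2_fourierCoeff_le (memLp_of_continuous hgc 2) A).trans ?_
    refine (lpNorm_two_le_mul (continuous_profile A τ b n) (by positivity : 0 ≤ B ^ 2) fun x => ?_).trans ?_
    · refine (norm_phaseIncr_le hτ _).trans ?_
      rw [pow_succ]
      gcongr
      exact hw x
    · rw [profile, lpNorm_trig, l2_freeMul_mul]
      gcongr
      exact h.mass n
  have e1 : l2 A (fun k => k * fourierCoeff g k) ≤ 3 * B ^ 2 * l2 A (derivSeq b n) := by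
    have : l2 A (fun k => k * fourierCoeff g k) ≤ l2 A (fourierCoeff g') :=
      l2_mono fun k _ => by rw [(h.torusDeriv_incr n).fourierCoeff hgc']; simp [g]
    refine this.trans ((l2_fourierCoeff_le (memLp_of_continuous hgc' 2) A).trans ?_)
    refine (lpNorm_two_le_mul (continuous_profile A τ (derivSeq b) n)
      (by positivity : 0 ≤ 3 * B ^ 2) fun x => ?_).trans ?_
    · refine (norm_phaseIncrDeriv_le hτ _ _).trans ?_
      have := hw x
      calc 3 * (‖profile A τ b n x‖ * ‖profile A τ b n x‖ * ‖profile A τ (derivSeq b) n x‖)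
          ≤ 3 * (B * B * ‖profile A τ (derivSeq b) n x‖) := by gcongr
        _ = _ := by ring
    · rw [profile, lpNorm_trig, l2_freeMul_mul]
  have hl0 := l2_nonneg A (fourierCoeff g)
  have hl1 := l2_nonneg A (fun k => k * fourierCoeff g k)
  have hl2 := l2_nonneg A (derivSeq b n)
  set Q := M ^ 2 + K with hQ
  have hQ0 : 0 ≤ Q := by positivity
  have hM0 := h.nonneg
  have hS : (∑ k ∈ A, ‖fourierCoeff g k‖) ^ 2 ≤ 54 * y * (6 * Q * y) ^ 2 * Q := by
    refine (FilteredNLS.sum_norm_sq_le hy1 A (fourierCoeff g)).trans ?_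
    have f0 : l2 A (fourierCoeff g) ^ 2 ≤ (6 * Q * y) ^ 2 * M ^ 2 := by
      calc l2 A (fourierCoeff g) ^ 2 ≤ (6 * Q * y * M) ^ 2 := by
            gcongr
            exact e0.trans (by gcongr)
        _ = _ := by ring
    have f1 : l2 A (fun k => k * fourierCoeff g k) ^ 2 / y ^ 2 ≤ 9 * (6 * Q * y) ^ 2 * K := by
      rw [div_le_iff₀ (by positivity)]
      calc l2 A (fun k => k * fourierCoeff g k) ^ 2 ≤ (3 * (6 * Q * y) * l2 A (derivSeq b n)) ^ 2 := by
            gcongr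
            exact e1.trans (by gcongr)
        _ = 9 * (6 * Q * y) ^ 2 * l2 A (derivSeq b n) ^ 2 := by ring
        _ ≤ 9 * (6 * Q * y) ^ 2 * (K * y ^ 2) := by gcongr
        _ = _ := by ring
    calc _ ≤ 6 * y * ((6 * Q * y) ^ 2 * M ^ 2 + 9 * (6 * Q * y) ^ 2 * K) := by gcongr
      _ ≤ 6 * y * (9 * (6 * Q * y) ^ 2 * M ^ 2 + 9 * (6 * Q * y) ^ 2 * K) := by
        gcongr
        have : 0 ≤ (6 * Q * y) ^ 2 := by positivity
        linarith
      _ = _ := by rw [hQ]; ring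
  -- The exponent $2+3(s/4-1/2)=1/2+3s/4$ is at least $s$ exactly when $s\le2$.
  have hyτ : τ ^ 2 * y ^ 3 ≤ (τ ^ (s / 2)) ^ 2 := by
    have a1 : τ ^ 2 = τ ^ (2 : ℝ) := (Real.rpow_two τ).symm
    rw [a1, hy, ← Real.rpow_natCast (τ ^ (s / 4 - 1 / 2)), ← Real.rpow_natCast (τ ^ (s / 2)),
      ← Real.rpow_mul hτ.le, ← Real.rpow_mul hτ.le, ← Real.rpow_add hτ]
    refine Real.rpow_le_rpow_of_exponent_ge hτ h.le_one ?_
    push_cast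
    linarith
  refine le_of_pow_le_pow_left₀ (n := 2) (by norm_num) (by positivity) ?_
  calc _ = τ ^ 2 * (∑ k ∈ A, ‖fourierCoeff g k‖) ^ 2 := by rw [mul_pow]
    _ ≤ τ ^ 2 * (54 * y * (6 * Q * y) ^ 2 * Q) := by gcongr
    _ = 1944 * Q ^ 3 * (τ ^ 2 * y ^ 3) := by ring
    _ ≤ 1944 * Q ^ 3 * (τ ^ (s / 2)) ^ 2 := by gcongr
    _ ≤ (54 ^ 2 * (Q ^ 2 + Q) ^ 2) * (τ ^ (s / 2)) ^ 2 := by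
      gcongr
      · norm_num
      · have h3 : 0 ≤ Q ^ 3 := by positivity
        have e : (Q ^ 2 + Q) ^ 2 = Q ^ 4 + 2 * Q ^ 3 + Q ^ 2 := by ring
        have h4 : 0 ≤ Q ^ 4 + Q ^ 2 := by positivity
        linarith
    _ = _ := by ring

end

/-! ### The cubic nonlinearity -/

/-- The forcing `-i |v|² v` of the cubic Schrödinger equation. -/
def nl (v : ℝ × Torus → ℂ) (p : ℝ × Torus) : ℂ := -Complex.I * (((‖v p‖ ^ 2 : ℝ) : ℂ) * v p)

theorem nl_eq (v : ℝ × Torus → ℂ) (p : ℝ × Torus) : nl v p = -Complex.I * (v p * conj (v p) * v p) := by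
  rw [nl, Complex.mul_conj, Complex.normSq_eq_norm_sq]

theorem memLp_nl {v : ℝ × Torus → ℂ} {μ : Measure (ℝ × Torus)} (hv : MemLp v 4 μ) :
    MemLp (nl v) (4 / 3) μ := by
  have h := (memLp_mul_mul hv hv.star hv).const_mul (-Complex.I)
  have e : nl v = fun p => -Complex.I * (v p * star v p * v p) := by
    ext p
    exact nl_eq v p
  rwa [e]

theorem norm_nl (v : ℝ × Torus → ℂ) (p : ℝ × Torus) : ‖nl v p‖ = ‖v p‖ * ‖v p‖ * ‖v p‖ := by
  rw [nl_eq]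
  simp

theorem norm_cubic_sub_le (a b : ℂ) :
    ‖((‖a‖ ^ 2 : ℝ) : ℂ) * a - ((‖b‖ ^ 2 : ℝ) : ℂ) * b‖ ≤
      2 * (‖a‖ * ‖a‖ * ‖a - b‖) + 2 * (‖b‖ * ‖b‖ * ‖a - b‖) := by
  have e : ((‖a‖ ^ 2 : ℝ) : ℂ) * a - ((‖b‖ ^ 2 : ℝ) : ℂ) * b =
      ((‖a‖ ^ 2 : ℝ) : ℂ) * (a - b) + ((‖a‖ ^ 2 - ‖b‖ ^ 2 : ℝ) : ℂ) * b := by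
    push_cast
    ring
  have h1 : |‖a‖ ^ 2 - ‖b‖ ^ 2| ≤ (‖a‖ + ‖b‖) * ‖a - b‖ := by
    rw [sq_sub_sq, abs_mul, abs_of_nonneg (by positivity)]
    gcongr
    exact abs_norm_sub_norm_le a b
  rw [e]
  refine (norm_add_le _ _).trans ?_
  rw [norm_mul, norm_mul, Complex.norm_real, Complex.norm_real, Real.norm_eq_abs, Real.norm_eq_abs,
    abs_of_nonneg (by positivity)]
  have h2 : ‖a‖ * ‖b‖ ≤ (‖a‖ ^ 2 + ‖b‖ ^ 2) / 2 := by nlinarith [sq_nonneg (‖a‖ - ‖b‖)]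
  have h3 := norm_nonneg (a - b)
  calc ‖a‖ ^ 2 * ‖a - b‖ + |‖a‖ ^ 2 - ‖b‖ ^ 2| * ‖b‖
      ≤ ‖a‖ ^ 2 * ‖a - b‖ + (‖a‖ + ‖b‖) * ‖a - b‖ * ‖b‖ := by gcongr
    _ = (‖a‖ ^ 2 + ‖b‖ ^ 2) * ‖a - b‖ + (‖a‖ * ‖b‖) * ‖a - b‖ := by ring
    _ ≤ (‖a‖ ^ 2 + ‖b‖ ^ 2) * ‖a - b‖ + ((‖a‖ ^ 2 + ‖b‖ ^ 2) / 2) * ‖a - b‖ := by gcongr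
    _ ≤ _ := by
      have : 0 ≤ (‖a‖ ^ 2 + ‖b‖ ^ 2) * ‖a - b‖ := by positivity
      linarith

theorem lpNorm_le_of_norm_le_cubic_sub {v w H : ℝ × Torus → ℂ} {μ : Measure (ℝ × Torus)}
    (hv : MemLp v 4 μ) (hw : MemLp w 4 μ)
    (hle : ∀ᵐ p ∂μ, ‖H p‖ ≤ 2 * (‖v p‖ * ‖v p‖ * ‖v p - w p‖) + 2 * (‖w p‖ * ‖w p‖ * ‖v p - w p‖)) :
    lpNorm H (4 / 3) μ ≤
      2 * (lpNorm v 4 μ ^ 2 + lpNorm w 4 μ ^ 2) * lpNorm (fun p => v p - w p) 4 μ := by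
  have hd : MemLp (fun p => v p - w p) 4 μ := hv.sub hw
  have h1 := (memLp_mul_mul hv hv hd).const_mul 2
  have h2 := (memLp_mul_mul hw hw hd).const_mul 2
  have h := lpNorm_le_of_norm_le_add one_le_fourThirds h1 h2 (H := H) (by
    filter_upwards [hle] with p hp
    simpa only [norm_mul, Complex.norm_ofNat] using hp)
  have h3 := lpNorm_le_of_norm_le_trilinear (C := 2) (by norm_num) hv hv hd
    (H := fun p => 2 * (v p * v p * (v p - w p)))
    (Eventually.of_forall fun p => by simp only [norm_mul, Complex.norm_ofNat, le_refl])
  have h4 := lpNorm_le_of_norm_le_trilinear (C := 2) (by norm_num) hw hw hd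
    (H := fun p => 2 * (w p * w p * (v p - w p)))
    (Eventually.of_forall fun p => by simp only [norm_mul, Complex.norm_ofNat, le_refl])
  nlinarith

theorem norm_nl_sub_le (v w : ℝ × Torus → ℂ) (p : ℝ × Torus) :
    ‖nl v p - nl w p‖ ≤ 2 * (‖v p‖ * ‖v p‖ * ‖v p - w p‖) + 2 * (‖w p‖ * ‖w p‖ * ‖v p - w p‖) := by
  rw [nl, nl, ← mul_sub, norm_mul, norm_neg, Complex.norm_I, one_mul]
  exact norm_cubic_sub_le _ _

theorem fourierCoeff_finset_sum {ι : Type*} (S : Finset ι) (a : ι → ℂ) (m : ι → ℤ) (k : ℤ) :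
    fourierCoeff (fun x => ∑ i ∈ S, a i * expi (m i) x) k = ∑ i ∈ S, if k = m i then a i else 0 := by
  have h2 := fourierCoeff.sum S (fun j (x : Torus) => a j * expi (m j) x) fun j _ =>
    integrable_of_continuous (continuous_const.mul (continuous_expi (m j)))
  have e : (fun x => ∑ i ∈ S, a i * expi (m i) x) = ∑ i ∈ S, fun x => a i * expi (m i) x := by
    ext x
    simp
  rw [e, h2, Finset.sum_apply]
  simp_rw [fourierCoeff.const_mul, fourierCoeff_expi]
  simp

/-- The cube of a trigonometric polynomial of degree `L` has degree `3 L`. -/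
theorem fourierCoeff_cubic_trig {L : ℝ} (d : ℤ → ℂ) {k : ℤ} (hk : k ∉ freqs (3 * L)) :
    fourierCoeff (fun x => -Complex.I * (trig (freqs L) d x * conj (trig (freqs L) d x) *
      trig (freqs L) d x)) k = 0 := by
  have e : (fun x => -Complex.I * (trig (freqs L) d x * conj (trig (freqs L) d x) *
      trig (freqs L) d x)) = fun x => ∑ q ∈ (freqs L ×ˢ freqs L) ×ˢ freqs L,
        (-Complex.I * (d q.1.1 * conj (d q.1.2) * d q.2)) * expi (q.1.1 - q.1.2 + q.2) x := by
    ext x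
    rw [Finset.sum_product, Finset.sum_product]
    simp only [trig, map_sum, Finset.mul_sum, Finset.sum_mul]
    refine Finset.sum_congr rfl fun i _ => Finset.sum_congr rfl fun j _ =>
      Finset.sum_congr rfl fun l _ => ?_
    rw [map_mul, conj_expi, sub_eq_add_neg, expi_add, expi_add]
    ring
  rw [e, fourierCoeff_finset_sum]
  refine Finset.sum_eq_zero fun q hq => if_neg ?_
  rintro rfl
  simp only [Finset.mem_product] at hq
  obtain ⟨⟨h1, h2⟩, h3⟩ := hq
  refine hk (mem_freqs.mpr ?_)
  rw [mem_freqs, abs_le] at h1 h2 h3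
  push_cast
  rw [abs_le]
  constructor <;> linarith [h1.1, h1.2, h2.1, h2.2, h3.1, h3.2]

/-- High frequencies of a sequence with bounded Sobolev norm. -/
theorem l2_le_of_forall_notMem_freqs {s S : ℝ} (hs : 0 ≤ s) (hS : 0 ≤ S) {d : ℤ → ℂ}
    (hd : ∀ A : Finset ℤ, ∑ k ∈ A, (1 + (k : ℝ) ^ 2) ^ s * ‖d k‖ ^ 2 ≤ S ^ 2) {A : Finset ℤ} {K : ℝ}
    (hK : 0 < K) (hA : ∀ k ∈ A, k ∉ freqs K) : l2 A d ≤ S * K ^ (-s) := by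
  refine le_of_pow_le_pow_left₀ (n := 2) (by norm_num) (by positivity) ?_
  rw [l2_sq, mul_pow]
  refine le_trans ?_ (mul_le_mul_of_nonneg_right (hd A) (sq_nonneg (K ^ (-s))))
  rw [Finset.sum_mul]
  refine Finset.sum_le_sum fun k hk => ?_
  have h1 : K < |(k : ℝ)| := not_le.mp fun h2 => hA k hk (mem_freqs.mpr h2)
  have h2 : K ^ 2 ≤ 1 + (k : ℝ) ^ 2 := by
    rw [← sq_abs (k : ℝ)]
    nlinarith
  have h3 : (K ^ (-s)) ^ 2 = ((K ^ 2) ^ s)⁻¹ := by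
    rw [Real.rpow_neg hK.le, inv_pow, ← Real.rpow_natCast (K ^ s), ← Real.rpow_mul hK.le, mul_comm,
      Real.rpow_mul hK.le, Real.rpow_natCast]
  have h4 : (K ^ 2) ^ s ≤ (1 + (k : ℝ) ^ 2) ^ s := Real.rpow_le_rpow (by positivity) h2 hs
  have h5 : 0 < (K ^ 2) ^ s := by positivity
  rw [h3, ← div_eq_mul_inv, le_div_iff₀ h5]
  have : 0 ≤ ‖d k‖ ^ 2 := by positivity
  nlinarith

/-! ### Solutions of the cubic Schrödinger equation on the Fourier side -/

/-- The space-time function `∑_{k ∈ A} e^{-itk²} c(t, k) exp(ikx)`. -/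
def evo (A : Finset ℤ) (c : ℝ → ℤ → ℂ) (p : ℝ × Torus) : ℂ :=
  ∑ k ∈ A, freeMul p.1 k * c p.1 k * expi k p.2

/-- A solution on `[0, T]`, bounded by `S` in `H^s`, with Fourier coefficients `c` in the
interaction picture and values `v`. -/
structure Solution (s T S : ℝ) (c : ℝ → ℤ → ℂ) (v : ℝ × Torus → ℂ) (N : ℕ → ℝ) : Prop where
  nonneg : 0 ≤ s
  le_two : s ≤ 2
  bound_nonneg : 0 ≤ S
  memLp : MemLp v 4 (slab 0 T)
  sobolev : ∀ t ∈ Set.Icc 0 T, ∀ A : Finset ℤ, ∑ k ∈ A, (1 + (k : ℝ) ^ 2) ^ s * ‖c t k‖ ^ 2 ≤ S ^ 2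
  duhamel : ∀ a t, 0 ≤ a → a ≤ t → t ≤ T → ∀ k,
    c t k = c a k + ∫ r in a..t, conj (freeMul r k) * coef (nl v) r k
  tendsto : Tendsto N atTop atTop
  limit : ∀ᵐ p ∂slab 0 T, Tendsto (fun j => evo (freqs (N j)) c p) atTop (𝓝 (v p))

theorem retarded_congr {A : Finset ℤ} {ω₁ ω₂ ω₃ : ℝ → ℤ → ℂ} {ρ : ℝ → ℝ} {a b : ℝ}
    {F F' : ℝ × Torus → ℂ}
    (h : ∀ k ∈ A, ∀ᵐ r ∂volume.restrict (Set.Ioc a b),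
      conj (ω₂ r k) * coef F r k = conj (ω₃ r k) * coef F' r k)
    {p : ℝ × Torus} (hp : ρ p.1 ∈ Set.Icc a b) :
    retarded A ω₁ ω₂ ρ a F p = retarded A ω₁ ω₃ ρ a F' p := by
  refine Finset.sum_congr rfl fun k hk => ?_
  congr 2
  rw [intervalIntegral.integral_of_le hp.1, intervalIntegral.integral_of_le hp.1]
  exact integral_congr_ae (ae_restrict_of_ae_restrict_of_subset
    (Set.Ioc_subset_Ioc_right hp.2) (h k hk))

theorem ae_integrable_slice {F : ℝ × Torus → ℂ} {a b : ℝ} (hF : Integrable F (slab a b)) :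
    ∀ᵐ r ∂volume.restrict (Set.Ioc a b), Integrable (fun x => F (r, x)) haarT := hF.prod_right_ae

theorem ae_coef_sub {F G : ℝ × Torus → ℂ} {a b : ℝ} (hF : Integrable F (slab a b))
    (hG : Integrable G (slab a b)) : ∀ᵐ r ∂volume.restrict (Set.Ioc a b), ∀ k,
      coef (fun p => F p - G p) r k = coef F r k - coef G r k := by
  filter_upwards [ae_integrable_slice hF, ae_integrable_slice hG] with r h1 h2 k
  have hb : ∀ f : Torus → ℂ, Integrable f haarT → Integrable (fun x => expi (-k) x * f x) haarT :=
    fun f hf => hf.bdd_mul (c := 1) (continuous_expi (-k)).aestronglyMeasurable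
      (Eventually.of_forall fun _ => (norm_expi _ _).le)
  rw [coef, coef, coef, fourierCoeff_eq_integral, fourierCoeff_eq_integral, fourierCoeff_eq_integral,
    ← integral_sub (hb _ h1) (hb _ h2)]
  simp only [mul_sub]

/-! ### Strichartz bounds and frequency tails of the exact solution -/

section

variable {s T S : ℝ} {c : ℝ → ℤ → ℂ} {v : ℝ × Torus → ℂ} {N : ℕ → ℝ} (h : Solution s T S c v N)
include h

theorem Solution.l2_le {t : ℝ} (ht : t ∈ Set.Icc 0 T) (A : Finset ℤ) : l2 A (c t) ≤ S := by
  refine le_of_pow_le_pow_left₀ (n := 2) (by norm_num) h.bound_nonneg ?_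
  rw [l2_sq]
  refine le_trans (Finset.sum_le_sum fun k _ => ?_) (h.sobolev t ht A)
  have : 1 ≤ (1 + (k : ℝ) ^ 2) ^ s := Real.one_le_rpow (by nlinarith) h.nonneg
  have : 0 ≤ ‖c t k‖ ^ 2 := by positivity
  nlinarith

theorem Solution.l2_tail_le {t : ℝ} (ht : t ∈ Set.Icc 0 T) {A : Finset ℤ} {K : ℝ} (hK : 0 < K)
    (hA : ∀ k ∈ A, k ∉ freqs K) : l2 A (c t) ≤ S * K ^ (-s) :=
  l2_le_of_forall_notMem_freqs h.nonneg h.bound_nonneg (h.sobolev t ht) hK hA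

variable {a b : ℝ} (ha : 0 ≤ a) (hab : a ≤ b) (hb : b ≤ T)
include ha hb

theorem Solution.memLp_slab : MemLp v 4 (slab a b) := h.memLp.mono_measure (slab_mono ha hb)

theorem Solution.memLp_nl_slab : MemLp (nl v) (4 / 3) (slab a b) :=
  FilteredNLS.memLp_nl (h.memLp_slab ha hb)

theorem Solution.evo_eq (A : Finset ℤ) {p : ℝ × Torus} (hp : p.1 ∈ Set.Ioc a b) :
    evo A c p = (mode A freeMul (c a) + retarded A freeMul freeMul id a (nl v)) p := by
  rw [Pi.add_apply, evo, mode, retarded, ← Finset.sum_add_distrib]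
  refine Finset.sum_congr rfl fun k _ => ?_
  rw [h.duhamel a p.1 ha hp.1.le (hp.2.trans hb) k]
  simp only [id]
  ring

theorem Solution.memLp_evo (A : Finset ℤ) : MemLp (evo A c) 4 (slab a b) := by
  have h1 := (memLp_mode isMultiplier_freeMul A (c a) 4 a b).add (memLp_retarded (A := A)
    isMultiplier_freeMul isMultiplier_freeMul measurable_id (a := a) (b := b)
    (fun t ht => ⟨ht.1.le, ht.2⟩) ((h.memLp_nl_slab ha hb).integrable one_le_fourThirds)).1
  refine (memLp_congr_ae ?_).mpr h1
  filter_upwards [ae_slab_mem a b] with p hp using h.evo_eq ha hb A hp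

include hab in
-- Only the coefficients of the forcing on $A$ matter, so the cubic term may be replaced by any $F$
-- agreeing with it there. The tail estimate exploits this freedom. The constant is
-- $54=6\cdot3\cdot3$.
theorem Solution.lpNorm_evo_le (hab' : b - a ≤ 1) (A : Finset ℤ) {F : ℝ × Torus → ℂ}
    (hF : MemLp F (4 / 3) (slab a b))
    (hcoef : ∀ᵐ r ∂volume.restrict (Set.Ioc a b), ∀ k ∈ A, coef (nl v) r k = coef F r k) :
    lpNorm (evo A c) 4 (slab a b) ≤
      3 * l2 A (c a) + 54 * (b - a) ^ (1 / 4 : ℝ) * lpNorm F (4 / 3) (slab a b) := by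
  have heq : evo A c =ᵐ[slab a b] mode A freeMul (c a) + retarded A freeMul freeMul id a F := by
    filter_upwards [ae_slab_mem a b] with p hp
    rw [h.evo_eq ha hb A hp, Pi.add_apply, Pi.add_apply]
    congr 1
    refine retarded_congr (b := b) (fun k hk => ?_) ⟨hp.1.le, hp.2⟩
    filter_upwards [hcoef] with r hr
    rw [hr k hk]
  rw [lpNorm_congr heq]
  refine (lpNorm_add_le (memLp_mode isMultiplier_freeMul A _ 4 _ _) (by norm_num)).trans ?_
  have h0 : 0 ≤ b - a := by linarith
  have h1 := strichartz_freeMul A a b hab hab' (c a)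
  have h2 := retBound_id isMultiplier_freeMul isMultiplier_freeMul (by norm_num) (by norm_num)
    (strichartz_freeMul A) (strichartz_freeMul A) hab hab' F hF
  have h3 : (b - a) ^ (1 / 8 : ℝ) ≤ 1 := Real.rpow_le_one h0 hab' (by norm_num)
  have h4 := l2_nonneg A (c a)
  have h5 : 0 ≤ (b - a) ^ (1 / 8 : ℝ) := by positivity
  refine add_le_add (h1.trans ?_) (h2.trans (le_of_eq (by ring)))
  nlinarith

include hab in
-- Uniform in $A$: the bound comes from Duhamel's formula and Strichartz, so the $L^4$ boundedness
-- of frequency projections is not used.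
theorem Solution.lpNorm_evo_le_const (hab' : b - a ≤ 1) (A : Finset ℤ) :
    lpNorm (evo A c) 4 (slab a b) ≤ 3 * S + 54 * lpNorm v 4 (slab 0 T) ^ 3 := by
  have hv := h.memLp_slab ha hb
  have h1 := h.lpNorm_evo_le ha hab hb hab' A (h.memLp_nl_slab ha hb)
    (Eventually.of_forall fun _ _ _ => rfl)
  have h2 := lpNorm_le_of_norm_le_trilinear (H := nl v) zero_le_one hv hv hv
    (Eventually.of_forall fun p => by rw [norm_nl, one_mul])
  have h3 := lpNorm_mono_measure' h.memLp (slab_mono ha hb)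
  have h4 := h.l2_le ⟨ha, hab.trans hb⟩ A
  have h5 : (b - a) ^ (1 / 4 : ℝ) ≤ 1 := Real.rpow_le_one (by linarith) hab' (by norm_num)
  have h6 : lpNorm (nl v) (4 / 3) (slab a b) ≤ lpNorm v 4 (slab 0 T) ^ 3 := by
    refine h2.trans ?_
    have h0 : 0 ≤ lpNorm v 4 (slab a b) := lpNorm_nonneg
    calc 1 * (lpNorm v 4 (slab a b) * lpNorm v 4 (slab a b) * lpNorm v 4 (slab a b))
        = lpNorm v 4 (slab a b) ^ 3 := by ring
      _ ≤ _ := by gcongr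
  refine h1.trans (add_le_add (by linarith) ?_)
  have h7 : 0 ≤ lpNorm (nl v) (4 / 3) (slab a b) := lpNorm_nonneg
  calc _ ≤ 54 * 1 * lpNorm v 4 (slab 0 T) ^ 3 := by gcongr
    _ = _ := by ring

include hab in
-- Let $w$ be the part of the solution below $K/3$. Its cube has no frequency above $K$, so the high
-- modes are driven only by $|v|^2v-|w|^2w$, which is linear in the tail $v-w$ at the lower scale
-- $K/3$.
theorem Solution.lpNorm_tail_le_succ (hab' : b - a ≤ 1) {K : ℝ} (hK : 0 < K) :
    lpNorm (fun p => v p - evo (freqs K) c p) 4 (slab a b) ≤ 3 * (S * K ^ (-s)) +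
      54 * (b - a) ^ (1 / 4 : ℝ) * (2 * (lpNorm v 4 (slab 0 T) ^ 2 +
        (3 * S + 54 * lpNorm v 4 (slab 0 T) ^ 3) ^ 2) *
          lpNorm (fun p => v p - evo (freqs (K / 3)) c p) 4 (slab a b)) := by
  have hS := h.bound_nonneg
  have hv := h.memLp_slab ha hb
  set w := evo (freqs (K / 3)) c with hw
  have hwm : MemLp w 4 (slab a b) := h.memLp_evo ha hb _
  set F : ℝ × Torus → ℂ := fun p => nl v p - nl w p with hF
  have hFm : MemLp F (4 / 3) (slab a b) := (h.memLp_nl_slab ha hb).sub (FilteredNLS.memLp_nl hwm)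
  have hFle : lpNorm F (4 / 3) (slab a b) ≤ 2 * (lpNorm v 4 (slab 0 T) ^ 2 +
        (3 * S + 54 * lpNorm v 4 (slab 0 T) ^ 3) ^ 2) * lpNorm (fun p => v p - w p) 4 (slab a b) := by
    refine (lpNorm_le_of_norm_le_cubic_sub hv hwm
      (Eventually.of_forall fun p => norm_nl_sub_le v w p)).trans ?_
    have h1 := lpNorm_mono_measure' h.memLp (slab_mono ha hb)
    have h2 := h.lpNorm_evo_le_const ha hab hb hab' (freqs (K / 3))
    have h3 : 0 ≤ lpNorm (fun p => v p - w p) 4 (slab a b) := lpNorm_nonneg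
    have h4 : 0 ≤ lpNorm w 4 (slab a b) := lpNorm_nonneg
    have h5 : 0 ≤ lpNorm v 4 (slab a b) := lpNorm_nonneg
    gcongr
  have hcoef : ∀ᵐ r ∂volume.restrict (Set.Ioc a b), ∀ k, k ∉ freqs K →
      coef (nl v) r k = coef F r k := by
    filter_upwards [ae_coef_sub ((h.memLp_nl_slab ha hb).integrable one_le_fourThirds)
      ((FilteredNLS.memLp_nl hwm).integrable one_le_fourThirds)] with r hr k hk
    have h0 : coef (nl w) r k = 0 := by
      have := fourierCoeff_cubic_trig (L := K / 3) (fun k => freeMul r k * c r k) (k := k)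
        (by rwa [mul_div_cancel₀ K (by norm_num : (3 : ℝ) ≠ 0)])
      rw [← this, coef]
      congr 1
      ext x
      rw [nl_eq]
      rfl
    rw [hr, h0, sub_zero]
  -- The tail is the almost everywhere limit of the finite sums over $K<|k|\le N_j$, to which the
  -- Strichartz bound applies.
  refine (lpNorm_le_of_tendsto (f := fun j => evo (freqs (N j) \ freqs K) c) ?_
    (fun j => h.memLp_evo ha hb _) (fun j => ?_) ?_).2
  · have : 0 ≤ b - a := by linarith
    have : 0 ≤ lpNorm (fun p => v p - w p) 4 (slab a b) := lpNorm_nonneg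
    positivity
  · have hdisj : ∀ k ∈ freqs (N j) \ freqs K, k ∉ freqs K := fun k hk => (Finset.mem_sdiff.mp hk).2
    refine (h.lpNorm_evo_le ha hab hb hab' _ hFm ?_).trans (add_le_add ?_ ?_)
    · filter_upwards [hcoef] with r hr k hk using hr k (hdisj k hk)
    · exact mul_le_mul_of_nonneg_left (h.l2_tail_le ⟨ha, hab.trans hb⟩ hK hdisj) (by norm_num)
    · have : 0 ≤ b - a := by linarith
      gcongr
  · have hl := ae_mono (slab_mono ha hb) h.limit
    filter_upwards [hl] with p hp
    refine (hp.sub_const (evo (freqs K) c p)).congr' ?_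
    filter_upwards [h.tendsto.eventually_ge_atTop K] with j hj
    have hsub : freqs K ⊆ freqs (N j) := fun k hk => mem_freqs.mpr ((mem_freqs.mp hk).trans hj)
    rw [evo, evo, evo, ← Finset.sum_sdiff hsub, add_sub_cancel_right]

end

/-- The high frequencies of a solution on short blocks. -/
theorem Solution.lpNorm_tail_le {s T S : ℝ} {c : ℝ → ℤ → ℂ} {v : ℝ × Torus → ℂ} {N : ℕ → ℝ}
    (h : Solution s T S c v N) {a b : ℝ} (ha : 0 ≤ a) (hab : a ≤ b) (hb : b ≤ T) (hab' : b - a ≤ 1)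
    (hsmall : (b - a) ^ (1 / 4 : ℝ) * (1944 * (lpNorm v 4 (slab 0 T) ^ 2 +
        (3 * S + 54 * lpNorm v 4 (slab 0 T) ^ 3) ^ 2)) ≤ 1) {K : ℝ} (hK : 0 < K) :
    lpNorm (fun p => v p - evo (freqs K) c p) 4 (slab a b) ≤
      (6 * S + 9 * (lpNorm v 4 (slab 0 T) + (3 * S + 54 * lpNorm v 4 (slab 0 T) ^ 3))) * K ^ (-s) := by
  have hS := h.bound_nonneg
  have hs := h.nonneg
  set R := lpNorm v 4 (slab 0 T) with hR
  have hR0 : 0 ≤ R := lpNorm_nonneg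
  set R' := 3 * S + 54 * R ^ 3 with hR'
  have hR'0 : 0 ≤ R' := by positivity
  have h39 : (3 : ℝ) ^ s ≤ 9 := by
    calc (3 : ℝ) ^ s ≤ 3 ^ (2 : ℝ) := Real.rpow_le_rpow_of_exponent_le (by norm_num) h.le_two
      _ = 9 := by norm_num
  -- Induction over triadic scales. For $K\le3$ the crude bound is enough, because
  -- $K^{-s}\ge3^{-s}\ge1/9$.
  have key : ∀ j : ℕ, ∀ K : ℝ, 0 < K → K ≤ 3 ^ (j + 1) →
      lpNorm (fun p => v p - evo (freqs K) c p) 4 (slab a b) ≤ (6 * S + 9 * (R + R')) * K ^ (-s) := by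
    intro j
    induction j with
    | zero =>
      intro K hK hK3
      rw [zero_add, pow_one] at hK3
      have h1 : lpNorm (fun p => v p - evo (freqs K) c p) 4 (slab a b) ≤ R + R' := by
        refine (lpNorm_sub_le (h.memLp_slab ha hb) (g := evo (freqs K) c) (by norm_num)).trans ?_
        exact add_le_add (lpNorm_mono_measure' h.memLp (slab_mono ha hb))
          (h.lpNorm_evo_le_const ha hab hb hab' _)
      have h2 : 1 / 9 ≤ K ^ (-s) := by
        rw [Real.rpow_neg hK.le, ← one_div]
        refine one_div_le_one_div_of_le (by positivity) (le_trans ?_ h39)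
        exact Real.rpow_le_rpow hK.le hK3 hs
      nlinarith
    | succ j ih =>
      intro K hK hK3
      have h1 := ih (K / 3) (by positivity) (by rw [div_le_iff₀ (by norm_num)]; rw [pow_succ] at hK3; exact hK3)
      have h2 := h.lpNorm_tail_le_succ ha hab hb hab' hK
      have h3 : (K / 3) ^ (-s) ≤ 9 * K ^ (-s) := by
        rw [Real.div_rpow hK.le (by norm_num), Real.rpow_neg (by norm_num : (0 : ℝ) ≤ 3), div_inv_eq_mul,
          mul_comm]
        gcongr
      set D := 6 * S + 9 * (R + R') with hD
      have hD0 : 0 ≤ D := by positivity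
      have hKs : 0 ≤ K ^ (-s) := by positivity
      have hba : 0 ≤ (b - a) ^ (1 / 4 : ℝ) := by
        have : 0 ≤ b - a := by linarith
        positivity
      calc _ ≤ 3 * (S * K ^ (-s)) + 54 * (b - a) ^ (1 / 4 : ℝ) * (2 * (R ^ 2 + R' ^ 2) *
            (D * (9 * K ^ (-s)))) := by
            refine h2.trans ?_
            gcongr
            exact h1.trans (by gcongr)
        -- Passing from $K/3$ to $K$ costs at most $9$; since $54\cdot2\cdot9=1944/2$, the smallness
        -- hypothesis makes the recursion contract by $1/2$.
        _ = 3 * (S * K ^ (-s)) + ((b - a) ^ (1 / 4 : ℝ) * (1944 * (R ^ 2 + R' ^ 2))) *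
            (D * K ^ (-s) / 2) := by ring
        _ ≤ 3 * (S * K ^ (-s)) + 1 * (D * K ^ (-s) / 2) := by gcongr
        _ ≤ D * K ^ (-s) := by
          have : 6 * S ≤ D := by rw [hD]; linarith [mul_nonneg (by norm_num : (0 : ℝ) ≤ 9) (add_nonneg hR0 hR'0)]
          nlinarith
  obtain ⟨j, hj⟩ := pow_unbounded_of_one_lt K (by norm_num : (1 : ℝ) < 3)
  refine key j K hK (hj.le.trans ?_)
  exact pow_le_pow_right₀ (by norm_num) (Nat.le_succ j)

/-! ### Sobolev spaces -/

theorem fourierCoeff_coe_sub (f g : L2Torus) (k : ℤ) :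
    fourierCoeff ((f - g : L2Torus) : Torus → ℂ) k =
      fourierCoeff (f : Torus → ℂ) k - fourierCoeff (g : Torus → ℂ) k := by
  simp only [← fourierBasis_repr, map_sub]
  rfl

theorem sq_norm_le_two_mul_add (a b : ℂ) : ‖a‖ ^ 2 ≤ 2 * ‖a - b‖ ^ 2 + 2 * ‖b‖ ^ 2 := by
  have h : ‖a‖ ≤ ‖a - b‖ + ‖b‖ := by simpa using norm_add_le (a - b) b
  have : ‖a‖ ^ 2 ≤ (‖a - b‖ + ‖b‖) ^ 2 := by gcongr
  nlinarith [sq_nonneg (‖a - b‖ - ‖b‖)]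

theorem MemSobolev.sub {s : ℝ} {f g : L2Torus} (hf : MemSobolev s f) (hg : MemSobolev s g) :
    MemSobolev s (f - g) := by
  refine Summable.of_nonneg_of_le (fun k => by positivity) (fun k => ?_)
    ((hf.mul_left 2).add (hg.mul_left 2))
  rw [fourierCoeff_coe_sub]
  have h := sq_norm_le_two_mul_add
    (fourierCoeff (f : Torus → ℂ) k - fourierCoeff (g : Torus → ℂ) k) (-fourierCoeff (g : Torus → ℂ) k)
  rw [sub_neg_eq_add, sub_add_cancel, norm_neg] at h
  have : 0 ≤ (1 + (k : ℝ) ^ 2) ^ s := by positivity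
  nlinarith

theorem sobolevNorm_nonneg (s : ℝ) (f : L2Torus) : 0 ≤ sobolevNorm s f := Real.sqrt_nonneg _

theorem sobolevNorm_sq (s : ℝ) (f : L2Torus) : sobolevNorm s f ^ 2 =
    ∑' k : ℤ, (1 + (k : ℝ) ^ 2) ^ s * ‖fourierCoeff (f : Torus → ℂ) k‖ ^ 2 :=
  Real.sq_sqrt (tsum_nonneg fun k => by positivity)

theorem sobolevNorm_sq_le {s : ℝ} {f g : L2Torus} (hf : MemSobolev s f) (hg : MemSobolev s g) :
    sobolevNorm s f ^ 2 ≤ 2 * sobolevNorm s (f - g) ^ 2 + 2 * sobolevNorm s g ^ 2 := by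
  have hd := hf.sub hg
  rw [sobolevNorm_sq, sobolevNorm_sq, sobolevNorm_sq, ← tsum_mul_left, ← tsum_mul_left,
    ← Summable.tsum_add (hd.mul_left 2) (hg.mul_left 2)]
  refine Summable.tsum_le_tsum (fun k => ?_) hf ((hd.mul_left 2).add (hg.mul_left 2))
  have h := sq_norm_le_two_mul_add (fourierCoeff (f : Torus → ℂ) k) (fourierCoeff (g : Torus → ℂ) k)
  rw [← fourierCoeff_coe_sub] at h
  have : 0 ≤ (1 + (k : ℝ) ^ 2) ^ s := by positivity
  nlinarith

theorem norm_fourierCoeff_le_sobolevNorm {s : ℝ} (hs : 0 ≤ s) {f : L2Torus} (hf : MemSobolev s f)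
    (k : ℤ) : ‖fourierCoeff (f : Torus → ℂ) k‖ ≤ sobolevNorm s f := by
  refine le_of_pow_le_pow_left₀ (n := 2) (by norm_num) (sobolevNorm_nonneg _ _) ?_
  have h := sum_weight_le_sobolevNorm_sq hf {k}
  rw [Finset.sum_singleton] at h
  refine le_trans ?_ h
  have : 1 ≤ (1 + (k : ℝ) ^ 2) ^ s := Real.one_le_rpow (by nlinarith) hs
  have : 0 ≤ ‖fourierCoeff (f : Torus → ℂ) k‖ ^ 2 := by positivity
  nlinarith

theorem ContinuousIntoSobolev.exists_bound {s T : ℝ} {u : ℝ → L2Torus}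
    (hu : ContinuousIntoSobolev s T u) : ∃ S ≥ 0, ∀ t ∈ Set.Icc 0 T, sobolevNorm s (u t) ≤ S := by
  have h : ∃ S, ∀ t ∈ Set.Icc 0 T, sobolevNorm s (u t) ≤ S := by
    refine isCompact_Icc.induction_on (p := fun B => ∃ S, ∀ t ∈ B, sobolevNorm s (u t) ≤ S)
      ⟨0, by simp⟩ ?_ ?_ ?_
    · rintro A B hAB ⟨S, hS⟩
      exact ⟨S, fun t ht => hS t (hAB ht)⟩
    · rintro A B ⟨S, hS⟩ ⟨S', hS'⟩
      refine ⟨max S S', fun t ht => ?_⟩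
      rcases ht with ht | ht
      · exact (hS t ht).trans (le_max_left _ _)
      · exact (hS' t ht).trans (le_max_right _ _)
    · intro t₀ ht₀
      have h1 : ∀ᶠ t in 𝓝[Set.Icc 0 T] t₀, sobolevNorm s (u t - u t₀) < 1 :=
        (hu.2 t₀ ht₀).eventually_lt_const zero_lt_one
      refine ⟨_, h1.and self_mem_nhdsWithin, 2 + 2 * sobolevNorm s (u t₀), fun t ht => ?_⟩
      obtain ⟨h2, h3⟩ := ht
      have h4 := sobolevNorm_sq_le (hu.1 t h3) (hu.1 t₀ ht₀)
      have h5 := sobolevNorm_nonneg s (u t₀)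
      have h6 := sobolevNorm_nonneg s (u t - u t₀)
      refine le_of_pow_le_pow_left₀ (n := 2) (by norm_num) (by positivity) ?_
      nlinarith
  obtain ⟨S, hS⟩ := h
  exact ⟨max S 0, le_max_right _ _, fun t ht => (hS t ht).trans (le_max_left _ _)⟩

theorem ContinuousIntoSobolev.continuousOn_fourierCoeff {s T : ℝ} (hs : 0 ≤ s) {u : ℝ → L2Torus}
    (hu : ContinuousIntoSobolev s T u) (k : ℤ) :
    ContinuousOn (fun t => fourierCoeff (u t : Torus → ℂ) k) (Set.Icc 0 T) := by
  intro t₀ ht₀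
  rw [ContinuousWithinAt, tendsto_iff_norm_sub_tendsto_zero]
  refine squeeze_zero' (Eventually.of_forall fun _ => norm_nonneg _) ?_ (hu.2 t₀ ht₀)
  filter_upwards [self_mem_nhdsWithin] with t ht
  rw [← fourierCoeff_coe_sub]
  exact norm_fourierCoeff_le_sobolevNorm hs ((hu.1 t ht).sub (hu.1 t₀ ht₀)) k

/-! ### Convergence of Fourier series -/

theorem lpNorm_sub_trig_le {s S : ℝ} (hs : 0 ≤ s) (hS : 0 ≤ S) {f : L2Torus}
    (hf : ∀ A : Finset ℤ, ∑ k ∈ A, (1 + (k : ℝ) ^ 2) ^ s * ‖fourierCoeff (f : Torus → ℂ) k‖ ^ 2 ≤ S ^ 2)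
    {K : ℝ} (hK : 0 < K) :
    lpNorm (fun x => f x - trig (freqs K) (fourierCoeff (f : Torus → ℂ)) x) 2 haarT ≤ S * K ^ (-s) := by
  set c := fourierCoeff (f : Torus → ℂ) with hc
  have ht := continuous_trig (freqs K) c
  have hm : MemLp (fun x => f x - trig (freqs K) c x) 2 haarT :=
    (Lp.memLp f).sub (memLp_of_continuous ht 2)
  have hcoef : ∀ k, fourierCoeff (fun x => f x - trig (freqs K) c x) k =
      if k ∈ freqs K then 0 else c k := by
    intro k
    have h1 : (fun x => f x - trig (freqs K) c x) = (f : Torus → ℂ) + fun x => (-1) * trig (freqs K) c x := by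
      ext x
      simp [sub_eq_add_neg]
    rw [h1, fourierCoeff.add ((Lp.memLp f).integrable (by norm_num))
      ((integrable_of_continuous ht).const_mul (-1)), Pi.add_apply, fourierCoeff.const_mul,
      fourierCoeff_trig]
    split_ifs <;> simp [hc]
  have hsum := hasSum_sq_norm_fourierCoeff hm
  refine le_of_pow_le_pow_left₀ (n := 2) (by norm_num) (by positivity) ?_
  refine hasSum_le_of_sum_le hsum fun B => ?_
  have h1 := l2_le_of_forall_notMem_freqs hs hS hf hK (A := B \ freqs K)
    fun k hk => (Finset.mem_sdiff.mp hk).2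
  have h2 : ∑ k ∈ B, ‖fourierCoeff (fun x => f x - trig (freqs K) c x) k‖ ^ 2 = l2 (B \ freqs K) c ^ 2 := by
    rw [l2_sq, Finset.sdiff_eq_filter, Finset.sum_filter]
    refine Finset.sum_congr rfl fun k _ => ?_
    rw [hcoef]
    by_cases hk : k ∈ freqs K <;> simp [hk]
  rw [h2]
  have := l2_nonneg (B \ freqs K) c
  gcongr

/-- A geometric rate makes the sequence summably Cauchy, so it converges almost everywhere without
extraction; a subsequence obtained from convergence in measure identifies the limit. -/
theorem ae_tendsto_of_lpNorm_sub_le {f : Torus → ℂ} {g : ℕ → Torus → ℂ} (hf : MemLp f 2 haarT)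
    (hg : ∀ n, MemLp (g n) 2 haarT) {S : ℝ} (hS : 0 ≤ S)
    (h : ∀ n, lpNorm (fun x => f x - g n x) 2 haarT ≤ S * (1 / 2) ^ n) :
    ∀ᵐ x ∂haarT, Tendsto (fun n => g n x) atTop (𝓝 (f x)) := by
  have he : ∀ n, eLpNorm (g n - f) 2 haarT ≤ ENNReal.ofReal (S * (1 / 2) ^ n) := by
    intro n
    have h1 : MemLp (fun x => f x - g n x) 2 haarT := hf.sub (hg n)
    rw [eLpNorm_sub_comm, ← ENNReal.ofReal_toReal (hf.sub (hg n)).2.ne]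
    refine ENNReal.ofReal_le_ofReal ((le_of_eq ?_).trans (h n))
    exact toReal_eLpNorm h1.1
  have hsum : Summable fun n : ℕ => (2 * S + 1) * (1 / 2 : ℝ) ^ n :=
    (summable_geometric_of_lt_one (by norm_num) (by norm_num)).mul_left _
  have h1 : ∀ᵐ x ∂haarT, ∃ l, Tendsto (fun n => g n x) atTop (𝓝 l) := by
    refine Lp.ae_tendsto_of_cauchy_eLpNorm (p := 2) (fun n => (hg n).1) (by norm_num)
      hsum.tsum_ofReal_ne_top fun N n m hn hm => ?_
    have e : g n - g m = (g n - f) - (g m - f) := by abel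
    rw [e]
    refine (eLpNorm_sub_le ((hg n).sub hf).1 ((hg m).sub hf).1 (by norm_num)).trans_lt ?_
    refine (add_le_add (he n) (he m)).trans_lt ?_
    rw [← ENNReal.ofReal_add (by positivity) (by positivity)]
    refine (ENNReal.ofReal_lt_ofReal_iff (by positivity)).mpr ?_
    have hp : ∀ j, N ≤ j → (1 / 2 : ℝ) ^ j ≤ (1 / 2) ^ N := fun j hj =>
      pow_le_pow_of_le_one (by norm_num) (by norm_num) hj
    have h2 := mul_le_mul_of_nonneg_left (hp n hn) hS
    have h3 := mul_le_mul_of_nonneg_left (hp m hm) hS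
    have h4 : (0 : ℝ) < (1 / 2) ^ N := by positivity
    linarith
  have h2 : Tendsto (fun n => eLpNorm (g n - f) 2 haarT) atTop (𝓝 0) := by
    have h3 : Tendsto (fun n : ℕ => ENNReal.ofReal (S * (1 / 2) ^ n)) atTop (𝓝 0) := by
      have h4 := (tendsto_pow_atTop_nhds_zero_of_lt_one (r := (1 / 2 : ℝ)) (by norm_num)
        (by norm_num)).const_mul S
      rw [mul_zero] at h4
      simpa using ENNReal.tendsto_ofReal h4
    exact tendsto_of_tendsto_of_tendsto_of_le_of_le tendsto_const_nhds h3 (fun _ => zero_le) he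
  obtain ⟨ns, hns, h3⟩ := (tendstoInMeasure_of_tendsto_eLpNorm (by norm_num) (fun n => (hg n).1) hf.1
    h2).exists_seq_tendsto_ae
  filter_upwards [h1, h3] with x hx hx'
  obtain ⟨l, hl⟩ := hx
  rwa [tendsto_nhds_unique hx' (hl.comp hns.tendsto_atTop)]

/-! ### From a solution in Sobolev space to a space-time function -/

theorem conj_freeMul (t : ℝ) (k : ℤ) : conj (freeMul t k) = freeMul (-t) k := by
  rw [freeMul, freeMul, ← Complex.exp_conj]
  simp

theorem conj_mul_freeMul (t : ℝ) (k : ℤ) : conj (freeMul t k) * freeMul t k = 1 := by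
  rw [mul_comm, freeMul_mul_conj]

/-- A curve of classes $u(t)$ need not come with a jointly measurable representative. Its Fourier
coefficients are continuous in time, so the partial sums are measurable in $(t,x)$; $v$ is their
almost everywhere limit and agrees with $u(t)$ for almost every $t$. -/
theorem IsNLSSolution.exists_solution {s T : ℝ} (hs : 0 < s) (hs2 : s ≤ 2) (hT : 0 < T) {u₀ : L2Torus}
    {u : ℝ → L2Torus} (hu : IsNLSSolution s T u₀ u) : ∃ S v N,
      Solution s T S (fun t k => conj (freeMul t k) * fourierCoeff (u t : Torus → ℂ) k) v N := by
  obtain ⟨S, hS, hbound⟩ := hu.continuous_sobolev.exists_bound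
  have hsob : ∀ t ∈ Set.Icc 0 T, ∀ A : Finset ℤ,
      ∑ k ∈ A, (1 + (k : ℝ) ^ 2) ^ s * ‖fourierCoeff (u t : Torus → ℂ) k‖ ^ 2 ≤ S ^ 2 := by
    intro t ht A
    refine (sum_weight_le_sobolevNorm_sq (hu.continuous_sobolev.1 t ht) A).trans ?_
    have := hbound t ht
    have := sobolevNorm_nonneg s (u t)
    gcongr
  -- Cutoffs $2^{j/s}$ make the $L^2$ tails at most $S2^{-j}$ at every time; this is where $s>0$ is
  -- indispensable.
  set N : ℕ → ℝ := fun j => ((2 : ℝ) ^ j) ^ (1 / s) with hN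
  have hN0 : ∀ j, 0 < N j := fun j => by positivity
  have hNs : ∀ j, N j ^ (-s) = (1 / 2) ^ j := by
    intro j
    rw [hN]
    simp only
    rw [← Real.rpow_mul (by positivity), show 1 / s * -s = -1 by field_simp, Real.rpow_neg_one,
      one_div, inv_pow]
  have hNtop : Tendsto N atTop atTop :=
    (tendsto_rpow_atTop (by positivity)).comp (tendsto_pow_atTop_atTop_of_one_lt (by norm_num))
  -- the partial Fourier sums as measurable space-time functions
  set d : ℝ → ℤ → ℂ := fun t k => (Set.Icc 0 T).indicator (fun t => fourierCoeff (u t : Torus → ℂ) k) t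
    with hd
  have hdm : ∀ k, Measurable fun t => d t k := by
    intro k
    classical
    have h1 := (hu.continuous_sobolev.continuousOn_fourierCoeff hs.le k).measurable_piecewise
      (g := fun _ => (0 : ℂ)) continuousOn_const measurableSet_Icc
    convert! h1 using 1
    ext t
    simp [hd, Set.indicator, Set.piecewise]
  set P : ℕ → ℝ × Torus → ℂ := fun j p => ∑ k ∈ freqs (N j), d p.1 k * expi k p.2 with hP
  have hPm : ∀ j, Measurable (P j) := fun j => Finset.measurable_sum _ fun k _ =>
    ((hdm k).comp measurable_fst).mul ((continuous_expi k).measurable.comp measurable_snd)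
  have hslice : ∀ t ∈ Set.Icc 0 T, ∀ᵐ x ∂haarT,
      Tendsto (fun j => P j (t, x)) atTop (𝓝 ((u t : Torus → ℂ) x)) := by
    intro t ht
    have hPt : ∀ j x, P j (t, x) = trig (freqs (N j)) (fourierCoeff (u t : Torus → ℂ)) x := by
      intro j x
      simp only [hP, hd, trig, Set.indicator_of_mem ht]
    simp only [hPt]
    refine ae_tendsto_of_lpNorm_sub_le (Lp.memLp (u t)) (fun j => memLp_of_continuous
      (continuous_trig _ _) 2) hS fun j => ?_
    rw [← hNs]
    exact lpNorm_sub_trig_le hs.le hS (hsob t ht) (hN0 j)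
  have hex : ∀ᵐ p ∂slab 0 T, ∃ l, Tendsto (fun j => P j p) atTop (𝓝 l) := by
    refine (Measure.ae_prod_iff_ae_ae (measurableSet_exists_tendsto hPm)).mpr ?_
    filter_upwards [ae_restrict_mem measurableSet_Ioc] with t ht
    filter_upwards [hslice t ⟨ht.1.le, ht.2⟩] with x hx using ⟨_, hx⟩
  obtain ⟨v, hv, hlim⟩ := exists_stronglyMeasurable_limit_of_tendsto_ae
    (fun j => (hPm j).aestronglyMeasurable) hex
  have hvu : ∀ᵐ t ∂volume.restrict (Set.Ioc 0 T), ∀ᵐ x ∂haarT, v (t, x) = (u t : Torus → ℂ) x := by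
    filter_upwards [Measure.ae_ae_of_ae_prod hlim, ae_restrict_mem measurableSet_Ioc] with t h1 ht
    filter_upwards [h1, hslice t ⟨ht.1.le, ht.2⟩] with x h2 h3 using tendsto_nhds_unique h2 h3
  have hmem : MemLp v 4 (slab 0 T) := by
    refine ⟨hv.aestronglyMeasurable, ?_⟩
    rw [eLpNorm_lt_top_iff_lintegral_rpow_enorm_lt_top (by norm_num) (by norm_num)]
    have e4 : ∀ z : ℂ, ‖z‖ₑ ^ (ENNReal.toReal 4) = ‖z‖ₑ ^ 4 := by
      intro z
      rw [show ENNReal.toReal 4 = ((4 : ℕ) : ℝ) by norm_num, ENNReal.rpow_natCast]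
    simp only [e4]
    rw [slab, lintegral_prod _ (hv.measurable.enorm.pow_const 4).aemeasurable]
    refine lt_of_le_of_lt ?_ hu.strichartz
    refine le_trans (le_of_eq (lintegral_congr_ae ?_)) (lintegral_mono_set Set.Ioc_subset_Icc_self)
    filter_upwards [hvu] with t ht
    refine lintegral_congr_ae ?_
    filter_upwards [ht] with x hx
    rw [hx]
  have hcoef : ∀ k, ∀ᵐ r ∂volume.restrict (Set.Ioc 0 T),
      coef (nl v) r k = -Complex.I * fourierCoeff (cubic (u r : Torus → ℂ)) k := by
    intro k
    filter_upwards [hvu] with r hr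
    rw [← fourierCoeff.const_mul, coef]
    refine congrFun (fourierCoeff_congr_ae ?_) k
    filter_upwards [hr] with x hx
    rw [nl, hx, cubic]
  have hint : ∀ k, Integrable (fun r => conj (freeMul r k) * coef (nl v) r k)
      (volume.restrict (Set.Ioc 0 T)) := fun k =>
    isMultiplier_freeMul.integrable_mul_coef ((memLp_nl hmem).integrable one_le_fourThirds) k
  have hduh : ∀ t ∈ Set.Icc 0 T, ∀ k, conj (freeMul t k) * fourierCoeff (u t : Torus → ℂ) k =
      fourierCoeff (u₀ : Torus → ℂ) k + ∫ r in (0 : ℝ)..t, conj (freeMul r k) * coef (nl v) r k := by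
    intro t ht k
    have h1 : fourierCoeff (u t : Torus → ℂ) k = freeMul t k * fourierCoeff (u₀ : Torus → ℂ) k -
        Complex.I * ∫ r in (0 : ℝ)..t, freeMul (t - r) k * fourierCoeff (cubic (u r : Torus → ℂ)) k :=
      hu.duhamel t ht k
    have h2 : ∫ r in (0 : ℝ)..t, conj (freeMul r k) * coef (nl v) r k =
        ∫ r in (0 : ℝ)..t, (-Complex.I * conj (freeMul t k)) *
          (freeMul (t - r) k * fourierCoeff (cubic (u r : Torus → ℂ)) k) := by
      rw [intervalIntegral.integral_of_le ht.1, intervalIntegral.integral_of_le ht.1]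
      refine integral_congr_ae ?_
      filter_upwards [ae_restrict_of_ae_restrict_of_subset (Set.Ioc_subset_Ioc_right ht.2) (hcoef k)]
        with r hr
      rw [hr, sub_eq_add_neg, freeMul_add, ← conj_freeMul r]
      linear_combination (Complex.I * conj (freeMul r k) * fourierCoeff (cubic (u r : Torus → ℂ)) k) *
        conj_mul_freeMul t k
    rw [h2, intervalIntegral.integral_const_mul, h1, mul_sub]
    linear_combination fourierCoeff (u₀ : Torus → ℂ) k * conj_mul_freeMul t k
  refine ⟨S, v, N, hs.le, hs2, hS, hmem, fun t ht A => ?_, fun a t ha hat htT k => ?_, hNtop, ?_⟩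
  · refine le_trans (le_of_eq (Finset.sum_congr rfl fun k _ => ?_)) (hsob t ht A)
    rw [norm_mul, RCLike.norm_conj, norm_freeMul, one_mul]
  · rw [hduh t ⟨ha.trans hat, htT⟩, hduh a ⟨ha, hat.trans htT⟩, add_assoc,
      intervalIntegral.integral_add_adjacent_intervals
        (intervalIntegrable_of_integrable_restrict (hint k) ⟨le_rfl, hT.le⟩ ⟨ha, hat.trans htT⟩)
        (intervalIntegrable_of_integrable_restrict (hint k) ⟨ha, hat.trans htT⟩ ⟨ha.trans hat, htT⟩)]
  · filter_upwards [hlim, ae_slab_mem 0 T] with p hp hpT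
    refine hp.congr fun j => ?_
    refine Finset.sum_congr rfl fun k _ => ?_
    rw [← mul_assoc, freeMul_mul_conj, one_mul]
    have hpT' : p.1 ∈ Set.Icc 0 T := ⟨hpT.1.le, hpT.2⟩
    have hi : d p.1 k = fourierCoeff (u p.1 : Torus → ℂ) k := by
      rw [hd]
      exact Set.indicator_of_mem hpT' _
    rw [hi]

theorem IsNLSSolution.fourierCoeff_zero {s T : ℝ} (hT : 0 < T) {u₀ : L2Torus} {u : ℝ → L2Torus}
    (hu : IsNLSSolution s T u₀ u) (k : ℤ) :
    fourierCoeff (u 0 : Torus → ℂ) k = fourierCoeff (u₀ : Torus → ℂ) k := by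
  rw [hu.duhamel 0 ⟨le_rfl, hT.le⟩ k]
  simp

/-! ### Comparison of the numerical and the exact solution -/

theorem lpNorm_four_le_of_norm_le {f : ℝ × Torus → ℂ} {a b ε : ℝ} (hε : 0 ≤ ε) (hab : a ≤ b)
    (hab' : b - a ≤ 1) (hle : ∀ᵐ p ∂slab a b, ‖f p‖ ≤ ε) : lpNorm f 4 (slab a b) ≤ ε := by
  have h0 : 0 ≤ b - a := by linarith
  refine (lpNorm_mono_ae (memLp_const ε) hle).trans ?_
  rw [lpNorm_const' (by norm_num) (by norm_num), measureReal_def, slab_univ,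
    ENNReal.toReal_ofReal h0, Real.norm_of_nonneg hε]
  have : (b - a) ^ (ENNReal.toReal 4)⁻¹ ≤ 1 := Real.rpow_le_one h0 hab' (by positivity)
  nlinarith

/-- The forcing of a trajectory. -/
def incrSeq (A : Finset ℤ) (τ : ℝ) (b : ℕ → ℤ → ℂ) (n : ℕ) (x : Torus) : ℂ :=
  phaseIncr τ (profile A τ b n x)

/-- The second derivative of the forcing of a trajectory. -/
def incrSeqDeriv₂ (A : Finset ℤ) (τ : ℝ) (b : ℕ → ℤ → ℂ) (n : ℕ) (x : Torus) : ℂ :=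
  phaseIncrDeriv₂ τ (profile A τ b n x) (profile A τ (derivSeq b) n x)
    (profile A τ (derivSeq (derivSeq b)) n x)

/-- The continuous in time interpolation of a trajectory on a block starting at `m τ`. -/
def interpolant (A : Finset ℤ) (τ : ℝ) (b : ℕ → ℤ → ℂ) (m : ℕ) : ℝ × Torus → ℂ :=
  mode A freeMul (b m) + retarded A freeMul (stepMul τ) id (m * τ) (stepFun τ (incrSeq A τ b))

/-- The constant in `Trajectory.lpNorm_incrDeriv₂_le`. -/
def derivConst (M : ℝ) : ℝ := 54 * (18 * M) ^ 2 + 1000 * (6 + 48 * M ^ 2) * (18 * M)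

theorem natCast_sub_nonneg {m n : ℕ} (hmn : m ≤ n) : (0 : ℝ) ≤ (n : ℝ) - m := by
  have : (m : ℝ) ≤ n := by exact_mod_cast hmn
  linarith

/-! ### Decomposition of the error on one block -/

section

variable {A : Finset ℤ} {τ M : ℝ} {b : ℕ → ℤ → ℂ} (h : Trajectory A τ M b) {δ : ℝ}
include h

theorem Trajectory.fourierCoeff_incrSeqDeriv₂ (n : ℕ) (k : ℤ) :
    fourierCoeff (incrSeqDeriv₂ A τ b n) k = -((k : ℂ) ^ 2 * fourierCoeff (incrSeq A τ b n) k) := by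
  have h1 := (h.torusDeriv_incrDeriv n).fourierCoeff (h.bddSeq_incrDeriv₂.1 n) k
  have h2 := (h.torusDeriv_incr n).fourierCoeff (h.bddSeq_incrDeriv.1 n) k
  rw [h2] at h1
  refine h1.trans ?_
  change _ = -((k : ℂ) ^ 2 * fourierCoeff (fun x => phaseIncr τ (profile A τ b n x)) k)
  linear_combination ((k : ℂ) ^ 2 * fourierCoeff (fun x => phaseIncr τ (profile A τ b n x)) k) *
    Complex.I_sq

/-- Replaces the frozen phase under the Duhamel integral by the free one; the price is `diffMul`, of
Strichartz size $\tau$, acting on two derivatives of the forcing. -/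
theorem Trajectory.conj_stepMul_mul_coef (r : ℝ) (k : ℤ) :
    conj (stepMul τ r k) * coef (stepFun τ (incrSeq A τ b)) r k =
      conj (diffMul τ r k) * coef (stepFun τ (incrSeqDeriv₂ A τ b)) r k +
        conj (freeMul r k) * coef (stepFun τ (incrSeq A τ b)) r k := by
  have h1 : coef (stepFun τ (incrSeqDeriv₂ A τ b)) r k =
      -((k : ℂ) ^ 2 * coef (stepFun τ (incrSeq A τ b)) r k) :=
    h.fourierCoeff_incrSeqDeriv₂ (stepIdx τ r) k
  have h2 := congrArg conj (diffMul_mul_sq τ r k)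
  simp only [map_mul, map_sub, map_pow, map_intCast] at h2
  rw [h1]
  linear_combination coef (stepFun τ (incrSeq A τ b)) r k * h2

theorem Trajectory.memLp_profile (p : ℝ≥0∞) (x y : ℝ) :
    MemLp (stepFun τ (profile A τ b)) p (slab x y) := h.bddSeq₀.memLp τ p x y

theorem Trajectory.memLp_incrSeq (p : ℝ≥0∞) (x y : ℝ) :
    MemLp (stepFun τ (incrSeq A τ b)) p (slab x y) := h.bddSeq_incr.memLp τ p x y

theorem Trajectory.memLp_incrSeqDeriv₂ (p : ℝ≥0∞) (x y : ℝ) :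
    MemLp (stepFun τ (incrSeqDeriv₂ A τ b)) p (slab x y) := h.bddSeq_incrDeriv₂.memLp τ p x y

/-- Letting the phases run freely inside the cells changes the profile by `diffMul` applied to its
second derivative, which solves a recursion of the same type. -/
theorem Trajectory.lpNorm_profile_sub_le (hδ : SmallBlock M δ) {m n : ℕ} (hmn : m ≤ n)
    (hle : ((n : ℝ) - m) * τ ≤ δ) :
    lpNorm (fun p => stepFun τ (profile A τ b) p - stepMode A freeMul τ b p) 4
      (slab (m * τ) (n * τ)) ≤ (9 + 972 * derivConst M) * (τ * energy A b m) := by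
  have hτ := h.pos
  have hmn' := natCast_sub_nonneg hmn
  have heq : (fun p => stepFun τ (profile A τ b) p - stepMode A freeMul τ b p)
      =ᵐ[slab (m * τ) (n * τ)] stepMode A (diffMul τ) τ (derivSeq (derivSeq b)) := by
    filter_upwards [stepFun_profile_ae hτ A b m (n * τ)] with p hp
    rw [hp, stepMode, stepMode, stepMode, mode, mode, mode, ← Finset.sum_sub_distrib]
    refine Finset.sum_congr rfl fun k _ => ?_
    have h1 := diffMul_mul_sq τ p.1 k
    simp only [derivSeq]
    linear_combination (b (stepIdx τ p.1) k * expi k p.2) * h1 -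
      (diffMul τ p.1 k * (k : ℂ) ^ 2 * b (stepIdx τ p.1) k * expi k p.2) * Complex.I_sq
  rw [lpNorm_congr heq]
  refine (h.duhamel₂.lpNorm_stepMode_le hτ h.bddSeq_incrDeriv₂ h.supp (isMultiplier_diffMul τ)
    (by positivity) (strichartz_diffMul hτ h.supp) hmn (hle.trans hδ.2.1)).trans ?_
  have h1 := h.lpNorm_incrDeriv₂_le hδ hmn hle
  have h2 : (((n : ℝ) - m) * τ) ^ (1 / 4 : ℝ) ≤ 1 :=
    Real.rpow_le_one (by positivity) (by linarith [hδ.2.1]) (by norm_num)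
  have h3 : l2 A (derivSeq (derivSeq b) m) ≤ energy A b m := le_add_of_nonneg_right (by positivity)
  rw [← derivConst] at h1
  calc _ ≤ 9 * τ * energy A b m + 108 * (9 * τ) * 1 * (derivConst M * energy A b m) := by
        gcongr
        exact lpNorm_nonneg
    _ = _ := by ring

/-- The two functions differ only by the forcing between the last grid point and the current time,
hence by at most $\tau$ times the $\ell^1$ norm of its coefficients. -/
theorem Trajectory.norm_stepMode_sub_interpolant_le {ε : ℝ} {m n : ℕ}
    (hε : ∀ j, m ≤ j → j < n → τ * ∑ k ∈ A, ‖fourierCoeff (incrSeq A τ b j) k‖ ≤ ε)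
    {p : ℝ × Torus} (hp : p.1 ∈ Set.Ioc (m * τ) (n * τ)) :
    ‖stepMode A freeMul τ b p - interpolant A τ b m p‖ ≤ ε := by
  have hτ := h.pos
  obtain ⟨hm, hn⟩ := stepIdx_mem hτ hp
  set j := stepIdx τ p.1 with hj
  have h0 : 0 < p.1 := lt_of_le_of_lt (by positivity) hp.1
  have hjt := mem_Ioc_stepIdx hτ h0
  rw [← hj] at hjt
  have hmj : (m : ℝ) * τ ≤ j * τ := by
    have : (m : ℝ) ≤ j := by exact_mod_cast hm
    gcongr
  refine le_trans ?_ (hε j hm hn)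
  rw [h.duhamel.stepMode_eq hτ h.bddSeq_incr m hp.1, interpolant, Pi.add_apply, Pi.add_apply,
    add_sub_add_left_eq_sub, retarded, retarded, ← Finset.sum_sub_distrib, Finset.mul_sum]
  refine norm_sum_le_of_le _ fun k _ => ?_
  rw [stepTime_eq_stepIdx hτ h0, ← hj, ← sub_mul, ← mul_sub, norm_mul, norm_mul, norm_freeMul, norm_expi,
    one_mul, mul_one]
  have hi := (isMultiplier_stepMul τ).integrable_mul_coef
    ((h.memLp_incrSeq 1 (m * τ) (n * τ)).integrable le_rfl) k
  have hsplit := intervalIntegral.integral_add_adjacent_intervals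
    (intervalIntegrable_of_integrable_restrict hi ⟨le_rfl, hp.1.le.trans hp.2⟩
      (t := j * τ) ⟨hmj, hjt.1.le.trans hp.2⟩)
    (intervalIntegrable_of_integrable_restrict hi (s := j * τ) ⟨hmj, hjt.1.le.trans hp.2⟩
      (t := p.1) ⟨hp.1.le, hp.2⟩)
  change ‖(∫ r in (m * τ)..(j * τ), conj (stepMul τ r k) * coef (stepFun τ (incrSeq A τ b)) r k) -
    ∫ r in (m * τ)..p.1, conj (stepMul τ r k) * coef (stepFun τ (incrSeq A τ b)) r k‖ ≤ _
  rw [← hsplit, sub_add_cancel_left, norm_neg]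
  refine (intervalIntegral.norm_integral_le_of_norm_le_const
    (C := ‖fourierCoeff (incrSeq A τ b j) k‖) fun r hr => ?_).trans ?_
  · rw [Set.uIoc_of_le hjt.1.le] at hr
    rw [norm_mul, RCLike.norm_conj, norm_stepMul, one_mul, coef]
    simp only [stepFun, stepIdx_eq hτ (⟨hr.1, hr.2.trans hjt.2⟩ : r ∈ Set.Ioc (j * τ) ((j + 1) * τ)),
      le_refl]
  · rw [abs_of_nonneg (by linarith [hjt.1]), mul_comm]
    refine mul_le_mul_of_nonneg_right ?_ (norm_nonneg _)
    linarith [hjt.2]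

theorem Trajectory.memLp_interpolant (m : ℕ) (y : ℝ) :
    MemLp (interpolant A τ b m) 4 (slab (m * τ) y) :=
  (memLp_mode isMultiplier_freeMul A (b m) 4 _ _).add (memLp_retarded (A := A) isMultiplier_freeMul
    (isMultiplier_stepMul τ) measurable_id (fun _ ht => ⟨ht.1.le, ht.2⟩)
    ((h.memLp_incrSeq 1 _ _).integrable le_rfl)).1

variable {s T S : ℝ} {c : ℝ → ℤ → ℂ} {v : ℝ × Torus → ℂ} {N : ℕ → ℝ} (hsol : Solution s T S c v N)
include hsol

theorem Trajectory.integral_sub_integral {m n : ℕ} (hn : n * τ ≤ T) {t : ℝ}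
    (ht : t ∈ Set.Icc (m * τ) (n * τ)) (k : ℤ) :
    (∫ r in (m * τ)..t, conj (stepMul τ r k) * coef (stepFun τ (incrSeq A τ b)) r k) -
      ∫ r in (m * τ)..t, conj (freeMul r k) * coef (nl v) r k =
    (∫ r in (m * τ)..t, conj (diffMul τ r k) * coef (stepFun τ (incrSeqDeriv₂ A τ b)) r k) +
      ∫ r in (m * τ)..t, conj (freeMul r k) *
        coef (fun p => stepFun τ (incrSeq A τ b) p - nl v p) r k := by
  have hτ := h.pos
  have hm0 : 0 ≤ (m : ℝ) * τ := by positivity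
  have hG := (h.memLp_incrSeq 1 (m * τ) (n * τ)).integrable le_rfl
  have hF := (h.memLp_incrSeqDeriv₂ 1 (m * τ) (n * τ)).integrable le_rfl
  have hN := (hsol.memLp_nl_slab hm0 hn).integrable one_le_fourThirds
  have hD : Integrable (fun p => stepFun τ (incrSeq A τ b) p - nl v p) (slab (m * τ) (n * τ)) :=
    hG.sub hN
  have hII : ∀ f : ℝ → ℂ, Integrable f (volume.restrict (Set.Ioc (m * τ) (n * τ))) →
      IntervalIntegrable f volume (m * τ) t := fun f hf =>
    intervalIntegrable_of_integrable_restrict hf ⟨le_rfl, ht.1.trans ht.2⟩ ht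
  rw [← intervalIntegral.integral_sub (hII _ ((isMultiplier_stepMul τ).integrable_mul_coef hG k))
    (hII _ (isMultiplier_freeMul.integrable_mul_coef hN k)),
    ← intervalIntegral.integral_add (hII _ ((isMultiplier_diffMul τ).integrable_mul_coef hF k))
    (hII _ (isMultiplier_freeMul.integrable_mul_coef hD k)),
    intervalIntegral.integral_of_le ht.1, intervalIntegral.integral_of_le ht.1]
  refine integral_congr_ae ?_
  filter_upwards [ae_restrict_of_ae_restrict_of_subset (Set.Ioc_subset_Ioc_right ht.2)
    (ae_coef_sub hG hN)] with r hr
  rw [hr, h.conj_stepMul_mul_coef]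
  ring

theorem Trajectory.interpolant_sub_evo {m n : ℕ} (hn : n * τ ≤ T) {p : ℝ × Torus}
    (hp : p.1 ∈ Set.Ioc (m * τ) (n * τ)) : interpolant A τ b m p - evo A c p =
      mode A freeMul (fun k => b m k - c (m * τ) k) p +
        (retarded A freeMul (diffMul τ) id (m * τ) (stepFun τ (incrSeqDeriv₂ A τ b)) p +
          retarded A freeMul freeMul id (m * τ)
            (fun p => stepFun τ (incrSeq A τ b) p - nl v p) p) := by
  have hτ := h.pos
  have hm0 : 0 ≤ (m : ℝ) * τ := by positivity
  rw [hsol.evo_eq hm0 hn A hp, interpolant, Pi.add_apply, Pi.add_apply]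
  simp only [mode, retarded, ← Finset.sum_add_distrib, ← Finset.sum_sub_distrib, id]
  refine Finset.sum_congr rfl fun k _ => ?_
  linear_combination (freeMul p.1 k * expi k p.2) *
    h.integral_sub_integral hsol hn (⟨hp.1.le, hp.2⟩ : p.1 ∈ Set.Icc (m * τ) (n * τ)) k

theorem Trajectory.memLp_forcing_sub {m n : ℕ} (hn : n * τ ≤ T) :
    MemLp (fun p => stepFun τ (incrSeq A τ b) p - nl v p) (4 / 3) (slab (m * τ) (n * τ)) :=
  (h.memLp_incrSeq (4 / 3) _ _).sub (hsol.memLp_nl_slab (by have := h.pos; positivity) hn)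

theorem Trajectory.lpNorm_interpolant_sub_evo_le {m n : ℕ} (hmn : m ≤ n) (hn : n * τ ≤ T)
    (hle : ((n : ℝ) - m) * τ ≤ 1) :
    lpNorm (fun p => interpolant A τ b m p - evo A c p) 4 (slab (m * τ) (n * τ)) ≤
      3 * l2 A (fun k => b m k - c (m * τ) k) +
        (162 * (τ * lpNorm (stepFun τ (incrSeqDeriv₂ A τ b)) (4 / 3) (slab (m * τ) (n * τ))) +
          54 * (((n : ℝ) - m) * τ) ^ (1 / 4 : ℝ) *
            lpNorm (fun p => stepFun τ (incrSeq A τ b) p - nl v p) (4 / 3) (slab (m * τ) (n * τ))) := by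
  have hτ := h.pos
  have hmn' := natCast_sub_nonneg hmn
  have e : (n : ℝ) * τ - m * τ = ((n : ℝ) - m) * τ := by ring
  have hδ0 : 0 ≤ ((n : ℝ) - m) * τ := by positivity
  have hab : (m : ℝ) * τ ≤ n * τ := by linarith
  have hab' : (n : ℝ) * τ - m * τ ≤ 1 := by linarith
  set d : ℤ → ℂ := fun k => b m k - c (m * τ) k with hd
  set F := stepFun τ (incrSeqDeriv₂ A τ b) with hF
  set H : ℝ × Torus → ℂ := fun p => stepFun τ (incrSeq A τ b) p - nl v p with hH
  have hHm : MemLp H (4 / 3) (slab (m * τ) (n * τ)) := h.memLp_forcing_sub hsol hn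
  have hFm : MemLp F (4 / 3) (slab (m * τ) (n * τ)) := h.memLp_incrSeqDeriv₂ _ _ _
  have heq : (fun p => interpolant A τ b m p - evo A c p) =ᵐ[slab (m * τ) (n * τ)]
      mode A freeMul d + (retarded A freeMul (diffMul τ) id (m * τ) F +
        retarded A freeMul freeMul id (m * τ) H) := by
    filter_upwards [ae_slab_mem (m * τ) (n * τ)] with p hp using h.interpolant_sub_evo hsol hn hp
  have hr1 := (memLp_retarded (A := A) isMultiplier_freeMul (isMultiplier_diffMul τ) measurable_id
    (a := m * τ) (b := n * τ) (fun t ht => ⟨ht.1.le, ht.2⟩) (hFm.integrable one_le_fourThirds)).1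
  rw [lpNorm_congr heq]
  refine (lpNorm_add_le (memLp_mode isMultiplier_freeMul A d 4 _ _) (by norm_num)).trans
    (add_le_add ?_ ((lpNorm_add_le hr1 (by norm_num)).trans (add_le_add ?_ ?_)))
  · refine (strichartz_freeMul A _ _ hab hab' d).trans ?_
    have h3 : ((n : ℝ) * τ - m * τ) ^ (1 / 8 : ℝ) ≤ 1 :=
      Real.rpow_le_one (by linarith) hab' (by norm_num)
    have := l2_nonneg A d
    calc _ ≤ 3 * 1 * l2 A d := by gcongr
      _ = _ := by ring
  · refine (retBound_id isMultiplier_freeMul (isMultiplier_diffMul τ) (by norm_num) (by positivity)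
      (strichartz_freeMul A) (strichartz_diffMul hτ h.supp) hab hab' F hFm).trans ?_
    have h3 : ((n : ℝ) * τ - m * τ) ^ (1 / 4 : ℝ) ≤ 1 :=
      Real.rpow_le_one (by linarith) hab' (by norm_num)
    have h4 : 0 ≤ lpNorm F (4 / 3) (slab (m * τ) (n * τ)) := lpNorm_nonneg
    calc _ ≤ 6 * (3 * (9 * τ)) * 1 * lpNorm F (4 / 3) (slab (m * τ) (n * τ)) := by gcongr
      _ = _ := by ring
  · refine (retBound_id isMultiplier_freeMul isMultiplier_freeMul (by norm_num) (by norm_num)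
      (strichartz_freeMul A) (strichartz_freeMul A) hab hab' H hHm).trans (le_of_eq ?_)
    rw [e]
    ring

/-- The Duhamel decomposition of the error at time $n\tau$, now measured by the adjoint estimates:
constant $9\tau$ for the phase difference and $3$ for the difference of the forcings. -/
theorem Trajectory.l2_sub_le {m n : ℕ} (hmn : m ≤ n) (hn : n * τ ≤ T)
    (hle : ((n : ℝ) - m) * τ ≤ 1) :
    l2 A (fun k => b n k - c (n * τ) k) ≤ l2 A (fun k => b m k - c (m * τ) k) +
      (9 * (τ * lpNorm (stepFun τ (incrSeqDeriv₂ A τ b)) (4 / 3) (slab (m * τ) (n * τ))) +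
        3 * lpNorm (fun p => stepFun τ (incrSeq A τ b) p - nl v p) (4 / 3)
          (slab (m * τ) (n * τ))) := by
  have hτ := h.pos
  have hmn' := natCast_sub_nonneg hmn
  have hδ0 : 0 ≤ ((n : ℝ) - m) * τ := by positivity
  have hab : (m : ℝ) * τ ≤ n * τ := by linarith
  have hab' : (n : ℝ) * τ - m * τ ≤ 1 := by linarith
  have hm0 : 0 ≤ (m : ℝ) * τ := by positivity
  set F := stepFun τ (incrSeqDeriv₂ A τ b) with hF
  set H : ℝ × Torus → ℂ := fun p => stepFun τ (incrSeq A τ b) p - nl v p with hH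
  have hHm : MemLp H (4 / 3) (slab (m * τ) (n * τ)) := h.memLp_forcing_sub hsol hn
  have hFm : MemLp F (4 / 3) (slab (m * τ) (n * τ)) := h.memLp_incrSeqDeriv₂ _ _ _
  have h1 : l2 A (fun k => b n k - c (n * τ) k) ≤ l2 A (fun k => (b m k - c (m * τ) k) +
      ((∫ r in (m * τ)..(n * τ), conj (diffMul τ r k) * coef F r k) +
        ∫ r in (m * τ)..(n * τ), conj (freeMul r k) * coef H r k)) := by
    refine l2_mono fun k hk => le_of_eq (congrArg norm ?_)
    have e : b n k = b m k + ∫ r in (m * τ)..(n * τ),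
        conj (stepMul τ r k) * coef (stepFun τ (incrSeq A τ b)) r k :=
      h.duhamel.eq_integral hτ h.bddSeq_incr hmn hk
    rw [← h.integral_sub_integral hsol hn ⟨hab, le_rfl⟩ k, e,
      hsol.duhamel (m * τ) (n * τ) hm0 hab hn k]
    ring
  have h3 : ((n : ℝ) * τ - m * τ) ^ (1 / 8 : ℝ) ≤ 1 :=
    Real.rpow_le_one (by linarith) hab' (by norm_num)
  have h4 : 0 ≤ lpNorm F (4 / 3) (slab (m * τ) (n * τ)) := lpNorm_nonneg
  have h5 : 0 ≤ lpNorm H (4 / 3) (slab (m * τ) (n * τ)) := lpNorm_nonneg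
  refine h1.trans ((l2_add_le _ _ _).trans (add_le_add le_rfl ((l2_add_le _ _ _).trans
    (add_le_add ?_ ?_))))
  · refine ((strichartz_diffMul hτ h.supp).dualBound (isMultiplier_diffMul τ) (by positivity)
      hab hab' F hFm).trans ?_
    calc _ ≤ 9 * τ * 1 * lpNorm F (4 / 3) (slab (m * τ) (n * τ)) := by gcongr
      _ = _ := by ring
  · refine ((strichartz_freeMul A).dualBound isMultiplier_freeMul (by norm_num)
      hab hab' H hHm).trans ?_
    calc _ ≤ 3 * 1 * lpNorm H (4 / 3) (slab (m * τ) (n * τ)) := by gcongr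
      _ = _ := by ring

/-- Splitting defect, namely the quintic remainder with $\tau|w|^2\le\theta$, plus the Lipschitz
bound of the cubic term between $w$ and $v$. -/
theorem Trajectory.lpNorm_forcing_sub_le (hδ : SmallBlock M δ) {m n : ℕ} (hmn : m ≤ n)
    (hn : n * τ ≤ T) (hle : ((n : ℝ) - m) * τ ≤ δ) {θ : ℝ} (hθ0 : 0 ≤ θ)
    (hθ : ∀ j, m ≤ j → j < n → ∀ x, τ * ‖profile A τ b j x‖ ^ 2 ≤ θ) :
    lpNorm (fun p => stepFun τ (incrSeq A τ b) p - nl v p) (4 / 3) (slab (m * τ) (n * τ)) ≤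
      2 * θ * (18 * M) ^ 3 + 2 * ((18 * M) ^ 2 + lpNorm v 4 (slab 0 T) ^ 2) *
        lpNorm (fun p => stepFun τ (profile A τ b) p - v p) 4 (slab (m * τ) (n * τ)) := by
  have hτ := h.pos
  have hM := h.nonneg
  have hm0 : 0 ≤ (m : ℝ) * τ := by positivity
  have hX := h.lpNorm_profile_le hδ hmn hle
  have hR := lpNorm_mono_measure' hsol.memLp (slab_mono hm0 hn)
  have hvm : MemLp v 4 (slab (m * τ) (n * τ)) := hsol.memLp_slab hm0 hn
  set w := stepFun τ (profile A τ b) with hw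
  have hwm : MemLp w 4 (slab (m * τ) (n * τ)) := h.memLp_profile 4 _ _
  have hX0 : 0 ≤ lpNorm w 4 (slab (m * τ) (n * τ)) := lpNorm_nonneg
  have hv0 : 0 ≤ lpNorm v 4 (slab (m * τ) (n * τ)) := lpNorm_nonneg
  have hd0 : 0 ≤ lpNorm (fun p => w p - v p) 4 (slab (m * τ) (n * τ)) := lpNorm_nonneg
  have hadd := lpNorm_le_of_norm_le_add one_le_fourThirds
    (H := fun p => stepFun τ (incrSeq A τ b) p - nl v p) (μ := slab (m * τ) (n * τ))
    (H₁ := fun p => ((2 * θ : ℝ) : ℂ) * (w p * w p * w p)) (H₂ := fun p => nl w p - nl v p)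
    ((memLp_mul_mul hwm hwm hwm).const_mul _) ((memLp_nl hwm).sub (memLp_nl hvm)) (by
      filter_upwards [ae_slab_mem (m * τ) (n * τ)] with p hp
      obtain ⟨hjm, hjn⟩ := stepIdx_mem hτ hp
      have e : stepFun τ (incrSeq A τ b) p - nl v p =
          (phaseIncr τ (w p) + Complex.I * (((‖w p‖ ^ 2 : ℝ) : ℂ) * w p)) + (nl w p - nl v p) := by
        have : stepFun τ (incrSeq A τ b) p = phaseIncr τ (w p) := rfl
        rw [this, nl, nl]
        ring
      rw [e]
      refine (norm_add_le _ _).trans (add_le_add ((norm_phaseIncr_add_cubic_le hτ _).trans ?_) le_rfl)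
      have h1 : τ * ‖w p‖ ^ 2 ≤ θ := hθ _ hjm hjn p.2
      rw [norm_mul, norm_mul, norm_mul, Complex.norm_real, Real.norm_of_nonneg (by positivity)]
      calc 2 * τ * ‖w p‖ ^ 5 = 2 * (τ * ‖w p‖ ^ 2) * (‖w p‖ * ‖w p‖ * ‖w p‖) := by ring
        _ ≤ _ := by gcongr)
  refine hadd.trans (add_le_add ?_ ?_)
  · refine (lpNorm_le_of_norm_le_trilinear (C := 2 * θ) (by positivity) hwm hwm hwm
      (Eventually.of_forall fun p => ?_)).trans ?_
    · rw [norm_mul, norm_mul, norm_mul, Complex.norm_real, Real.norm_of_nonneg (by positivity)]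
    · calc _ ≤ 2 * θ * (18 * M * (18 * M) * (18 * M)) := by gcongr
        _ = _ := by ring
  · refine (lpNorm_le_of_norm_le_cubic_sub hwm hvm
      (Eventually.of_forall fun p => norm_nl_sub_le w v p)).trans ?_
    gcongr

/-- Four successive comparisons: unfreeze the phases, let the forcing act continuously inside cells,
pass to the exact flow on the retained frequencies, and add the discarded ones. -/
theorem Trajectory.lpNorm_profile_sub_solution_le {m n : ℕ} (hn : n * τ ≤ T) :
    lpNorm (fun p => stepFun τ (profile A τ b) p - v p) 4 (slab (m * τ) (n * τ)) ≤
      lpNorm (fun p => stepFun τ (profile A τ b) p - stepMode A freeMul τ b p) 4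
        (slab (m * τ) (n * τ)) +
      lpNorm (fun p => stepMode A freeMul τ b p - interpolant A τ b m p) 4 (slab (m * τ) (n * τ)) +
      lpNorm (fun p => interpolant A τ b m p - evo A c p) 4 (slab (m * τ) (n * τ)) +
      lpNorm (fun p => v p - evo A c p) 4 (slab (m * τ) (n * τ)) := by
  have hτ := h.pos
  have hm0 : 0 ≤ (m : ℝ) * τ := by positivity
  have m1 : MemLp (stepFun τ (profile A τ b)) 4 (slab (m * τ) (n * τ)) := h.memLp_profile 4 _ _
  have m2 : MemLp (stepMode A freeMul τ b) 4 (slab (m * τ) (n * τ)) :=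
    h.duhamel.memLp_stepMode hτ h.bddSeq_incr isMultiplier_freeMul m (n * τ)
  have m3 : MemLp (interpolant A τ b m) 4 (slab (m * τ) (n * τ)) := h.memLp_interpolant m _
  have m4 : MemLp (evo A c) 4 (slab (m * τ) (n * τ)) := hsol.memLp_evo hm0 hn A
  have e : (fun p => stepFun τ (profile A τ b) p - v p) =
      ((((fun p => stepFun τ (profile A τ b) p - stepMode A freeMul τ b p) +
        fun p => stepMode A freeMul τ b p - interpolant A τ b m p) +
        fun p => interpolant A τ b m p - evo A c p) - fun p => v p - evo A c p) := by
    ext p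
    simp only [Pi.add_apply, Pi.sub_apply]
    ring
  rw [e]
  refine (lpNorm_sub_le (((m1.sub m2).add (m2.sub m3)).add (m3.sub m4)) (by norm_num)).trans
    (add_le_add ?_ le_rfl)
  refine (lpNorm_add_le ((m1.sub m2).add (m2.sub m3)) (by norm_num)).trans (add_le_add ?_ le_rfl)
  exact lpNorm_add_le (m1.sub m2) (by norm_num)

end

/-! ### The global error bound -/

theorem derivConst_nonneg {M : ℝ} (hM : 0 ≤ M) : 0 ≤ derivConst M := by
  unfold derivConst
  positivity

/-- Propagation of the error over one block. -/
theorem Solution.exists_block_error {s T S : ℝ} {c : ℝ → ℤ → ℂ} {v : ℝ × Torus → ℂ} {N : ℕ → ℝ}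
    (hsol : Solution s T S c v N) {M K : ℝ} (hM : 0 ≤ M) (hK : 0 ≤ K) :
    ∃ δ > (0 : ℝ), ∃ Λ ≥ (0 : ℝ), ∃ C ≥ (0 : ℝ), ∀ (τ : ℝ) (b : ℕ → ℤ → ℂ),
      Trajectory (stepFreqs τ) τ M b →
      (∀ n : ℕ, n * τ ≤ T → τ * energy (stepFreqs τ) b n ≤ K * τ ^ (s / 2)) →
      ∀ m n : ℕ, m ≤ n → ((n : ℝ) - m) * τ ≤ δ → n * τ ≤ T →
        l2 (stepFreqs τ) (fun k => b n k - c (n * τ) k) ≤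
          Λ * l2 (stepFreqs τ) (fun k => b m k - c (m * τ) k) + C * τ ^ (s / 2) := by
  have hs := hsol.nonneg
  have hs2 := hsol.le_two
  have hS := hsol.bound_nonneg
  set R := lpNorm v 4 (slab 0 T) with hR
  have hR0 : 0 ≤ R := lpNorm_nonneg
  set R' := 3 * S + 54 * R ^ 3 with hR'
  have hR'0 : 0 ≤ R' := by positivity
  set L := 2 * ((18 * M) ^ 2 + R ^ 2) with hL
  have hL0 : 0 ≤ L := by positivity
  -- One $\delta$ for three purposes: the a priori bounds of the scheme, the absorption of the
  -- forcing error, and the contraction in the tail estimate.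
  obtain ⟨δ, hδ0, hδ1, hδ2⟩ := exists_mul_rpow_le
    (2916 * (18 * M) ^ 2 + 54 * L + 1944 * (R ^ 2 + R' ^ 2))
  have hd0 : 0 ≤ δ ^ (1 / 4 : ℝ) := by positivity
  have p1 : 0 ≤ 2916 * (18 * M) ^ 2 * δ ^ (1 / 4 : ℝ) := by positivity
  have p2 : 0 ≤ 54 * L * δ ^ (1 / 4 : ℝ) := by positivity
  have p3 : 0 ≤ 1944 * (R ^ 2 + R' ^ 2) * δ ^ (1 / 4 : ℝ) := by positivity
  have hsum : 2916 * (18 * M) ^ 2 * δ ^ (1 / 4 : ℝ) + 54 * L * δ ^ (1 / 4 : ℝ) +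
      1944 * (R ^ 2 + R' ^ 2) * δ ^ (1 / 4 : ℝ) ≤ 1 / 2 := by linarith
  have hblock : SmallBlock M δ := ⟨hδ0, hδ1, by linarith⟩
  have hLδ : 54 * L * δ ^ (1 / 4 : ℝ) ≤ 1 / 2 := by linarith
  have hRδ : 1944 * (R ^ 2 + R' ^ 2) * δ ^ (1 / 4 : ℝ) ≤ 1 / 2 := by linarith
  set G := derivConst M with hG
  have hG0 : 0 ≤ G := derivConst_nonneg hM
  set c₁ := (9 + 972 * G) * K with hc₁
  set c₂ := 54 * (M ^ 2 + K) ^ 2 + 54 * (M ^ 2 + K) with hc₂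
  set c₃ := 6 * S + 9 * (R + R') with hc₃
  set c₄ := 2 * (6 * (M ^ 2 + K)) * (18 * M) ^ 3 with hc₄
  have hc₁0 : 0 ≤ c₁ := by positivity
  have hc₂0 : 0 ≤ c₂ := by positivity
  have hc₃0 : 0 ≤ c₃ := by positivity
  have hc₄0 : 0 ≤ c₄ := by positivity
  refine ⟨δ, hδ0, 1 + 18 * L, by positivity,
    9 * (G * K) + 6 * (c₄ + L * (c₁ + c₂ + c₃ + 162 * (G * K))), by positivity,
    fun τ b h hE m n hmn hle hn => ?_⟩
  have hτ := h.pos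
  have hmn' := natCast_sub_nonneg hmn
  have hδ' : 0 ≤ ((n : ℝ) - m) * τ := by positivity
  have hm0 : 0 ≤ (m : ℝ) * τ := by positivity
  have hab : (m : ℝ) * τ ≤ n * τ := by linarith
  have e : (n : ℝ) * τ - m * τ = ((n : ℝ) - m) * τ := by ring
  have hq : (((n : ℝ) - m) * τ) ^ (1 / 4 : ℝ) ≤ δ ^ (1 / 4 : ℝ) :=
    Real.rpow_le_rpow hδ' hle (by norm_num)
  set A := stepFreqs τ with hA
  set ε := τ ^ (s / 2) with hε
  have hε0 : 0 ≤ ε := by positivity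
  have hEj : ∀ j : ℕ, j ≤ n → τ * energy A b j ≤ K * ε := fun j hj => hE j (by
    refine le_trans ?_ hn
    have : (j : ℝ) ≤ n := by exact_mod_cast hj
    gcongr)
  set err := l2 A (fun k => b m k - c (m * τ) k) with herr
  have herr0 : 0 ≤ err := l2_nonneg _ _
  set H := lpNorm (fun p => stepFun τ (incrSeq A τ b) p - nl v p) (4 / 3) (slab (m * τ) (n * τ)) with hH
  set F := lpNorm (stepFun τ (incrSeqDeriv₂ A τ b)) (4 / 3) (slab (m * τ) (n * τ)) with hF
  set E := lpNorm (fun p => interpolant A τ b m p - evo A c p) 4 (slab (m * τ) (n * τ)) with hEdef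
  set W := lpNorm (fun p => stepFun τ (profile A τ b) p - v p) 4 (slab (m * τ) (n * τ)) with hW
  have hH0 : 0 ≤ H := lpNorm_nonneg
  have hFle : τ * F ≤ G * K * ε := by
    have h1 : F ≤ G * energy A b m := h.lpNorm_incrDeriv₂_le hblock hmn hle
    calc τ * F ≤ τ * (G * energy A b m) := by gcongr
      _ = G * (τ * energy A b m) := by ring
      _ ≤ G * (K * ε) := mul_le_mul_of_nonneg_left (hEj m hmn) hG0
      _ = _ := by ring
  have hstep : lpNorm (fun p => stepFun τ (profile A τ b) p - stepMode A freeMul τ b p) 4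
      (slab (m * τ) (n * τ)) ≤ c₁ * ε := by
    refine (h.lpNorm_profile_sub_le hblock hmn hle).trans ?_
    rw [← hG, hc₁, mul_assoc]
    exact mul_le_mul_of_nonneg_left (hEj m hmn) (by positivity)
  have hinterp : lpNorm (fun p => stepMode A freeMul τ b p - interpolant A τ b m p) 4
      (slab (m * τ) (n * τ)) ≤ c₂ * ε := by
    refine lpNorm_four_le_of_norm_le (by positivity) hab (by linarith) ?_
    filter_upwards [ae_slab_mem (m * τ) (n * τ)] with p hp
    refine h.norm_stepMode_sub_interpolant_le (fun j _ hj => ?_) hp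
    refine (h.mul_sum_fourierCoeff_incr_le hs2 hK (hEj j hj.le)).trans (le_of_eq ?_)
    rw [hc₂]
    ring
  have htail : lpNorm (fun p => v p - evo A c p) 4 (slab (m * τ) (n * τ)) ≤ c₃ * ε := by
    have hsmall : ((n : ℝ) * τ - m * τ) ^ (1 / 4 : ℝ) * (1944 * (R ^ 2 + R' ^ 2)) ≤ 1 := by
      rw [e]
      have : (((n : ℝ) - m) * τ) ^ (1 / 4 : ℝ) * (1944 * (R ^ 2 + R' ^ 2)) ≤
          δ ^ (1 / 4 : ℝ) * (1944 * (R ^ 2 + R' ^ 2)) := by gcongr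
      linarith
    have h1 := hsol.lpNorm_tail_le hm0 hab hn (by linarith) hsmall
      (K := τ ^ (-(1 / 2) : ℝ)) (by positivity)
    have h2 : (τ ^ (-(1 / 2) : ℝ)) ^ (-s) = ε := by
      rw [← Real.rpow_mul hτ.le, hε]
      congr 1
      ring
    rw [h2] at h1
    exact h1
  have hWle : W ≤ (c₁ + c₂ + c₃) * ε + E := by
    have := h.lpNorm_profile_sub_solution_le hsol (m := m) hn
    rw [← hW, ← hEdef] at this
    linarith
  have hEle : E ≤ 3 * err + (162 * (G * K * ε) + 54 * δ ^ (1 / 4 : ℝ) * H) := by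
    refine (h.lpNorm_interpolant_sub_evo_le hsol hmn hn (by linarith)).trans ?_
    gcongr
  have hHle : H ≤ c₄ * ε + L * W := by
    refine (h.lpNorm_forcing_sub_le hsol hblock hmn hn hle (θ := 6 * (M ^ 2 + K) * ε)
      (by positivity) fun j _ hj x => h.mul_sq_norm_profile_le hs hs2 hK (hEj j hj.le) x).trans
      (le_of_eq ?_)
    rw [hc₄]
    ring
  -- The loop closes: $H$ is controlled by $W$, $W$ by $E$, and $E$ by $H$ with total factor
  -- $54L\delta^{1/4}\le1/2$, so $H$ is absorbed. The term $3\cdot6L$ in $\Lambda$ comes from here.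
  have hHfin : H ≤ 2 * (c₄ + L * (c₁ + c₂ + c₃ + 162 * (G * K))) * ε + 6 * L * err := by
    have h1 : L * W ≤ L * ((c₁ + c₂ + c₃) * ε +
        (3 * err + (162 * (G * K * ε) + 54 * δ ^ (1 / 4 : ℝ) * H))) :=
      mul_le_mul_of_nonneg_left (hWle.trans (add_le_add le_rfl hEle)) hL0
    have h2 : 54 * L * δ ^ (1 / 4 : ℝ) * H ≤ 1 / 2 * H := mul_le_mul_of_nonneg_right hLδ hH0
    linarith
  have hfin := h.l2_sub_le hsol hmn hn (by linarith)
  rw [← herr, ← hF, ← hH] at hfin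
  linarith

/-- Parseval, split at the cutoff: beyond $\tau^{-1/2}$ the numerical solution vanishes and the
exact one is at most $S(\tau^{-1/2})^{-s}=S\tau^{s/2}$. -/
theorem Solution.norm_sub_le {s T S : ℝ} {u : ℝ → L2Torus} {v : ℝ × Torus → ℂ} {N : ℕ → ℝ}
    (hsol : Solution s T S (fun t k => conj (freeMul t k) * fourierCoeff (u t : Torus → ℂ) k) v N)
    {τ : ℝ} (hτ : 0 < τ) (u₀ : L2Torus) {n : ℕ} (hn : n * τ ≤ T) :
    ‖filteredLie τ u₀ n - u (n * τ)‖ ≤ l2 (stepFreqs τ) (fun k => lieCoeff τ u₀ n k -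
      conj (freeMul (n * τ) k) * fourierCoeff (u (n * τ) : Torus → ℂ) k) + S * τ ^ (s / 2) := by
  have hS := hsol.bound_nonneg
  set d : ℤ → ℂ := fun k => lieCoeff τ u₀ n k -
      conj (freeMul (n * τ) k) * fourierCoeff (u (n * τ) : Torus → ℂ) k with hd
  set c : ℤ → ℂ := fun k => conj (freeMul (n * τ) k) * fourierCoeff (u (n * τ) : Torus → ℂ) k with hc
  have hcoef : ∀ k, ‖fourierCoeff ((filteredLie τ u₀ n - u (n * τ) : L2Torus) : Torus → ℂ) k‖ = ‖d k‖ := by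
    intro k
    have : d k = conj (freeMul (n * τ) k) *
        fourierCoeff ((filteredLie τ u₀ n - u (n * τ) : L2Torus) : Torus → ℂ) k := by
      rw [hd, fourierCoeff_coe_sub, mul_sub]
      rfl
    rw [this, norm_mul, RCLike.norm_conj, norm_freeMul, one_mul]
  have hl := l2_nonneg (stepFreqs τ) d
  have hsum := hasSum_sq_norm_fourierCoeff (Lp.memLp (filteredLie τ u₀ n - u (n * τ)))
  rw [← norm_eq_lpNorm] at hsum
  refine le_of_pow_le_pow_left₀ (n := 2) (by norm_num) (by positivity) ?_
  refine hasSum_le_of_sum_le hsum fun B => ?_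
  simp only [hcoef]
  have htail : l2 (B \ stepFreqs τ) c ≤ S * τ ^ (s / 2) := by
    have h1 := hsol.l2_tail_le (t := n * τ) ⟨by positivity, hn⟩ (A := B \ stepFreqs τ)
      (K := τ ^ (-(1 / 2) : ℝ)) (by positivity) fun k hk => (Finset.mem_sdiff.mp hk).2
    refine h1.trans (le_of_eq ?_)
    rw [← Real.rpow_mul hτ.le]
    congr 2
    ring
  have hl' := l2_nonneg (B \ stepFreqs τ) c
  have h1 : ∑ k ∈ B ∩ stepFreqs τ, ‖d k‖ ^ 2 ≤ l2 (stepFreqs τ) d ^ 2 := by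
    rw [l2_sq]
    exact Finset.sum_le_sum_of_subset_of_nonneg Finset.inter_subset_right fun _ _ _ => by positivity
  have h2 : ∑ k ∈ B \ stepFreqs τ, ‖d k‖ ^ 2 = l2 (B \ stepFreqs τ) c ^ 2 := by
    rw [l2_sq]
    refine Finset.sum_congr rfl fun k hk => ?_
    rw [hd, hc]
    simp only
    rw [lieCoeff_eq_zero u₀ n (Finset.mem_sdiff.mp hk).2, zero_sub, norm_neg]
  rw [← Finset.sum_inter_add_sum_sdiff B (stepFreqs τ), h2]
  have h3 : l2 (B \ stepFreqs τ) c ^ 2 ≤ (S * τ ^ (s / 2)) ^ 2 := by gcongr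
  have h4 : 0 ≤ l2 (stepFreqs τ) d * (S * τ ^ (s / 2)) := by positivity
  nlinarith

/-- The filtered Lie splitting scheme converges with order `s / 2`. -/
theorem exists_norm_filteredLie_sub_le (s₀ T : ℝ) (hs₀ : 0 < s₀) (hs₀' : s₀ ≤ 2) (hT : 0 < T)
    (u₀ : L2Torus) (hu₀ : MemSobolev s₀ u₀)
    (u : ℝ → L2Torus) (hu : IsNLSSolution s₀ T u₀ u) :
    ∃ τ₀ > (0 : ℝ), ∃ C > (0 : ℝ), ∀ τ : ℝ, 0 < τ → τ ≤ τ₀ → ∀ n : ℕ, (n : ℝ) * τ ≤ T →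
      ‖filteredLie τ u₀ n - u ((n : ℝ) * τ)‖ ≤ C * τ ^ (s₀ / 2) := by
  obtain ⟨S, v, N, hsol⟩ := hu.exists_solution hs₀ hs₀' hT
  obtain ⟨K, hK, τ₁, hτ₁, henergy⟩ := exists_mul_energy_le (T := T) hs₀.le hs₀' hu₀
  obtain ⟨δ, hδ, Λ, hΛ, C, hC, hblock⟩ := hsol.exists_block_error (norm_nonneg u₀) hK
  have hS := hsol.bound_nonneg
  -- The three bounds on $\tau$ serve the energy estimate, the iteration over blocks and the
  -- trajectory axioms; the summand $1$ only makes the constant positive.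
  refine ⟨min (min τ₁ (δ / 2)) 1, by positivity, (Λ + 1) ^ ⌈2 * T / δ⌉₊ * C + S + 1, by positivity,
    fun τ hτ hττ₀ n hn => ?_⟩
  have h1 : τ ≤ τ₁ := hττ₀.trans ((min_le_left _ _).trans (min_le_left _ _))
  have h2 : τ ≤ δ / 2 := hττ₀.trans ((min_le_left _ _).trans (min_le_right _ _))
  have h3 : τ ≤ 1 := hττ₀.trans (min_le_right _ _)
  set err : ℕ → ℝ := fun n => l2 (stepFreqs τ) fun k => lieCoeff τ u₀ n k -
    conj (freeMul (n * τ) k) * fourierCoeff (u (n * τ) : Torus → ℂ) k with herr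
  -- On the retained frequencies the filtered datum has the coefficients of $u_0$, so the iteration
  -- starts without error.
  have herr0 : err 0 = 0 := by
    have : err 0 ≤ l2 (stepFreqs τ) fun _ => 0 := l2_mono fun k hk => by
      have e := hu.fourierCoeff_zero hT k
      rw [lieCoeff_zero, if_pos hk, Nat.cast_zero, zero_mul, e]
      simp [freeMul]
    exact le_antisymm (this.trans (by simp [l2])) (l2_nonneg _ _)
  have hε : 0 ≤ τ ^ (s₀ / 2) := by positivity
  have hmain := le_of_block_bound hΛ hδ hτ h2 (z := err) (E := C * τ ^ (s₀ / 2)) (T := T)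
    (by positivity) herr0.ge
    (hblock τ (lieCoeff τ u₀) (trajectory_lieCoeff hτ h3 u₀) fun n hn => henergy τ hτ h1 n hn) hn
  rw [herr0, zero_add] at hmain
  refine (hsol.norm_sub_le hτ u₀ hn).trans ?_
  calc _ ≤ (Λ + 1) ^ ⌈2 * T / δ⌉₊ * (C * τ ^ (s₀ / 2)) + S * τ ^ (s₀ / 2) :=
        add_le_add hmain le_rfl
    _ ≤ _ := by linarith

end FilteredNLS

end

theorem theorem1 (s₀ T : ℝ) (hs₀ : 0 < s₀) (hs₀' : s₀ ≤ 2) (hT : 0 < T)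
    (u₀ : FilteredNLS.L2Torus) (hu₀ : FilteredNLS.MemSobolev s₀ u₀)
    (u : ℝ → FilteredNLS.L2Torus) (hu : FilteredNLS.IsNLSSolution s₀ T u₀ u) :
    ∃ τ₀ > (0 : ℝ), ∃ C > (0 : ℝ), ∀ τ : ℝ, 0 < τ → τ ≤ τ₀ → ∀ n : ℕ, (n : ℝ) * τ ≤ T →
      ‖FilteredNLS.filteredLie τ u₀ n - u ((n : ℝ) * τ)‖ ≤ C * τ ^ (s₀ / 2) :=
  FilteredNLS.exists_norm_filteredLie_sub_le s₀ T hs₀ hs₀' hT u₀ hu₀ u hu
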